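/- **Setting.** Let $G=(V,E,w)$ be a connected undirected graph without self-edges or duplicate edges, with $V=\{0,\dots,n-1\}$, $n\ge 2$, $m=|E|$ and edge weights (similarities) $w:E\to\mathbb{R}_{\ge 0}$. The *average-linkage* similarity of two disjoint clusters $X,Y\subseteq V$ is $$\mathcal W(X,Y)=\frac{1}{|X|\,|Y|}\sum_{(x,y)\in \mathrm{Cut}(X,Y)} w(x,y),$$ where $\mathrm{Cut}(X,Y)$ is the set of edges of $G$ between $X$ and $Y$. A *hierarchical agglomerative clustering (HAC) algorithm* starts from the $n$ singleton clusters and performs $n-1$ merges, until a single cluster is left. Each merge replaces two current clusters $X,Y$ that are joined by an edge of the current graph (that is, $\mathrm{Cut}(X,Y)\ne\emptyset$) by $X\cup Y$. The output is the *dendrogram*: the sequence of merges, each with its two child nodes and with the weight $\mathcal W(X,Y)$ of the merged edge at the time of the merge. For $0<\epsilon<1$ the algorithm is *$\epsilon$-close* if every merge $X,Y$ that it performs satisfies $\mathcal W(X,Y)\ge(1-\epsilon)\,\mathcal W_{\max}$, where $\mathcal W_{\max}$ is the largest similarity of an edge of the current graph (of two distinct current clusters joined by an edge of $G$) at that time.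 The model of computation is the real RAM with words of $O(\log n)$ bits: arithmetic, comparisons and memory accesses on words and on real numbers (exact $+,-,\times,/$ and comparison, no rounding of reals to integers) take unit time. The input is $n$, $m$, $\epsilon$ and a list of the edges, in any order, with their weights. **Theorem.** There is a (single, deterministic) program that, given $\epsilon\in(0,1)$ and such a graph $G$, performs $\epsilon$-close HAC for the average-linkage measure and outputs the dendrogram, in $O(m\log^2 n)$ time for every constant $\epsilon$. That is, for every $\epsilon\in(0,1)$ there is a constant $C_\epsilon$ such that on every such input with this $\epsilon$ the program halts after at most $C_\epsilon\, m\log^2 n$ steps. -/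

import Mathlib

/-! ## The machine model

A real RAM with words of logarithmic length. The memory consists of named arrays of words
(natural numbers below a bound `W`) and named arrays of real numbers. A program is a fixed finite
piece of syntax that mentions finitely many arrays. Each arithmetic operation, comparison, test,
memory access and assignment takes one unit of time. An operation on words whose result does not
fit into a word, and a division by zero, have no result: an execution that meets one gets stuck,
that is, it does not count as an execution. -/

namespace RealRAM

/-- The memory: cell `i` of the word array `a` is `word a i`, cell `i` of the real array `a` is
`real a i`. -/
structure Memory where
  word : ℕ → ℕ → ℕ
  real : ℕ → ℕ → ℝ

/-- Expressions for words. -/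
inductive WordExpr where
  | lit (k : ℕ)
  | get (a : ℕ) (i : WordExpr)
  | add (e f : WordExpr)
  | sub (e f : WordExpr)
  | mul (e f : WordExpr)
  | div (e f : WordExpr)

/-- Expressions for real numbers. The only constants are natural numbers, and there is no
conversion from real numbers to words. -/
inductive RealExpr where
  | lit (k : ℕ)
  | ofWord (e : WordExpr)
  | get (a : ℕ) (i : WordExpr)
  | add (e f : RealExpr)
  | sub (e f : RealExpr)
  | mul (e f : RealExpr)
  | div (e f : RealExpr)

/-- Tests. -/
inductive Test where
  | wordLt (e f : WordExpr)
  | wordEq (e f : WordExpr)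
  | realLt (e f : RealExpr)
  | realLe (e f : RealExpr)
  | neg (b : Test)
  | conj (b c : Test)
  | disj (b c : Test)

/-- Programs. -/
inductive Program where
  | skip
  | setWord (a : ℕ) (i : WordExpr) (e : WordExpr)
  | setReal (a : ℕ) (i : WordExpr) (e : RealExpr)
  | seq (p q : Program)
  | ite (b : Test) (p q : Program)
  | loop (b : Test) (p : Program)

/-- The word `k`, if it fits. -/
def fit (W k : ℕ) : Option ℕ := if k < W then some k else none

/-- The value of a word expression; subtraction is truncated at `0`, division rounds down. -/
def WordExpr.eval (W : ℕ) (s : Memory) : WordExpr → Option ℕ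
  | lit k => fit W k
  | get a i => (i.eval W s).map (s.word a)
  | add e f => (e.eval W s).bind fun x => (f.eval W s).bind fun y => fit W (x + y)
  | sub e f => (e.eval W s).bind fun x => (f.eval W s).bind fun y => fit W (x - y)
  | mul e f => (e.eval W s).bind fun x => (f.eval W s).bind fun y => fit W (x * y)
  | div e f => (e.eval W s).bind fun x => (f.eval W s).bind fun y =>
      if y = 0 then none else fit W (x / y)

/-- The value of a real expression. -/
noncomputable def RealExpr.eval (W : ℕ) (s : Memory) : RealExpr → Option ℝ
  | lit k => some (k : ℝ)
  | ofWord e => (e.eval W s).map fun k => (k : ℝ)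
  | get a i => (i.eval W s).map (s.real a)
  | add e f => (e.eval W s).bind fun x => (f.eval W s).bind fun y => some (x + y)
  | sub e f => (e.eval W s).bind fun x => (f.eval W s).bind fun y => some (x - y)
  | mul e f => (e.eval W s).bind fun x => (f.eval W s).bind fun y => some (x * y)
  | div e f => (e.eval W s).bind fun x => (f.eval W s).bind fun y =>
      if y = 0 then none else some (x / y)

/-- The outcome of a test. -/
noncomputable def Test.eval (W : ℕ) (s : Memory) : Test → Option Bool
  | wordLt e f => (e.eval W s).bind fun x => (f.eval W s).bind fun y => some (decide (x < y))
  | wordEq e f => (e.eval W s).bind fun x => (f.eval W s).bind fun y => some (decide (x = y))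
  | realLt e f => (e.eval W s).bind fun x => (f.eval W s).bind fun y => some (decide (x < y))
  | realLe e f => (e.eval W s).bind fun x => (f.eval W s).bind fun y => some (decide (x ≤ y))
  | neg b => (b.eval W s).map fun x => !x
  | conj b c => (b.eval W s).bind fun x => (c.eval W s).bind fun y => some (x && y)
  | disj b c => (b.eval W s).bind fun x => (c.eval W s).bind fun y => some (x || y)

/-- The time to evaluate a word expression: one unit for each constant, operation and access. -/
def WordExpr.time : WordExpr → ℕ
  | lit _ => 1
  | get _ i => i.time + 1
  | add e f => e.time + f.time + 1
  | sub e f => e.time + f.time + 1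
  | mul e f => e.time + f.time + 1
  | div e f => e.time + f.time + 1

/-- The time to evaluate a real expression. -/
def RealExpr.time : RealExpr → ℕ
  | lit _ => 1
  | ofWord e => e.time + 1
  | get _ i => i.time + 1
  | add e f => e.time + f.time + 1
  | sub e f => e.time + f.time + 1
  | mul e f => e.time + f.time + 1
  | div e f => e.time + f.time + 1

/-- The time to evaluate a test. -/
def Test.time : Test → ℕ
  | wordLt e f => e.time + f.time + 1
  | wordEq e f => e.time + f.time + 1
  | realLt e f => e.time + f.time + 1
  | realLe e f => e.time + f.time + 1
  | neg b => b.time + 1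
  | conj b c => b.time + c.time + 1
  | disj b c => b.time + c.time + 1

/-- The memory after writing `x` into cell `i` of the word array `a`. -/
def Memory.setWord (s : Memory) (a i x : ℕ) : Memory :=
  { s with word := Function.update s.word a (Function.update (s.word a) i x) }

/-- The memory after writing `x` into cell `i` of the real array `a`. -/
noncomputable def Memory.setReal (s : Memory) (a i : ℕ) (x : ℝ) : Memory :=
  { s with real := Function.update s.real a (Function.update (s.real a) i x) }

/-- `Exec W p s s' t`: with words below `W`, the program `p` started in the memory `s` halts after
exactly `t` units of time, without getting stuck, and leaves the memory `s'`. -/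
inductive Exec (W : ℕ) : Program → Memory → Memory → ℕ → Prop where
  | skip (s : Memory) : Exec W .skip s s 1
  | setWord {s : Memory} {a : ℕ} {i e : WordExpr} {k x : ℕ}
      (hi : i.eval W s = some k) (he : e.eval W s = some x) :
      Exec W (.setWord a i e) s (s.setWord a k x) (i.time + e.time + 1)
  | setReal {s : Memory} {a : ℕ} {i : WordExpr} {e : RealExpr} {k : ℕ} {x : ℝ}
      (hi : i.eval W s = some k) (he : e.eval W s = some x) :
      Exec W (.setReal a i e) s (s.setReal a k x) (i.time + e.time + 1)
  | seq {p q : Program} {s s₁ s₂ : Memory} {t₁ t₂ : ℕ}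
      (hp : Exec W p s s₁ t₁) (hq : Exec W q s₁ s₂ t₂) :
      Exec W (.seq p q) s s₂ (t₁ + t₂)
  | iteTrue {b : Test} {p q : Program} {s s' : Memory} {t : ℕ}
      (hb : b.eval W s = some true) (hp : Exec W p s s' t) :
      Exec W (.ite b p q) s s' (b.time + 1 + t)
  | iteFalse {b : Test} {p q : Program} {s s' : Memory} {t : ℕ}
      (hb : b.eval W s = some false) (hq : Exec W q s s' t) :
      Exec W (.ite b p q) s s' (b.time + 1 + t)
  | loopTrue {b : Test} {p : Program} {s s₁ s₂ : Memory} {t₁ t₂ : ℕ}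
      (hb : b.eval W s = some true) (hp : Exec W p s s₁ t₁)
      (hl : Exec W (.loop b p) s₁ s₂ t₂) :
      Exec W (.loop b p) s s₂ (b.time + 1 + t₁ + t₂)
  | loopFalse {b : Test} {p : Program} {s : Memory}
      (hb : b.eval W s = some false) :
      Exec W (.loop b p) s s (b.time + 1)

end RealRAM

/-! ## Hierarchical agglomerative clustering with average linkage -/

namespace HAC

/-- The average-linkage similarity of two clusters `X`, `Y` of vertices: the total weight of the
edges between them, divided by `|X| * |Y|`. -/
noncomputable def avgLinkage {n : ℕ} (G : SimpleGraph (Fin n)) [DecidableRel G.Adj]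
    (w : Sym2 (Fin n) → ℝ) (X Y : Finset (Fin n)) : ℝ :=
  (∑ p ∈ G.interedges X Y, w s(p.1, p.2)) / ((X.card : ℝ) * (Y.card : ℝ))

/-- A dendrogram on the leaves `0, …, n - 1`, as the sequence of its merges: merge number `i`
(for `i < n - 1`) joins the nodes `left i` and `right i` into the new node `n + i`, to which it
gives the weight `weight i`. The values for `i ≥ n - 1` have no meaning. -/
structure Dendrogram where
  left : ℕ → ℕ
  right : ℕ → ℕ
  weight : ℕ → ℝ

/-- The cluster of vertices at each node, after the first `i` merges (empty at the nodes that do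
not exist yet). -/
def Dendrogram.cluster (D : Dendrogram) (n : ℕ) : ℕ → ℕ → Finset (Fin n)
  | 0 => fun k => if h : k < n then {⟨k, h⟩} else ∅
  | i + 1 => Function.update (D.cluster n i) (n + i)
      (D.cluster n i (D.left i) ∪ D.cluster n i (D.right i))

/-- The nodes whose clusters are active after the first `i` merges. -/
def Dendrogram.active (D : Dendrogram) (n : ℕ) : ℕ → Finset ℕ
  | 0 => Finset.range n
  | i + 1 => insert (n + i) (((D.active n i).erase (D.left i)).erase (D.right i))

/-- `D.IsEdge G i a b`: after the first `i` merges, `a` and `b` are two different active nodes, and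
some edge of `G` joins their clusters, so that they are joined by an edge in the current graph. -/
def Dendrogram.IsEdge (D : Dendrogram) {n : ℕ} (G : SimpleGraph (Fin n)) [DecidableRel G.Adj]
    (i a b : ℕ) : Prop :=
  a ∈ D.active n i ∧ b ∈ D.active n i ∧ a ≠ b ∧
    (G.interedges (D.cluster n i a) (D.cluster n i b)).Nonempty

/-- The average-linkage similarity of the nodes `a` and `b` after the first `i` merges. -/
noncomputable def Dendrogram.similarity (D : Dendrogram) {n : ℕ} (G : SimpleGraph (Fin n))
    [DecidableRel G.Adj] (w : Sym2 (Fin n) → ℝ) (i a b : ℕ) : ℝ :=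
  avgLinkage G w (D.cluster n i a) (D.cluster n i b)

/-- `D` is a dendrogram of `ε`-close average-linkage clustering of `(G, w)`: each of the `n - 1`
merges is along an edge of the current graph, records the similarity of this edge as the weight
of the new node, and this similarity is at least `(1 - ε) * Wmax`, where `Wmax` is the largest
similarity of an edge of the current graph. -/
def Dendrogram.IsClose (D : Dendrogram) {n : ℕ} (G : SimpleGraph (Fin n)) [DecidableRel G.Adj]
    (w : Sym2 (Fin n) → ℝ) (ε : ℝ) : Prop :=
  ∀ i < n - 1,
    D.IsEdge G i (D.left i) (D.right i) ∧
    D.weight i = D.similarity G w i (D.left i) (D.right i) ∧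
    ∃ Wmax : ℝ,
      IsGreatest {x | ∃ a b, D.IsEdge G i a b ∧ x = D.similarity G w i a b} Wmax ∧
      (1 - ε) * Wmax ≤ D.similarity G w i (D.left i) (D.right i)

/-- `L` lists each edge of `G` exactly once, in any order, and with any order of its ends. -/
def IsEdgeList {n : ℕ} (G : SimpleGraph (Fin n)) (L : List (Fin n × Fin n)) : Prop :=
  (L.map fun p => s(p.1, p.2)).Nodup ∧ ∀ e, e ∈ L.map (fun p => s(p.1, p.2)) ↔ e ∈ G.edgeSet

/-- The memory that holds the input. Word array `0`: the number of vertices, the number of edges.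
Word arrays `1`, `2`: the ends of the listed edges. Real array `0`: the number `ε`. Real array `1`:
the weights of the listed edges. All other cells are `0`. -/
noncomputable def inputMemory {n : ℕ} (L : List (Fin n × Fin n)) (w : Sym2 (Fin n) → ℝ) (ε : ℝ) :
    RealRAM.Memory where
  word a i :=
    if a = 0 then (if i = 0 then n else if i = 1 then L.length else 0)
    else if a = 1 then ((L.map fun p => (p.1 : ℕ)).getD i 0)
    else if a = 2 then ((L.map fun p => (p.2 : ℕ)).getD i 0)
    else 0
  real a i :=
    if a = 0 then (if i = 0 then ε else 0)
    else if a = 1 then ((L.map fun p => w s(p.1, p.2)).getD i 0)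
    else 0

/-- The dendrogram that a memory holds as output: word arrays `3` and `4` hold the nodes that are
merged, real array `2` the weights of the new nodes. -/
def outputDendrogram (s : RealRAM.Memory) : Dendrogram where
  left := s.word 3
  right := s.word 4
  weight := s.real 2

end HAC

/-! ## Reasoning about programs -/

namespace RealRAM

section Memory

variable (s : Memory) (a b i k : ℕ) (x : ℝ)

@[simp] theorem Memory.word_setWord_self :
    (s.setWord a i k).word a = Function.update (s.word a) i k := by
  simp [Memory.setWord]

@[simp] theorem Memory.word_setWord_of_ne {a b : ℕ} (h : b ≠ a) :
    (s.setWord a i k).word b = s.word b := by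
  simp [Memory.setWord, h]

@[simp] theorem Memory.real_setWord : (s.setWord a i k).real = s.real := rfl

@[simp] theorem Memory.real_setReal_self :
    (s.setReal a i x).real a = Function.update (s.real a) i x := by
  simp [Memory.setReal]

@[simp] theorem Memory.real_setReal_of_ne {a b : ℕ} (h : b ≠ a) :
    (s.setReal a i x).real b = s.real b := by
  simp [Memory.setReal, h]

@[simp] theorem Memory.word_setReal : (s.setReal a i x).word = s.word := rfl

end Memory

/-- `Frame A B s s'`: the two memories differ only in the word arrays of `A` and the real arrays
of `B`. -/
def Frame (A B : List ℕ) (s s' : Memory) : Prop :=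
  (∀ a, a ∉ A → s'.word a = s.word a) ∧ ∀ b, b ∉ B → s'.real b = s.real b

theorem Frame.refl (A B : List ℕ) (s : Memory) : Frame A B s s := ⟨fun _ _ => rfl, fun _ _ => rfl⟩

theorem Frame.mono {A B A' B' : List ℕ} {s s' : Memory} (h : Frame A B s s') (hA : A ⊆ A')
    (hB : B ⊆ B') : Frame A' B' s s' :=
  ⟨fun a ha => h.1 a fun h' => ha (hA h'), fun a ha => h.2 a fun h' => ha (hB h')⟩

theorem Frame.trans {A B : List ℕ} {s₁ s₂ s₃ : Memory} (h : Frame A B s₁ s₂)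
    (h' : Frame A B s₂ s₃) : Frame A B s₁ s₃ :=
  ⟨fun a ha => (h'.1 a ha).trans (h.1 a ha), fun a ha => (h'.2 a ha).trans (h.2 a ha)⟩

theorem Frame.setWord {A B : List ℕ} {s s' : Memory} (h : Frame A B s s') {a : ℕ} (ha : a ∈ A)
    (i k : ℕ) : Frame A B s (s'.setWord a i k) :=
  ⟨fun b hb => by
    rw [Memory.word_setWord_of_ne _ _ _ (by rintro rfl; exact hb ha), h.1 b hb], h.2⟩

theorem Frame.setReal {A B : List ℕ} {s s' : Memory} (h : Frame A B s s') {a : ℕ} (ha : a ∈ B)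
    (i : ℕ) (x : ℝ) : Frame A B s (s'.setReal a i x) :=
  ⟨h.1, fun b hb => by
    rw [Memory.real_setReal_of_ne _ _ _ (by rintro rfl; exact hb ha), h.2 b hb]⟩

/-- The rule for loops: `I k s t` holds after `k` rounds that took time `t`. -/
theorem exec_loop {W : ℕ} {b : Test} {p : Program} (I : ℕ → Memory → ℕ → Prop) (N : ℕ)
    (hstep : ∀ k < N, ∀ s t, I k s t → b.eval W s = some true ∧
      ∃ s' t', Exec W p s s' t' ∧ I (k + 1) s' (t + (b.time + 1 + t')))
    (hend : ∀ s t, I N s t → b.eval W s = some false) {s : Memory} (h0 : I 0 s 0) :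
    ∃ s' t, Exec W (.loop b p) s s' (t + (b.time + 1)) ∧ I N s' t := by
  have key : ∀ j k, k + j = N → ∀ s t, I k s t →
      ∃ s' t', Exec W (.loop b p) s s' (t' + (b.time + 1)) ∧ I N s' (t + t') := by
    intro j
    induction j with
    | zero =>
      rintro k rfl s t h
      exact ⟨s, 0, by simpa using Exec.loopFalse (hend s t h), by simpa using h⟩
    | succ j ih =>
      rintro k hk s t h
      obtain ⟨hb, s₁, t₁, he, hI⟩ := hstep k (by omega) s t h
      obtain ⟨s₂, t₂, he₂, hI₂⟩ := ih (k + 1) (by omega) s₁ _ hI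
      refine ⟨s₂, b.time + 1 + t₁ + t₂, ?_, ?_⟩
      · have := Exec.loopTrue hb he he₂
        rwa [← add_assoc] at this
      · rwa [← add_assoc, ← add_assoc, ← add_assoc] at *
  obtain ⟨s', t, h, hI⟩ := key N 0 (by omega) s 0 h0
  exact ⟨s', t, h, by simpa using hI⟩

/-- The rule for loops whose rounds take bounded time. -/
theorem exec_loop_of_le {W : ℕ} {b : Test} {p : Program} (I : ℕ → Memory → Prop) (N T : ℕ)
    (hstep : ∀ k < N, ∀ s, I k s → b.eval W s = some true ∧
      ∃ s' t, Exec W p s s' t ∧ t ≤ T ∧ I (k + 1) s')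
    (hend : ∀ s, I N s → b.eval W s = some false) {s : Memory} (h0 : I 0 s) :
    ∃ s' t, Exec W (.loop b p) s s' t ∧ t ≤ N * (b.time + 1 + T) + (b.time + 1) ∧ I N s' := by
  obtain ⟨s', t, h, hI, ht⟩ := exec_loop (W := W) (b := b) (p := p)
    (fun k s t => I k s ∧ t ≤ k * (b.time + 1 + T)) N
    (fun k hk s t h => by
      obtain ⟨hb, s', t', he, ht', hI⟩ := hstep k hk s h.1
      refine ⟨hb, s', t', he, hI, ?_⟩
      rw [add_one_mul]
      have := h.2
      omega)
    (fun s t h => hend s h.1) (s := s) ⟨h0, by simp⟩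
  exact ⟨s', _, h, by omega, hI⟩

/-- The scalar variable in cell `0` of the word array `a`. -/
abbrev WordExpr.var (a : ℕ) : WordExpr := .get a (.lit 0)

/-- Assignment to the scalar variable in cell `0` of the word array `a`. -/
abbrev Program.assign (a : ℕ) (e : WordExpr) : Program := .setWord a (.lit 0) e

end RealRAM

/-! ## The tournament tree -/

namespace HAC

open RealRAM

/-- The tree on the nodes `1, …, 2 * m - 1`, with leaves `m, …, 2 * m - 1`, has at each inner node
the maximum of its two children. -/
def IsTournament (m : ℕ) (val : ℕ → ℝ) (skip : ℕ) : Prop :=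
  ∀ j, 1 ≤ j → j < m → j ≠ skip → val j = max (val (2 * j)) (val (2 * j + 1))

theorem IsTournament.le_root {m : ℕ} {val : ℕ → ℝ} (h : IsTournament m val 0) :
    ∀ i, 1 ≤ i → i < 2 * m → val i ≤ val 1 := by
  intro i
  induction i using Nat.strong_induction_on with
  | _ i ih =>
    intro h1 h2
    rcases eq_or_lt_of_le h1 with h | h1
    · rw [← h]
    · refine le_trans ?_ (ih (i / 2) (by omega) (by omega) (by omega))
      rw [h (i / 2) (by omega) (by omega) (by omega)]
      rcases Nat.even_or_odd' i with ⟨k, rfl | rfl⟩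
      · rw [show 2 * k / 2 = k by omega]
        exact le_max_left _ _
      · rw [show (2 * k + 1) / 2 = k by omega]
        exact le_max_right _ _

/-- Recompute the values on the path from the node in variable `11` to the root. -/
def siftUp : Program :=
  .loop (.wordLt (.lit 0) (.var 11))
    (.seq
      (.ite (.realLt (.get 4 (.mul (.lit 2) (.var 11)))
          (.get 4 (.add (.mul (.lit 2) (.var 11)) (.lit 1))))
        (.setReal 4 (.var 11) (.get 4 (.add (.mul (.lit 2) (.var 11)) (.lit 1))))
        (.setReal 4 (.var 11) (.get 4 (.mul (.lit 2) (.var 11)))))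
      (.assign 11 (.div (.var 11) (.lit 2))))

theorem exec_siftUp {W m : ℕ} (hW : 2 * m + 2 < W) (d : ℕ) :
    ∀ (s : Memory) (j : ℕ), s.word 11 0 = j → j < 2 ^ d → j < m ∨ j = 0 →
      IsTournament m (s.real 4) j →
      ∃ s' t, Exec W siftUp s s' t ∧ t ≤ 50 * d + 10 ∧ IsTournament m (s'.real 4) 0 ∧
        (∀ i, m ≤ i → s'.real 4 i = s.real 4 i) ∧ Frame [11] [4] s s' := by
  induction d with
  | zero =>
    intro s j hj hd hm hT
    obtain rfl : j = 0 := by simpa using hd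
    refine ⟨s, _, Exec.loopFalse ?_, ?_, hT, fun _ _ => rfl, Frame.refl _ _ _⟩
    · have : 0 < W := by omega
      simp [Test.eval, WordExpr.eval, fit, hj, this]
    · simp [Test.time, WordExpr.time]
  | succ d ih =>
    intro s j hj hd hm hT
    have h0 : 0 < W := by omega
    have h1 : 1 < W := by omega
    have h2 : 2 < W := by omega
    rcases Nat.eq_zero_or_pos j with rfl | hpos
    · refine ⟨s, _, Exec.loopFalse ?_, ?_, hT, fun _ _ => rfl, Frame.refl _ _ _⟩
      · simp [Test.eval, WordExpr.eval, fit, hj, h0]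
      · simp [Test.time, WordExpr.time]
    have hm : j < m := by omega
    have h3 : 2 * j < W := by omega
    have h4 : 2 * j + 1 < W := by omega
    have h5 : j / 2 < W := by omega
    set x : ℝ := max (s.real 4 (2 * j)) (s.real 4 (2 * j + 1)) with hx
    obtain ⟨s₁, t₁, he₁, ht₁, hs₁⟩ : ∃ s₁ t₁, Exec W (.seq
      (.ite (.realLt (.get 4 (.mul (.lit 2) (.var 11)))
          (.get 4 (.add (.mul (.lit 2) (.var 11)) (.lit 1))))
        (.setReal 4 (.var 11) (.get 4 (.add (.mul (.lit 2) (.var 11)) (.lit 1))))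
        (.setReal 4 (.var 11) (.get 4 (.mul (.lit 2) (.var 11)))))
      (.assign 11 (.div (.var 11) (.lit 2)))) s s₁ t₁ ∧ t₁ ≤ 40 ∧
        s₁ = (s.setReal 4 j x).setWord 11 0 (j / 2) := by
      by_cases hlt : s.real 4 (2 * j) < s.real 4 (2 * j + 1)
      · refine ⟨_, _, .seq (.iteTrue ?_ (.setReal (k := j) (x := x) ?_ ?_))
          (.setWord (k := 0) (x := j / 2) ?_ ?_), ?_, rfl⟩
        · simp [Test.eval, RealExpr.eval, WordExpr.eval, fit, hj, h0, h1, h2, h3, h4, hlt]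
        · simp [WordExpr.eval, fit, hj, h0]
        · simp [RealExpr.eval, WordExpr.eval, fit, hj, h0, h1, h2, h3, h4, hx, hlt.le]
        · simp [WordExpr.eval, fit, h0]
        · simp [WordExpr.eval, fit, hj, h0, h2, h5]
        · simp [Test.time, RealExpr.time, WordExpr.time]
      · refine ⟨_, _, .seq (.iteFalse ?_ (.setReal (k := j) (x := x) ?_ ?_))
          (.setWord (k := 0) (x := j / 2) ?_ ?_), ?_, rfl⟩
        · simp only [not_lt] at hlt
          simp [Test.eval, RealExpr.eval, WordExpr.eval, fit, hj, h0, h1, h2, h3, h4, hlt]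
        · simp [WordExpr.eval, fit, hj, h0]
        · simp [RealExpr.eval, WordExpr.eval, fit, hj, h0, h2, h3, hx, not_lt.1 hlt]
        · simp [WordExpr.eval, fit, h0]
        · simp [WordExpr.eval, fit, hj, h0, h2, h5]
        · simp [Test.time, RealExpr.time, WordExpr.time]
    have hval : s₁.real 4 = Function.update (s.real 4) j x := by simp [hs₁]
    obtain ⟨s', t, he, ht, hT', hleaf, hF⟩ := ih s₁ (j / 2) (by simp [hs₁]) (by omega) (by omega)
      (by
        intro i hi1 hi2 hi3
        rw [hval]
        rcases eq_or_ne i j with rfl | hij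
        · rw [Function.update_self, Function.update_of_ne (by omega),
            Function.update_of_ne (by omega)]
        · rw [Function.update_of_ne hij, Function.update_of_ne (by omega),
            Function.update_of_ne (by omega)]
          exact hT i hi1 hi2 hij)
    refine ⟨s', _, Exec.loopTrue ?_ he₁ he, ?_, hT', ?_, ?_⟩
    · simp [Test.eval, WordExpr.eval, fit, hj, h0, hpos]
    · simp [Test.time, WordExpr.time]; omega
    · intro i hi
      rw [hleaf i hi, hval, Function.update_of_ne (by omega)]
    · refine Frame.trans ?_ hF
      rw [hs₁]
      exact ((Frame.refl _ _ s).setReal (by simp) _ _).setWord (by simp) _ _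

/-- Find a leaf with the value of the root; its number goes to variable `11`. -/
def descend : Program :=
  .seq (.assign 11 (.lit 1))
    (.loop (.wordLt (.var 11) (.get 0 (.lit 1)))
      (.ite (.realLt (.get 4 (.mul (.lit 2) (.var 11))) (.get 4 (.var 11)))
        (.assign 11 (.add (.mul (.lit 2) (.var 11)) (.lit 1)))
        (.assign 11 (.mul (.lit 2) (.var 11)))))

theorem exec_descend {W m d : ℕ} (hW : 2 * m + 2 < W) (hm : 1 ≤ m) (hd : m ≤ 2 ^ d) (s : Memory)
    (hsm : s.word 0 1 = m) (hT : IsTournament m (s.real 4) 0) :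
    ∃ e t, Exec W descend s (s.setWord 11 0 (m + e)) t ∧ t ≤ 50 * d + 20 ∧ e < m ∧
      ∀ i, i < m → s.real 4 (m + i) ≤ s.real 4 (m + e) := by
  have h0 : 0 < W := by omega
  have h1 : 1 < W := by omega
  have h2 : 2 < W := by omega
  have key : ∀ d j, 1 ≤ j → j < 2 * m → m ≤ j * 2 ^ d → s.real 4 j = s.real 4 1 →
      ∃ e t, Exec W (.loop (.wordLt (.var 11) (.get 0 (.lit 1)))
        (.ite (.realLt (.get 4 (.mul (.lit 2) (.var 11))) (.get 4 (.var 11)))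
          (.assign 11 (.add (.mul (.lit 2) (.var 11)) (.lit 1)))
          (.assign 11 (.mul (.lit 2) (.var 11))))) (s.setWord 11 0 j) (s.setWord 11 0 (m + e)) t ∧
        t ≤ 50 * d + 10 ∧ e < m ∧ s.real 4 (m + e) = s.real 4 1 := by
    intro d
    induction d with
    | zero =>
      intro j hj1 hj2 hjd hv
      have hmj : m ≤ j := by simpa using hjd
      obtain ⟨e, rfl⟩ := Nat.exists_eq_add_of_le hmj
      refine ⟨e, _, Exec.loopFalse ?_, ?_, by omega, hv⟩
      · simp [Test.eval, WordExpr.eval, fit, h0, h1, hsm]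
      · simp [Test.time, WordExpr.time]
    | succ d ih =>
      intro j hj1 hj2 hjd hv
      by_cases hmj : m ≤ j
      · obtain ⟨e, rfl⟩ := Nat.exists_eq_add_of_le hmj
        refine ⟨e, _, Exec.loopFalse ?_, ?_, by omega, hv⟩
        · simp [Test.eval, WordExpr.eval, fit, h0, h1, hsm]
        · simp [Test.time, WordExpr.time]
      · rw [not_le] at hmj
        have h3 : 2 * j < W := by omega
        have h4 : 2 * j + 1 < W := by omega
        have hmax := hT j hj1 hmj (by omega)
        have hss : ∀ k, (s.setWord 11 0 j).setWord 11 0 k = s.setWord 11 0 k := by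
          intro k; simp [Memory.setWord]
        have hbt : (Test.wordLt (.var 11) (.get 0 (.lit 1))).eval W (s.setWord 11 0 j)
            = some true := by
          simp [Test.eval, WordExpr.eval, fit, h0, h1, hsm, hmj]
        rw [pow_succ] at hjd
        by_cases hlt : s.real 4 (2 * j) < s.real 4 j
        · obtain ⟨e, t, he, ht, hem, hev⟩ := ih (2 * j + 1) (by omega) (by omega)
            (by nlinarith [Nat.pos_of_neZero (2 ^ d)]) (by
              rcases max_choice (s.real 4 (2 * j)) (s.real 4 (2 * j + 1)) with h | h
              · rw [h] at hmax; exact absurd hmax hlt.ne'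
              · rw [h] at hmax; rw [← hmax, hv])
          refine ⟨e, _, .loopTrue hbt (.iteTrue ?_
            (.setWord (k := 0) (x := 2 * j + 1) ?_ ?_)) (by rwa [hss]), ?_, hem, hev⟩
          · simp [Test.eval, RealExpr.eval, WordExpr.eval, fit, h0, h2, h3, hlt]
          · simp [WordExpr.eval, fit, h0]
          · simp [WordExpr.eval, fit, h0, h1, h2, h3, h4]
          · simp [Test.time, RealExpr.time, WordExpr.time]; omega
        · rw [not_lt] at hlt
          obtain ⟨e, t, he, ht, hem, hev⟩ := ih (2 * j) (by omega) (by omega)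
            (by nlinarith) (by
              rw [← hv]
              exact le_antisymm (by rw [hmax]; exact le_max_left _ _) hlt)
          refine ⟨e, _, .loopTrue hbt (.iteFalse ?_
            (.setWord (k := 0) (x := 2 * j) ?_ ?_)) (by rwa [hss]), ?_, hem, hev⟩
          · simp [Test.eval, RealExpr.eval, WordExpr.eval, fit, h0, h2, h3, hlt]
          · simp [WordExpr.eval, fit, h0]
          · simp [WordExpr.eval, fit, h0, h2, h3]
          · simp [Test.time, RealExpr.time, WordExpr.time]; omega
  obtain ⟨e, t, he, ht, hem, hev⟩ := key d 1 le_rfl (by omega) (by simpa using hd) rfl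
  refine ⟨e, _, .seq (.setWord (k := 0) (x := 1) ?_ ?_) he, ?_, hem, ?_⟩
  · simp [WordExpr.eval, fit, h0]
  · simp [WordExpr.eval, fit, h1]
  · simp [WordExpr.time]; omega
  · intro i hi
    rw [hev]
    exact hT.le_root _ (by omega) (by omega)

/-! ## Lists of half-edges and cut weights -/

theorem row_col_eq {n u k u' k' : ℕ} (hk : k < n) (hk' : k' < n) :
    u * n + k = u' * n + k' ↔ u = u' ∧ k = k' := by
  constructor
  · intro h
    have h1 : (u * n + k) / n = u := by
      rw [mul_comm, Nat.mul_add_div (by omega), Nat.div_eq_of_lt hk, add_zero]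
    have h2 : (u' * n + k') / n = u' := by
      rw [mul_comm, Nat.mul_add_div (by omega), Nat.div_eq_of_lt hk', add_zero]
    have hu : u = u' := by rw [← h1, ← h2, h]
    subst hu
    exact ⟨rfl, by omega⟩
  · rintro ⟨rfl, rfl⟩
    rfl

theorem row_col_lt {n q u k : ℕ} (hu : u < n) (hk : k < q) : u * q + k < n * q := by
  have : (u + 1) * q ≤ n * q := Nat.mul_le_mul_right q hu
  rw [add_one_mul] at this
  omega

/-- The rows `u < n` of `lst`, of width `q` and with `len u` entries, list the elements `h` of `H`
with `rep h = u`, each once. -/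
def Lists (n q : ℕ) (lst len rep : ℕ → ℕ) (H : Finset ℕ) : Prop :=
  ∃ pos : ℕ → ℕ,
    (∀ u < n, ∀ k < len u, lst (u * q + k) ∈ H ∧ rep (lst (u * q + k)) = u ∧
      pos (lst (u * q + k)) = k) ∧
    ∀ h ∈ H, rep h < n ∧ pos h < len (rep h) ∧ lst (rep h * q + pos h) = h

section Lists

variable {n q : ℕ} {lst len rep : ℕ → ℕ} {H : Finset ℕ}

theorem Lists.len_eq (hL : Lists n q lst len rep H) {u : ℕ} (hu : u < n) :
    len u = (H.filter fun h => rep h = u).card := by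
  obtain ⟨pos, h1, h2⟩ := hL
  rw [← Finset.card_range (len u)]
  refine Finset.card_bij (fun k _ => lst (u * q + k)) ?_ ?_ ?_
  · intro k hk
    have := h1 u hu k (Finset.mem_range.1 hk)
    exact Finset.mem_filter.2 ⟨this.1, this.2.1⟩
  · intro k hk k' hk' h
    have h3 := h1 u hu k (Finset.mem_range.1 hk)
    have h4 := h1 u hu k' (Finset.mem_range.1 hk')
    rw [← h3.2.2, h, h4.2.2]
  · intro h hh
    obtain ⟨hh', rfl⟩ := Finset.mem_filter.1 hh
    exact ⟨pos h, Finset.mem_range.2 (h2 h hh').2.1, (h2 h hh').2.2⟩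

theorem Lists.len_le (hL : Lists n q lst len rep H) (hH : H ⊆ Finset.range q) {u : ℕ}
    (hu : u < n) : len u ≤ q := by
  rw [hL.len_eq hu]
  simpa using Finset.card_le_card ((Finset.filter_subset _ _).trans hH)

theorem Lists.len_lt (hL : Lists n q lst len rep H) (hH : H ⊆ Finset.range q) {u h : ℕ}
    (hu : u < n) (hh : h ∉ H.filter fun h => rep h = u) (hq : h < q) : len u < q := by
  rw [hL.len_eq hu]
  have : (insert h (H.filter fun h => rep h = u)).card ≤ (Finset.range q).card := by
    refine Finset.card_le_card (Finset.insert_subset (by simpa using hq) ?_)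
    exact (Finset.filter_subset _ _).trans hH
  rw [Finset.card_insert_of_notMem hh, Finset.card_range] at this
  omega

theorem Lists.push (hL : Lists n q lst len rep H) (hH : H ⊆ Finset.range q) {u h : ℕ}
    (hu : u < n) (hh : h ∉ H) (hq : h < q) :
    Lists n q (Function.update lst (u * q + len u) h) (Function.update len u (len u + 1))
      (Function.update rep h u) (insert h H) := by
  have hlen : len u < q := hL.len_lt hH hu (fun h' => hh (Finset.mem_filter.1 h').1) hq
  have hle : ∀ u' < n, len u' ≤ q := fun u' hu' => hL.len_le hH hu'
  obtain ⟨pos, h1, h2⟩ := hL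
  refine ⟨Function.update pos h (len u), ?_, ?_⟩
  · intro u' hu' k hk
    by_cases hc : u' = u ∧ k = len u
    · obtain ⟨rfl, rfl⟩ := hc
      simp
    · have hk' : k < len u' := by
        rcases eq_or_ne u' u with rfl | hne
        · rw [Function.update_self] at hk
          have : k ≠ len u' := fun h => hc ⟨rfl, h⟩
          omega
        · rwa [Function.update_of_ne hne] at hk
      have hne : u' * q + k ≠ u * q + len u := by
        rw [Ne, row_col_eq (lt_of_lt_of_le hk' (hle u' hu')) hlen]
        exact hc
      obtain ⟨h3, h4, h5⟩ := h1 u' hu' k hk'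
      have hne' : lst (u' * q + k) ≠ h := fun h' => hh (h' ▸ h3)
      rw [Function.update_of_ne hne, Function.update_of_ne hne', Function.update_of_ne hne']
      exact ⟨Finset.mem_insert_of_mem h3, h4, h5⟩
  · intro h' hh'
    rcases Finset.mem_insert.1 hh' with rfl | hh'
    · simp [hu]
    · have hne : h' ≠ h := fun h'' => hh (h'' ▸ hh')
      obtain ⟨h3, h4, h5⟩ := h2 h' hh'
      rw [Function.update_of_ne hne, Function.update_of_ne hne]
      refine ⟨h3, ?_, ?_⟩
      · rcases eq_or_ne (rep h') u with h | h
        · rw [h, Function.update_self, ← h]; omega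
        · rwa [Function.update_of_ne h]
      · rw [Function.update_of_ne, h5]
        rw [Ne, row_col_eq (lt_of_lt_of_le h4 (hle _ h3)) hlen]
        rintro ⟨h6, h7⟩
        rw [h6] at h4
        omega

theorem Lists.pop (hL : Lists n q lst len rep H) {v l : ℕ} (hv : v < n) (hl : len v = l + 1) :
    lst (v * q + l) ∈ H ∧ rep (lst (v * q + l)) = v ∧
      Lists n q lst (Function.update len v l) rep (H.erase (lst (v * q + l))) := by
  obtain ⟨pos, h1, h2⟩ := hL
  obtain ⟨h3, h4, h5⟩ := h1 v hv l (by omega)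
  refine ⟨h3, h4, pos, ?_, ?_⟩
  · intro u hu k hk
    have hk' : k < len u ∧ ¬(u = v ∧ k = l) := by
      rcases eq_or_ne u v with rfl | hne
      · rw [Function.update_self] at hk
        omega
      · rw [Function.update_of_ne hne] at hk
        exact ⟨hk, fun h => hne h.1⟩
    obtain ⟨h6, h7, h8⟩ := h1 u hu k hk'.1
    refine ⟨Finset.mem_erase.2 ⟨fun h => hk'.2 ?_, h6⟩, h7, h8⟩
    rw [h] at h7 h8
    exact ⟨h7.symm.trans h4, h8.symm.trans h5⟩
  · intro h hh
    obtain ⟨hne, hh⟩ := Finset.mem_erase.1 hh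
    obtain ⟨h6, h7, h8⟩ := h2 h hh
    refine ⟨h6, ?_, h8⟩
    rcases eq_or_ne (rep h) v with hr | hr
    · rw [hr, Function.update_self]
      have : pos h ≠ l := by
        rintro hp
        rw [hr, hp] at h8
        exact hne h8.symm
      rw [hr] at h7
      omega
    · rwa [Function.update_of_ne hr]

end Lists

/-- Edge `e`, with half-edges `2 * e` and `2 * e + 1`, joins the clusters `a` and `b`. -/
abbrev Joins (rep : ℕ → ℕ) (e a b : ℕ) : Prop :=
  rep (2 * e) = a ∧ rep (2 * e + 1) = b ∨ rep (2 * e) = b ∧ rep (2 * e + 1) = a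

/-- The total weight of the edges below `m` that join the clusters `a` and `b`. -/
noncomputable def cutWeight (wt : ℕ → ℝ) (rep : ℕ → ℕ) (m a b : ℕ) : ℝ :=
  ∑ e ∈ Finset.range m, if Joins rep e a b then wt e else 0

theorem cutWeight_succ (wt : ℕ → ℝ) (rep : ℕ → ℕ) (m a b : ℕ) :
    cutWeight wt rep (m + 1) a b = cutWeight wt rep m a b +
      if Joins rep m a b then wt m else 0 := Finset.sum_range_succ _ _

theorem cutWeight_congr {wt : ℕ → ℝ} {rep rep' : ℕ → ℕ} {m : ℕ} (a b : ℕ)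
    (h : ∀ i < 2 * m, rep i = rep' i) : cutWeight wt rep m a b = cutWeight wt rep' m a b := by
  refine Finset.sum_congr rfl fun e he => ?_
  have he := Finset.mem_range.1 he
  simp only [Joins]
  rw [h _ (by omega), h _ (by omega)]

theorem cutWeight_comm (wt : ℕ → ℝ) (rep : ℕ → ℕ) (m a b : ℕ) :
    cutWeight wt rep m a b = cutWeight wt rep m b a :=
  Finset.sum_congr rfl fun e _ => by simp only [Joins, or_comm]

/-- The effect on the cut weights of moving a half-edge from `v` to `u`. -/
theorem cutWeight_update (wt : ℕ → ℝ) (rep : ℕ → ℕ) {m h a b : ℕ} (u : ℕ) (hh : h < 2 * m)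
    (ha : a ≠ rep h) (hb : b ≠ rep h) :
    cutWeight wt (Function.update rep h u) m a b = cutWeight wt rep m a b +
      if Joins (Function.update rep h u) (h / 2) a b then wt (h / 2) else 0 := by
  have hmem : h / 2 ∈ Finset.range m := Finset.mem_range.2 (by omega)
  unfold cutWeight
  rw [← Finset.sum_erase_add _ _ hmem, ← Finset.sum_erase_add _ _ hmem]
  have h0 : ¬ Joins rep (h / 2) a b := by
    rcases Nat.even_or_odd' h with ⟨k, rfl | rfl⟩
    · rw [show 2 * k / 2 = k by omega, Joins]
      tauto
    · rw [show (2 * k + 1) / 2 = k by omega, Joins]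
      tauto
  rw [if_neg h0, add_zero]
  congr 1
  refine Finset.sum_congr rfl fun e he => ?_
  have hne := (Finset.mem_erase.1 he).1
  simp only [Joins]
  rw [Function.update_of_ne (by omega), Function.update_of_ne (by omega)]

/-- Add the weight of edge number `12` to the cut weight of the clusters `18` and `19`. -/
def addEdge : Program :=
  .seq
    (.setReal 3 (.add (.mul (.var 18) (.get 0 (.lit 0))) (.var 19))
      (.add (.get 3 (.add (.mul (.var 18) (.get 0 (.lit 0))) (.var 19))) (.get 1 (.var 12))))
    (.setReal 3 (.add (.mul (.var 19) (.get 0 (.lit 0))) (.var 18))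
      (.add (.get 3 (.add (.mul (.var 19) (.get 0 (.lit 0))) (.var 18))) (.get 1 (.var 12))))

theorem exec_addEdge {W n a b e : ℕ} (hW : n * n + 2 < W) {s : Memory} (hn : s.word 0 0 = n)
    (ha : s.word 18 0 = a) (hb : s.word 19 0 = b) (he : s.word 12 0 = e) (han : a < n)
    (hbn : b < n) :
    ∃ s' t, Exec W addEdge s s' t ∧ t ≤ 60 ∧
      (∀ x < n, ∀ y < n, x ≠ y → s'.real 3 (x * n + y) = s.real 3 (x * n + y) +
        if a = x ∧ b = y ∨ a = y ∧ b = x then s.real 1 e else 0) ∧ Frame [] [3] s s' := by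
  have h0 : 0 < W := by omega
  have h1 := row_col_lt han hbn
  have h2 := row_col_lt hbn han
  have h3 : a * n + b < W := by omega
  have h4 : b * n + a < W := by omega
  have h5 : a * n < W := by omega
  have h6 : b * n < W := by omega
  set s₁ := s.setReal 3 (a * n + b) (s.real 3 (a * n + b) + s.real 1 e) with hs₁
  refine ⟨s₁.setReal 3 (b * n + a) (s₁.real 3 (b * n + a) + s.real 1 e), _,
    .seq (s₁ := s₁) (.setReal ?_ ?_) (.setReal ?_ ?_), ?_, ?_, ?_⟩
  · simp [WordExpr.eval, fit, h0, h3, h5, ha, hb, hn]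
  · simp [RealExpr.eval, WordExpr.eval, fit, h0, h3, h5, ha, hb, hn, he]
  · simp [s₁, WordExpr.eval, fit, h0, h4, h6, ha, hb, hn]
  · simp [s₁, RealExpr.eval, WordExpr.eval, fit, h0, h4, h6, ha, hb, hn, he]
  · simp [RealExpr.time, WordExpr.time]
  · intro x hx y hy hxy
    simp only [hs₁, Memory.real_setReal_self, Function.update_apply, row_col_eq hy han,
      row_col_eq hy hbn, row_col_eq han hbn]
    grind
  · exact ((Frame.refl _ _ s).setReal (by simp) _ _).setReal (by simp) _ _

/-- Append the half-edge in variable `16` to the list of the cluster in variable `20`. -/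
def push : Program :=
  .seq (.setWord 5 (.add (.mul (.var 20) (.mul (.lit 2) (.get 0 (.lit 1)))) (.get 6 (.var 20)))
    (.var 16))
  (.seq (.setWord 6 (.var 20) (.add (.get 6 (.var 20)) (.lit 1)))
    (.setWord 7 (.var 16) (.var 20)))

theorem exec_push {W n m u h : ℕ} (hW : n * (2 * m) + 2 * m + 2 < W) {s : Memory}
    (hm : s.word 0 1 = m) (hu : s.word 20 0 = u) (hh : s.word 16 0 = h) (hun : u < n)
    (hl : s.word 6 u < 2 * m) :
    ∃ t, Exec W push s (((s.setWord 5 (u * (2 * m) + s.word 6 u) h).setWord 6 u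
      (s.word 6 u + 1)).setWord 7 h u) t ∧ t ≤ 40 := by
  have h0 : 0 < W := by omega
  have h1 : 1 < W := by omega
  have h2 : 2 < W := by omega
  have h3 : 2 * m < W := by omega
  have h4 := row_col_lt hun hl
  have h5 : u * (2 * m) + s.word 6 u < W := by omega
  have h6 : u * (2 * m) < W := by omega
  have h7 : s.word 6 u + 1 < W := by omega
  refine ⟨_, .seq (.setWord ?_ ?_) (.seq (.setWord ?_ ?_) (.setWord ?_ ?_)), ?_⟩
  · simp [WordExpr.eval, fit, h0, h1, h2, h3, hm, hu, h5, h6]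
  · simp [WordExpr.eval, fit, h0, hh]
  · simp [WordExpr.eval, fit, h0, hu]
  · simp [WordExpr.eval, fit, h0, h1, hu, h7]
  · simp [WordExpr.eval, fit, h0, hh]
  · simp [WordExpr.eval, fit, h0, hu]
  · simp [WordExpr.time]

/-! ## Moving half-edges and refreshing keys -/

/-- Put the edge of the half-edge in variable `16` into variable `12`, and the clusters of its
ends into the variables `18` and `19`. -/
def loadEnds : Program :=
  .seq (.assign 12 (.div (.var 16) (.lit 2)))
  (.seq (.assign 18 (.get 7 (.mul (.lit 2) (.var 12))))
    (.assign 19 (.get 7 (.add (.mul (.lit 2) (.var 12)) (.lit 1)))))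

theorem exec_loadEnds {W m h : ℕ} (hW : 2 * m + 2 < W) {s : Memory} (hh : s.word 16 0 = h)
    (hm : h < 2 * m) :
    ∃ t, Exec W loadEnds s (((s.setWord 12 0 (h / 2)).setWord 18 0
      (s.word 7 (2 * (h / 2)))).setWord 19 0 (s.word 7 (2 * (h / 2) + 1))) t ∧ t ≤ 40 := by
  have h0 : 0 < W := by omega
  have h1 : 1 < W := by omega
  have h2 : 2 < W := by omega
  have h3 : h / 2 < W := by omega
  have h4 : 2 * (h / 2) < W := by omega
  have h5 : 2 * (h / 2) + 1 < W := by omega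
  refine ⟨_, .seq (.setWord ?_ ?_) (.seq (.setWord ?_ ?_) (.setWord ?_ ?_)), ?_⟩
  · simp [WordExpr.eval, fit, h0]
  · simp [WordExpr.eval, fit, h0, h2, h3, hh]
  · simp [WordExpr.eval, fit, h0]
  · simp [WordExpr.eval, fit, h0, h2, h4]
  · simp [WordExpr.eval, fit, h0]
  · simp [WordExpr.eval, fit, h0, h1, h2, h4, h5]
  · simp [WordExpr.time]

/-- Move the last half-edge of the cluster in variable `14` to the cluster in variable `20`. -/
def moveStep : Program :=
  .seq (.setWord 6 (.var 14) (.sub (.get 6 (.var 14)) (.lit 1)))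
  (.seq (.assign 16 (.get 5 (.add (.mul (.var 14) (.mul (.lit 2) (.get 0 (.lit 1))))
    (.get 6 (.var 14)))))
  (.seq push (.seq loadEnds addEdge)))

theorem exec_moveStep {W n m u v l : ℕ} (hWn : n * n + 2 < W)
    (hWm : n * (2 * m) + 2 * m + 2 < W) {s : Memory} (hn : s.word 0 0 = n) (hm : s.word 0 1 = m)
    (hu : s.word 20 0 = u) (hv : s.word 14 0 = v) (hun : u < n) (hvn : v < n) (huv : u ≠ v)
    (hL : Lists n (2 * m) (s.word 5) (s.word 6) (s.word 7) (Finset.range (2 * m)))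
    (hl : s.word 6 v = l + 1) :
    ∃ s' t h, Exec W moveStep s s' t ∧ t ≤ 200 ∧ h < 2 * m ∧ s.word 7 h = v ∧
      Lists n (2 * m) (s'.word 5) (s'.word 6) (s'.word 7) (Finset.range (2 * m)) ∧
      s'.word 5 = Function.update (s.word 5) (u * (2 * m) + s.word 6 u) h ∧
      s'.word 6 = Function.update (Function.update (s.word 6) v l) u (s.word 6 u + 1) ∧
      s'.word 7 = Function.update (s.word 7) h u ∧
      (∀ x < n, ∀ y < n, x ≠ y → s'.real 3 (x * n + y) = s.real 3 (x * n + y) +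
        if Joins (s'.word 7) (h / 2) x y then s.real 1 (h / 2) else 0) ∧
      Frame [5, 6, 7, 12, 16, 18, 19] [3] s s' := by
  have h0 : 0 < W := by omega
  have h1 : 1 < W := by omega
  have h2 : 2 < W := by omega
  have h3 : 2 * m < W := by omega
  have hlv : s.word 6 v ≤ 2 * m := hL.len_le (by simp) hvn
  have h4 := row_col_lt hvn (show l < 2 * m by omega)
  have h5 : v * (2 * m) < W := by omega
  have h6 : v * (2 * m) + l < W := by omega
  have h7 : l < W := by omega
  obtain ⟨hH, hrep, hpop⟩ := hL.pop hvn hl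
  set h := s.word 5 (v * (2 * m) + l) with hh
  have hH' : h < 2 * m := Finset.mem_range.1 hH
  set s₁ := (s.setWord 6 v l).setWord 16 0 h with hs₁
  have hw5 : s₁.word 5 = s.word 5 := by simp [hs₁]
  have hw6 : s₁.word 6 = Function.update (s.word 6) v l := by simp [hs₁]
  have hw7 : s₁.word 7 = s.word 7 := by simp [hs₁]
  have hw6u : s₁.word 6 u = s.word 6 u := by rw [hw6, Function.update_of_ne huv]
  rw [← hw5, ← hw6, ← hw7] at hpop
  have hsub : (Finset.range (2 * m)).erase h ⊆ Finset.range (2 * m) := Finset.erase_subset _ _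
  have hlu : s₁.word 6 u < 2 * m := hpop.len_lt (h := h) hsub hun (by simp) hH'
  obtain ⟨t₂, he₂, ht₂⟩ := exec_push (s := s₁) hWm (by simp [hs₁, hm]) (by simp [hs₁, hu])
    (h := h) (by simp [hs₁]) hun hlu
  set s₂ := ((s₁.setWord 5 (u * (2 * m) + s₁.word 6 u) h).setWord 6 u
      (s₁.word 6 u + 1)).setWord 7 h u with hs₂
  obtain ⟨t₃, he₃, ht₃⟩ := exec_loadEnds (W := W) (m := m) (h := h) (s := s₂) (by omega)
    (by simp [hs₂, hs₁]) hH'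
  set s₃ := ((s₂.setWord 12 0 (h / 2)).setWord 18 0
      (s₂.word 7 (2 * (h / 2)))).setWord 19 0 (s₂.word 7 (2 * (h / 2) + 1)) with hs₃
  have hpush := hpop.push hsub hun (Finset.notMem_erase _ _) hH'
  rw [Finset.insert_erase hH] at hpush
  have hv5 : s₂.word 5 = Function.update (s₁.word 5) (u * (2 * m) + s₁.word 6 u) h := by
    simp [hs₂]
  have hv6 : s₂.word 6 = Function.update (s₁.word 6) u (s₁.word 6 u + 1) := by simp [hs₂]
  have hv7 : s₂.word 7 = Function.update (s₁.word 7) h u := by simp [hs₂]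
  rw [← hv5, ← hv6, ← hv7] at hpush
  have hlt : ∀ i < 2 * m, s₂.word 7 i < n := fun i hi => by
    obtain ⟨pos, -, hp⟩ := hpush
    exact (hp i (Finset.mem_range.2 hi)).1
  obtain ⟨s₄, t₄, he₄, ht₄, hA, hF⟩ := exec_addEdge (s := s₃) hWn (by simp [hs₃, hs₂, hs₁, hn])
    (a := s₂.word 7 (2 * (h / 2))) (by simp [hs₃]) (b := s₂.word 7 (2 * (h / 2) + 1))
    (by simp [hs₃]) (e := h / 2) (by simp [hs₃]) (hlt _ (by omega)) (hlt _ (by omega))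
  have hz5 : s₄.word 5 = s₂.word 5 := by rw [hF.1 5 (by simp)]; simp [hs₃]
  have hz6 : s₄.word 6 = s₂.word 6 := by rw [hF.1 6 (by simp)]; simp [hs₃]
  have hz7 : s₄.word 7 = s₂.word 7 := by rw [hF.1 7 (by simp)]; simp [hs₃]
  refine ⟨s₄, _, h, .seq (.setWord (k := v) (x := l) ?_ ?_)
    (.seq (.setWord (k := 0) (x := h) ?_ ?_) (.seq he₂ (.seq he₃ he₄))), ?_, hH', hrep, ?_, ?_,
    ?_, ?_, ?_, ?_⟩
  · simp [WordExpr.eval, fit, h0, hv]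
  · simp [WordExpr.eval, fit, h0, h1, hv, hl, h7]
  · simp [WordExpr.eval, fit, h0]
  · simp [WordExpr.eval, fit, h0, h1, h2, h3, hv, h5, h6, hm, hh]
  · simp [WordExpr.time]; omega
  · rwa [hz5, hz6, hz7]
  · rw [hz5, hv5, hw5, hw6u]
  · rw [hz6, hv6, hw6u, hw6]
  · rw [hz7, hv7, hw7]
  · intro x hx y hy hxy
    rw [hA x hx y hy hxy, hz7]
    simp [hs₃, hs₂, hs₁]
  · refine Frame.trans ?_ (hF.mono (by simp) (by simp))
    rw [hs₃, hs₂, hs₁]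
    repeat' first | exact Frame.refl _ _ _ | refine Frame.setWord ?_ (by simp) _ _

/-- Move all half-edges of the cluster in variable `14` to the cluster in variable `20`. -/
def moveLoop : Program := .loop (.wordLt (.lit 0) (.get 6 (.var 14))) moveStep

theorem exec_moveLoop {W n m u v : ℕ} (hWn : n * n + 2 < W)
    (hWm : n * (2 * m) + 2 * m + 2 < W) {s : Memory} (hn : s.word 0 0 = n) (hm : s.word 0 1 = m)
    (hu : s.word 20 0 = u) (hv : s.word 14 0 = v) (hun : u < n) (hvn : v < n) (huv : u ≠ v)
    (hL : Lists n (2 * m) (s.word 5) (s.word 6) (s.word 7) (Finset.range (2 * m)))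
    (B : ℕ → Prop) (hB : ∀ x, B x → x < n ∧ x ≠ v)
    (hA : ∀ x y, B x → B y → x ≠ y →
      s.real 3 (x * n + y) = cutWeight (s.real 1) (s.word 7) m x y) :
    ∃ s' t, Exec W moveLoop s s' t ∧ t ≤ s.word 6 v * 300 + 20 ∧
      Lists n (2 * m) (s'.word 5) (s'.word 6) (s'.word 7) (Finset.range (2 * m)) ∧
      s'.word 6 u = s.word 6 u + s.word 6 v ∧
      (∀ h < 2 * m, s'.word 7 h = if s.word 7 h = v then u else s.word 7 h) ∧
      (∀ k < s.word 6 u, s.word 7 (s'.word 5 (u * (2 * m) + k)) = u) ∧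
      (∀ k, s.word 6 u ≤ k → k < s'.word 6 u → s.word 7 (s'.word 5 (u * (2 * m) + k)) = v) ∧
      (∀ x y, B x → B y → x ≠ y →
        s'.real 3 (x * n + y) = cutWeight (s.real 1) (s'.word 7) m x y) ∧
      Frame [5, 6, 7, 12, 16, 18, 19] [3] s s' := by
  have h0 : 0 < W := by omega
  let I : ℕ → Memory → Prop := fun k s' =>
    Lists n (2 * m) (s'.word 5) (s'.word 6) (s'.word 7) (Finset.range (2 * m)) ∧
    s'.word 6 u = s.word 6 u + k ∧ s'.word 6 v + k = s.word 6 v ∧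
    (∀ h < 2 * m, s'.word 7 h = s.word 7 h ∨ s.word 7 h = v ∧ s'.word 7 h = u) ∧
    (∀ k < s.word 6 u, s.word 7 (s'.word 5 (u * (2 * m) + k)) = u) ∧
    (∀ k, s.word 6 u ≤ k → k < s'.word 6 u → s.word 7 (s'.word 5 (u * (2 * m) + k)) = v) ∧
    (∀ x y, B x → B y → x ≠ y →
      s'.real 3 (x * n + y) = cutWeight (s.real 1) (s'.word 7) m x y) ∧
    Frame [5, 6, 7, 12, 16, 18, 19] [3] s s'
  refine Exists.elim (exec_loop_of_le (W := W) (b := .wordLt (.lit 0) (.get 6 (.var 14))) (p := moveStep) I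
    (s.word 6 v) 200 (s := s) ?_ ?_ ?_) ?_
  · rintro k hk s₁ ⟨hL₁, h6u, h6v, hrep, hold, hnew, hA₁, hF⟩
    have hv₁ : s₁.word 14 0 = v := by rw [hF.1 14 (by simp), hv]
    obtain ⟨s₂, t, h, he, ht, hh, h7, hL₂, w5, w6, w7, hA₂, hF₂⟩ := exec_moveStep hWn hWm (s := s₁)
      (l := s₁.word 6 v - 1)
      (by rw [hF.1 0 (by simp), hn]) (by rw [hF.1 0 (by simp), hm])
      (by rw [hF.1 20 (by simp), hu]) hv₁ hun hvn huv hL₁ (by omega)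
    have h7' : s.word 7 h = v := by
      rcases hrep h hh with h8 | h8
      · rw [← h8, h7]
      · exact h8.1
    refine ⟨?_, s₂, t, he, ht, hL₂, ?_, ?_, ?_, ?_, ?_, ?_, hF.trans hF₂⟩
    · simp [Test.eval, WordExpr.eval, fit, h0, hv₁]
      omega
    · rw [w6, Function.update_self]; omega
    · rw [w6, Function.update_of_ne huv.symm, Function.update_self]; omega
    · intro i hi
      rw [w7]
      rcases eq_or_ne i h with rfl | hne
      · exact Or.inr ⟨h7', Function.update_self _ _ _⟩
      · rw [Function.update_of_ne hne]; exact hrep i hi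
    · intro k' hk'
      rw [w5, Function.update_of_ne (by omega), hold k' hk']
    · intro k' hk' hk''
      rw [w6, Function.update_self] at hk''
      rw [w5]
      rcases eq_or_ne k' (s₁.word 6 u) with rfl | hne
      · rw [Function.update_self, h7']
      · rw [Function.update_of_ne (by omega)]
        exact hnew k' hk' (by omega)
    · intro x y hx hy hxy
      have hx' := hB x hx
      have hy' := hB y hy
      rw [hA₂ x hx'.1 y hy'.1 hxy, hA₁ x y hx hy hxy, w7,
        cutWeight_update _ _ u hh (by rw [h7]; exact hx'.2) (by rw [h7]; exact hy'.2),
        hF.2 1 (by simp)]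
  · rintro s₁ ⟨-, -, h6v, -, -, -, -, hF⟩
    have hv₁ : s₁.word 14 0 = v := by rw [hF.1 14 (by simp), hv]
    simp [Test.eval, WordExpr.eval, fit, h0, hv₁]
    omega
  · exact ⟨hL, rfl, rfl, fun h _ => Or.inl rfl, fun k hk => by
      obtain ⟨pos, hp, -⟩ := hL
      exact (hp u hun k hk).2.1, fun k hk hk' => by omega, hA, Frame.refl _ _ _⟩
  · rintro s' ⟨t, he, ht, hL', h6u, h6v, hrep, hold, hnew, hA', hF⟩
    refine ⟨s', t, he, ?_, hL', h6u, ?_, hold, hnew, hA', hF⟩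
    · simp only [Test.time, WordExpr.time] at ht
      omega
    · intro h hh
      obtain ⟨pos, -, hp⟩ := hL'
      have hne : s'.word 7 h ≠ v := by
        intro h7
        have := (hp h (Finset.mem_range.2 hh)).2.1
        rw [h7] at this
        omega
      split_ifs with h7
      · rcases hrep h hh with h8 | h8
        · exact absurd (h8.trans h7) hne
        · exact h8.2
      · rcases hrep h hh with h8 | h8
        · exact h8
        · exact absurd h8.1 h7

/-- Restore the tree after a change at the leaf of the edge in variable `12`. -/
def refresh : Program :=
  .seq (.assign 11 (.div (.add (.get 0 (.lit 1)) (.var 12)) (.lit 2))) siftUp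

theorem exec_refresh {W m e d : ℕ} (hW : 2 * m + 2 < W) (hd : m ≤ 2 ^ d) {s : Memory}
    (hm : s.word 0 1 = m) (hse : s.word 12 0 = e) (he : e < m) {val : ℕ → ℝ} {x : ℝ}
    (hval : s.real 4 = Function.update val (m + e) x) (hT : IsTournament m val 0) :
    ∃ s' t, Exec W refresh s s' t ∧ t ≤ 50 * d + 30 ∧ IsTournament m (s'.real 4) 0 ∧
      (∀ e' < m, s'.real 4 (m + e') = if e' = e then x else val (m + e')) ∧
      Frame [11] [4] s s' := by
  have h0 : 0 < W := by omega
  have h1 : 1 < W := by omega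
  have h2 : 2 < W := by omega
  have h3 : m + e < W := by omega
  have h4 : (m + e) / 2 < W := by omega
  obtain ⟨s', t, hex, ht, hT', hleaf, hF⟩ := exec_siftUp hW d (s.setWord 11 0 ((m + e) / 2))
    ((m + e) / 2) (by simp) (by omega) (by omega) (by
      intro j hj1 hj2 hj3
      simp only [Memory.real_setWord, hval]
      rw [Function.update_of_ne (by omega), Function.update_of_ne (by omega),
        Function.update_of_ne (by omega)]
      exact hT j hj1 hj2 (by omega))
  refine ⟨s', _, .seq (.setWord ?_ ?_) hex, ?_, hT', ?_, ?_⟩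
  · simp [WordExpr.eval, fit, h0]
  · simp [WordExpr.eval, fit, h0, h1, h2, h3, h4, hm, hse]
  · simp [WordExpr.time]; omega
  · intro e' he'
    rw [hleaf _ (by omega), Memory.real_setWord, hval, Function.update_apply]
    simp
  · exact ((Frame.refl _ _ s).setWord (by simp) _ _).trans hF

/-- The key of an edge between the clusters `a` and `b`. -/
noncomputable def edgeKey (n : ℕ) (A : ℕ → ℝ) (sz : ℕ → ℕ) (a b : ℕ) : ℝ :=
  if a = b then -1 else A (a * n + b) / (sz a * sz b)

/-- Recompute the key of half-edge number `15` of the cluster in variable `20`. -/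
def touchStep : Program :=
  .seq (.assign 16 (.get 5 (.add (.mul (.var 20) (.mul (.lit 2) (.get 0 (.lit 1)))) (.var 15))))
  (.seq loadEnds
  (.seq (.ite (.wordEq (.var 18) (.var 19))
      (.setReal 4 (.add (.get 0 (.lit 1)) (.var 12)) (.sub (.lit 0) (.lit 1)))
      (.setReal 4 (.add (.get 0 (.lit 1)) (.var 12))
        (.div (.get 3 (.add (.mul (.var 18) (.get 0 (.lit 0))) (.var 19)))
          (.mul (.ofWord (.get 10 (.var 18))) (.ofWord (.get 10 (.var 19)))))))
  (.seq refresh (.assign 15 (.add (.var 15) (.lit 1))))))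

theorem exec_touchStep {W n m d u k h : ℕ} (hWn : n * n + 2 < W)
    (hWm : n * (2 * m) + 2 * m + 2 < W) (hd : m ≤ 2 ^ d) {s : Memory} (hn : s.word 0 0 = n)
    (hm : s.word 0 1 = m) (hu : s.word 20 0 = u) (hk : s.word 15 0 = k) (hun : u < n)
    (hkm : k < 2 * m) (hh : s.word 5 (u * (2 * m) + k) = h) (hhm : h < 2 * m)
    (hrep : ∀ i < 2 * m, s.word 7 i < n ∧ s.word 10 (s.word 7 i) ≠ 0)
    (hT : IsTournament m (s.real 4) 0) :
    ∃ s' t, Exec W touchStep s s' t ∧ t ≤ 50 * d + 200 ∧ IsTournament m (s'.real 4) 0 ∧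
      s'.word 15 0 = k + 1 ∧
      (∀ e < m, s'.real 4 (m + e) = if e = h / 2 then
        edgeKey n (s.real 3) (s.word 10) (s.word 7 (2 * e)) (s.word 7 (2 * e + 1))
        else s.real 4 (m + e)) ∧
      Frame [11, 12, 15, 16, 18, 19] [4] s s' := by
  have h0 : 0 < W := by omega
  have h1 : 1 < W := by omega
  have h2 : 2 < W := by omega
  have h3 : 2 * m < W := by omega
  have h4 := row_col_lt hun hkm
  have h5 : u * (2 * m) < W := by omega
  have h6 : u * (2 * m) + k < W := by omega
  have h7 : m + h / 2 < W := by omega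
  have h8 : k + 1 < W := by omega
  set s₁ := s.setWord 16 0 h with hs₁
  obtain ⟨t₂, he₂, ht₂⟩ := exec_loadEnds (W := W) (m := m) (h := h) (s := s₁) (by omega)
    (by simp [hs₁]) hhm
  set s₂ := ((s₁.setWord 12 0 (h / 2)).setWord 18 0
      (s₁.word 7 (2 * (h / 2)))).setWord 19 0 (s₁.word 7 (2 * (h / 2) + 1)) with hs₂
  obtain ⟨ha, ha'⟩ := hrep (2 * (h / 2)) (by omega)
  obtain ⟨hb, hb'⟩ := hrep (2 * (h / 2) + 1) (by omega)
  set a := s.word 7 (2 * (h / 2)) with hsa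
  set b := s.word 7 (2 * (h / 2) + 1) with hsb
  have h9 := row_col_lt ha hb
  have h10 : a * n < W := by omega
  have h11 : a * n + b < W := by omega
  have h12 : s₂.word 18 0 = a := by simp [hs₂, hs₁, hsa]
  have h13 : s₂.word 19 0 = b := by simp [hs₂, hs₁, hsb]
  have h14 : s₂.word 12 0 = h / 2 := by simp [hs₂]
  have h15 : s₂.word 0 = s.word 0 := by simp [hs₂, hs₁]
  have h16 : s₂.word 10 = s.word 10 := by simp [hs₂, hs₁]
  have h17 : s₂.real = s.real := by simp [hs₂, hs₁]
  set x := edgeKey n (s.real 3) (s.word 10) a b with hx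
  set s₃ := s₂.setReal 4 (m + h / 2) x with hs₃
  obtain ⟨t₃, he₃, ht₃⟩ : ∃ t, Exec W (.ite (.wordEq (.var 18) (.var 19))
      (.setReal 4 (.add (.get 0 (.lit 1)) (.var 12)) (.sub (.lit 0) (.lit 1)))
      (.setReal 4 (.add (.get 0 (.lit 1)) (.var 12))
        (.div (.get 3 (.add (.mul (.var 18) (.get 0 (.lit 0))) (.var 19)))
          (.mul (.ofWord (.get 10 (.var 18))) (.ofWord (.get 10 (.var 19))))))) s₂ s₃ t ∧
      t ≤ 60 := by
    by_cases hab : a = b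
    · refine ⟨_, .iteTrue ?_ (.setReal ?_ ?_), ?_⟩
      · simp [Test.eval, WordExpr.eval, fit, h0, h12, h13, hab]
      · simp [WordExpr.eval, fit, h0, h1, h14, h15, hm, h7]
      · simp [RealExpr.eval, hx, edgeKey, hab]
      · simp [Test.time, RealExpr.time, WordExpr.time]
    · refine ⟨_, .iteFalse ?_ (.setReal ?_ ?_), ?_⟩
      · simp [Test.eval, WordExpr.eval, fit, h0, h12, h13, hab]
      · simp [WordExpr.eval, fit, h0, h1, h14, h15, hm, h7]
      · simp [RealExpr.eval, WordExpr.eval, fit, h0, h12, h13, h15, h16, h17, hn, h10, h11,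
          ha', hb', hx, edgeKey, hab]
      · simp [Test.time, RealExpr.time, WordExpr.time]
  obtain ⟨s₄, t₄, he₄, ht₄, hT₄, hleaf, hF⟩ := exec_refresh (W := W) (val := s.real 4) (s := s₃) (m := m) (e := h / 2)
    (by omega) hd (by simp [hs₃, h15, hm]) (by simp [hs₃, h14]) (by omega) (x := x)
    (by simp [hs₃, h17]) hT
  have hk₄ : s₄.word 15 0 = k := by rw [hF.1 15 (by simp)]; simp [hs₃, hs₂, hs₁, hk]
  refine ⟨s₄.setWord 15 0 (k + 1), _, .seq (.setWord (k := 0) (x := h) ?_ ?_)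
    (.seq he₂ (.seq he₃ (.seq he₄ (.setWord ?_ ?_)))), ?_, ?_, ?_, ?_, ?_⟩
  · simp [WordExpr.eval, fit, h0]
  · simp [WordExpr.eval, fit, h0, h1, h2, h3, hm, hu, hk, h5, h6, hh]
  · simp [WordExpr.eval, fit, h0]
  · simp [WordExpr.eval, fit, h0, h1, hk₄, h8]
  · simp [WordExpr.time]; omega
  · simpa using hT₄
  · simp
  · intro e he
    rw [Memory.real_setWord, hleaf e he]
    split_ifs with heh
    · rw [heh]
    · rfl
  · refine Frame.setWord (Frame.trans ?_ (hF.mono (by simp) (by simp))) (by simp) _ _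
    rw [hs₃, hs₂, hs₁]
    refine Frame.setReal ?_ (by simp) _ _
    repeat' first | exact Frame.refl _ _ _ | refine Frame.setWord ?_ (by simp) _ _

/-- Recompute the keys of the half-edges of the cluster in variable `20`, from the position in
variable `15` on. -/
def touchLoop : Program := .loop (.wordLt (.var 15) (.get 6 (.var 20))) touchStep

theorem exec_touchLoop {W n m d u k : ℕ} (hWn : n * n + 2 < W)
    (hWm : n * (2 * m) + 2 * m + 2 < W) (hd : m ≤ 2 ^ d) {s : Memory} (hn : s.word 0 0 = n)
    (hm : s.word 0 1 = m) (hu : s.word 20 0 = u) (hk : s.word 15 0 = k) (hun : u < n)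
    (hkl : k ≤ s.word 6 u) (hl : s.word 6 u ≤ 2 * m)
    (hh : ∀ i < s.word 6 u, s.word 5 (u * (2 * m) + i) < 2 * m)
    (hrep : ∀ i < 2 * m, s.word 7 i < n ∧ s.word 10 (s.word 7 i) ≠ 0)
    (hT : IsTournament m (s.real 4) 0) :
    ∃ s' t, Exec W touchLoop s s' t ∧ t ≤ (s.word 6 u - k) * (50 * d + 300) + 20 ∧
      IsTournament m (s'.real 4) 0 ∧
      (∀ i, k ≤ i → i < s.word 6 u → ∀ e, s.word 5 (u * (2 * m) + i) / 2 = e →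
        s'.real 4 (m + e) =
        edgeKey n (s.real 3) (s.word 10) (s.word 7 (2 * e)) (s.word 7 (2 * e + 1))) ∧
      (∀ e < m, (∀ i, k ≤ i → i < s.word 6 u → s.word 5 (u * (2 * m) + i) / 2 ≠ e) →
        s'.real 4 (m + e) = s.real 4 (m + e)) ∧
      Frame [11, 12, 15, 16, 18, 19] [4] s s' := by
  have h0 : 0 < W := by omega
  let I : ℕ → Memory → Prop := fun r s' =>
    IsTournament m (s'.real 4) 0 ∧ s'.word 15 0 = k + r ∧
      (∀ i, k ≤ i → i < k + r → ∀ e, s.word 5 (u * (2 * m) + i) / 2 = e →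
        s'.real 4 (m + e) =
        edgeKey n (s.real 3) (s.word 10) (s.word 7 (2 * e)) (s.word 7 (2 * e + 1))) ∧
      (∀ e < m, (∀ i, k ≤ i → i < k + r → s.word 5 (u * (2 * m) + i) / 2 ≠ e) →
        s'.real 4 (m + e) = s.real 4 (m + e)) ∧
      Frame [11, 12, 15, 16, 18, 19] [4] s s'
  refine Exists.elim (exec_loop_of_le (W := W) (b := .wordLt (.var 15) (.get 6 (.var 20))) (p := touchStep) I
    (s.word 6 u - k) (50 * d + 200) (s := s) ?_ ?_ ?_) ?_
  · rintro r hr s₁ ⟨hT₁, h15, hkey, hold, hF⟩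
    have hw : ∀ a, a ∉ [11, 12, 15, 16, 18, 19] → s₁.word a = s.word a := hF.1
    have hi : s.word 5 (u * (2 * m) + (k + r)) < 2 * m := hh (k + r) (by omega)
    obtain ⟨s₂, t, he, ht, hT₂, h15', hkey₂, hF₂⟩ := exec_touchStep (s := s₁) (u := u)
      (h := s.word 5 (u * (2 * m) + (k + r))) hWn hWm hd
      (by rw [hw 0 (by simp), hn]) (by rw [hw 0 (by simp), hm]) (by rw [hw 20 (by simp), hu]) h15
      hun (by omega) (by rw [hw 5 (by simp)]) hi
      (by rw [hw 7 (by simp), hw 10 (by simp)]; exact hrep) hT₁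
    rw [hw 7 (by simp), hw 10 (by simp), hF.2 3 (by simp)] at hkey₂
    refine ⟨?_, s₂, t, he, ht, hT₂, by omega, ?_, ?_, hF.trans hF₂⟩
    · simp [Test.eval, WordExpr.eval, fit, h0, h15, hw 20 (by simp), hw 6 (by simp), hu]
      omega
    · intro i hki hik e hie
      have hem : e < m := by
        have := hh i (by omega)
        omega
      rw [hkey₂ e hem]
      split_ifs with h
      · rfl
      · refine hkey i hki ?_ e hie
        have : i ≠ k + r := by
          rintro rfl
          exact h hie.symm
        omega
    · intro e hem hne
      rw [hkey₂ e hem, if_neg (hne (k + r) (by omega) (by omega)).symm]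
      exact hold e hem fun i hi1 hi2 => hne i hi1 (by omega)
  · rintro s₁ ⟨-, h15, -, -, hF⟩
    simp [Test.eval, WordExpr.eval, fit, h0, h15, hF.1 20 (by simp), hF.1 6 (by simp), hu]
    omega
  · exact ⟨hT, hk, fun i _ _ => by omega, fun _ _ _ => rfl, Frame.refl _ _ _⟩
  · rintro s' ⟨t, he, ht, hT', -, hkey, hold, hF⟩
    rw [Nat.add_sub_cancel' hkl] at hkey hold
    refine ⟨s', t, he, ?_, hT', hkey, hold, hF⟩
    simp only [Test.time, WordExpr.time] at ht
    refine ht.trans (Nat.add_le_add (Nat.mul_le_mul_left _ (by omega)) (by omega))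

/-! ## One merge -/

/-- Find an edge of largest key, and put the larger one of its two clusters into variable `20` and
the other one into variable `14`. -/
def select : Program :=
  .seq descend
  (.seq (.assign 16 (.mul (.lit 2) (.sub (.var 11) (.get 0 (.lit 1)))))
  (.seq loadEnds
    (.ite (.wordLt (.get 9 (.var 18)) (.get 9 (.var 19)))
      (.seq (.assign 20 (.var 19)) (.assign 14 (.var 18)))
      (.seq (.assign 20 (.var 18)) (.assign 14 (.var 19))))))

theorem exec_select {W m d : ℕ} (hW : 2 * m + 2 < W) (hm : 1 ≤ m) (hd : m ≤ 2 ^ d) {s : Memory}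
    (hsm : s.word 0 1 = m) (hT : IsTournament m (s.real 4) 0) :
    ∃ s' t e u v, Exec W select s s' t ∧ t ≤ 50 * d + 120 ∧ e < m ∧
      (∀ i < m, s.real 4 (m + i) ≤ s.real 4 (m + e)) ∧ Joins (s.word 7) e u v ∧
      s.word 9 v ≤ s.word 9 u ∧ s'.word 20 0 = u ∧ s'.word 14 0 = v ∧
      Frame [11, 12, 14, 16, 18, 19, 20] [] s s' := by
  have h0 : 0 < W := by omega
  have h1 : 1 < W := by omega
  have h2 : 2 < W := by omega
  obtain ⟨e, t₁, he₁, ht₁, hem, hmax⟩ := exec_descend hW hm hd s hsm hT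
  have h3 : 2 * e < W := by omega
  have h4 : e < W := by omega
  set s₁ := s.setWord 11 0 (m + e) with hs₁
  set s₂ := s₁.setWord 16 0 (2 * e) with hs₂
  obtain ⟨t₂, he₂, ht₂⟩ : ∃ t, Exec W (.assign 16 (.mul (.lit 2) (.sub (.var 11)
      (.get 0 (.lit 1))))) s₁ s₂ t ∧ t ≤ 20 := by
    refine ⟨_, .setWord ?_ ?_, ?_⟩
    · simp [WordExpr.eval, fit, h0]
    · simp [hs₁, WordExpr.eval, fit, h0, h1, h2, h3, h4, hsm]
    · simp [WordExpr.time]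
  obtain ⟨t₃, he₃, ht₃⟩ := exec_loadEnds (W := W) (m := m) (h := 2 * e) (s := s₂) hW
    (by simp [hs₂]) (by omega)
  rw [show 2 * e / 2 = e by omega] at he₃
  set a := s.word 7 (2 * e) with ha
  set b := s.word 7 (2 * e + 1) with hb
  have ha' : s₂.word 7 (2 * e) = a := by simp [hs₂, hs₁, ha]
  have hb' : s₂.word 7 (2 * e + 1) = b := by simp [hs₂, hs₁, hb]
  rw [ha', hb'] at he₃
  set s₃ := ((s₂.setWord 12 0 e).setWord 18 0 a).setWord 19 0 b with hs₃
  have h18 : s₃.word 18 0 = a := by simp [hs₃]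
  have h19 : s₃.word 19 0 = b := by simp [hs₃]
  have h9 : s₃.word 9 = s.word 9 := by simp [hs₃, hs₂, hs₁]
  have hF₃ : Frame [11, 12, 14, 16, 18, 19, 20] [] s s₃ := by
    rw [hs₃, hs₂, hs₁]
    repeat' first | exact Frame.refl _ _ _ | refine Frame.setWord ?_ (by simp) _ _
  by_cases hlt : s.word 9 a < s.word 9 b
  · refine ⟨(s₃.setWord 20 0 b).setWord 14 0 a, _, e, b, a,
      .seq he₁ (.seq he₂ (.seq he₃ (.iteTrue ?_ (.seq (.setWord ?_ ?_) (.setWord ?_ ?_))))),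
      ?_, hem, hmax, Or.inr ⟨rfl, rfl⟩, hlt.le, by simp, by simp,
      (hF₃.setWord (by simp) _ _).setWord (by simp) _ _⟩
    · simp [Test.eval, WordExpr.eval, fit, h0, h18, h19, h9, hlt]
    · simp [WordExpr.eval, fit, h0]
    · simp [WordExpr.eval, fit, h0, h19]
    · simp [WordExpr.eval, fit, h0]
    · simp [WordExpr.eval, fit, h0, h18]
    · simp [Test.time, WordExpr.time]; omega
  · refine ⟨(s₃.setWord 20 0 a).setWord 14 0 b, _, e, a, b,
      .seq he₁ (.seq he₂ (.seq he₃ (.iteFalse ?_ (.seq (.setWord ?_ ?_) (.setWord ?_ ?_))))),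
      ?_, hem, hmax, Or.inl ⟨rfl, rfl⟩, not_lt.1 hlt, by simp, by simp,
      (hF₃.setWord (by simp) _ _).setWord (by simp) _ _⟩
    · simp [Test.eval, WordExpr.eval, fit, h0, h18, h19, h9, not_lt.1 hlt]
    · simp [WordExpr.eval, fit, h0]
    · simp [WordExpr.eval, fit, h0, h18]
    · simp [WordExpr.eval, fit, h0]
    · simp [WordExpr.eval, fit, h0, h19]
    · simp [Test.time, WordExpr.time]; omega

/-- Output merge number `17`, of the clusters in the variables `20` and `14`. -/
def record : Program :=
  .seq (.setWord 3 (.var 17) (.get 8 (.var 20)))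
  (.seq (.setWord 4 (.var 17) (.get 8 (.var 14)))
  (.seq (.setReal 2 (.var 17)
    (.div (.get 3 (.add (.mul (.var 20) (.get 0 (.lit 0))) (.var 14)))
      (.mul (.ofWord (.get 9 (.var 20))) (.ofWord (.get 9 (.var 14))))))
  (.seq (.setWord 8 (.var 20) (.add (.get 0 (.lit 0)) (.var 17)))
  (.seq (.setWord 9 (.var 20) (.add (.get 9 (.var 20)) (.get 9 (.var 14))))
    (.assign 15 (.get 6 (.var 20)))))))

theorem exec_record {W n u v i : ℕ} (hW : n * n + 2 < W) {s : Memory} (hn : s.word 0 0 = n)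
    (hu : s.word 20 0 = u) (hv : s.word 14 0 = v) (hi : s.word 17 0 = i) (hun : u < n)
    (hvn : v < n) (hni : n + i < W) (hu0 : s.word 9 u ≠ 0) (hv0 : s.word 9 v ≠ 0)
    (huv : s.word 9 u + s.word 9 v < W) :
    ∃ t, Exec W record s ((((((s.setWord 3 i (s.word 8 u)).setWord 4 i (s.word 8 v)).setReal 2 i
      (s.real 3 (u * n + v) / (s.word 9 u * s.word 9 v))).setWord 8 u (n + i)).setWord 9 u
      (s.word 9 u + s.word 9 v)).setWord 15 0 (s.word 6 u)) t ∧ t ≤ 100 := by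
  have h0 : 0 < W := by omega
  have h1 := row_col_lt hun hvn
  have h2 : u * n + v < W := by omega
  have h3 : u * n < W := by omega
  refine ⟨_, .seq (.setWord ?_ ?_) (.seq (.setWord ?_ ?_) (.seq (.setReal ?_ ?_)
    (.seq (.setWord ?_ ?_) (.seq (.setWord ?_ ?_) (.setWord ?_ ?_))))), ?_⟩
  · simp [WordExpr.eval, fit, h0, hi]
  · simp [WordExpr.eval, fit, h0, hu]
  · simp [WordExpr.eval, fit, h0, hi]
  · simp [WordExpr.eval, fit, h0, hv]
  · simp [WordExpr.eval, fit, h0, hi]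
  · simp [RealExpr.eval, WordExpr.eval, fit, h0, hu, hv, hn, h2, h3, hu0, hv0]
  · simp [WordExpr.eval, fit, h0, hu]
  · simp [WordExpr.eval, fit, h0, hn, hi, hni]
  · simp [WordExpr.eval, fit, h0, hu]
  · simp [WordExpr.eval, fit, h0, hu, hv, huv]
  · simp [WordExpr.eval, fit, h0]
  · simp [WordExpr.eval, fit, h0, hu]
  · simp [RealExpr.time, WordExpr.time]

/-- If the size of the cluster in variable `20` has outgrown the size that its keys refer to,
update the latter, and have all keys of the cluster recomputed. -/
def announce : Program :=
  .ite (.realLt (.mul (.add (.lit 1) (.div (.get 0 (.lit 0)) (.lit 4))) (.ofWord (.get 10 (.var 20))))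
      (.ofWord (.get 9 (.var 20))))
    (.seq (.setWord 10 (.var 20) (.get 9 (.var 20))) (.assign 15 (.lit 0)))
    .skip

theorem exec_announce {W u : ℕ} (hW : 0 < W) {s : Memory} {ε : ℝ} (hε : s.real 0 0 = ε)
    (hu : s.word 20 0 = u) :
    ∃ s' t, Exec W announce s s' t ∧ t ≤ 60 ∧
      ((1 + ε / 4) * s.word 10 u < s.word 9 u ∧
        s' = (s.setWord 10 u (s.word 9 u)).setWord 15 0 0 ∨
       (s.word 9 u : ℝ) ≤ (1 + ε / 4) * s.word 10 u ∧ s' = s) := by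
  by_cases h : (1 + ε / 4) * s.word 10 u < s.word 9 u
  · refine ⟨_, _, .iteTrue ?_ (.seq (.setWord ?_ ?_) (.setWord ?_ ?_)), ?_, Or.inl ⟨h, rfl⟩⟩
    · simp [Test.eval, RealExpr.eval, WordExpr.eval, fit, hW, hu, hε, h]
    · simp [WordExpr.eval, fit, hW, hu]
    · simp [WordExpr.eval, fit, hW, hu]
    · simp [WordExpr.eval, fit, hW]
    · simp [WordExpr.eval, fit, hW]
    · simp [Test.time, RealExpr.time, WordExpr.time]
  · refine ⟨_, _, .iteFalse ?_ (.skip _), ?_, Or.inr ⟨not_lt.1 h, rfl⟩⟩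
    · simp [Test.eval, RealExpr.eval, WordExpr.eval, fit, hW, hu, hε, not_lt.1 h]
    · simp [Test.time, RealExpr.time, WordExpr.time]

/-- Merge the clusters in the variables `20` and `14`, as merge number `17`. -/
def merge : Program :=
  .seq record (.seq moveLoop (.seq announce (.seq touchLoop
    (.assign 17 (.add (.var 17) (.lit 1))))))

/-- The effect of `merge` on the memory: `v` is merged into `u`, and the keys of the half-edges of
`T` have been recomputed. -/
structure Merged (n m : ℕ) (ε : ℝ) (i u v : ℕ) (T : Finset ℕ) (s s' : Memory) : Prop where
  left : s'.word 3 = Function.update (s.word 3) i (s.word 8 u)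
  right : s'.word 4 = Function.update (s.word 4) i (s.word 8 v)
  weight : s'.real 2 = Function.update (s.real 2) i
    (s.real 3 (u * n + v) / (s.word 9 u * s.word 9 v))
  node : s'.word 8 = Function.update (s.word 8) u (n + i)
  size : s'.word 9 = Function.update (s.word 9) u (s.word 9 u + s.word 9 v)
  index : s'.word 17 0 = i + 1
  rep : ∀ h < 2 * m, s'.word 7 h = if s.word 7 h = v then u else s.word 7 h
  lists : Lists n (2 * m) (s'.word 5) (s'.word 6) (s'.word 7) (Finset.range (2 * m))
  cut : ∀ x y, (x ≠ v ∧ ∃ h < 2 * m, s.word 7 h = x) → (y ≠ v ∧ ∃ h < 2 * m, s.word 7 h = y) →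
    x ≠ y → s'.real 3 (x * n + y) = cutWeight (s.real 1) (s'.word 7) m x y
  tree : IsTournament m (s'.real 4) 0
  subset : T ⊆ Finset.range (2 * m)
  touched : ∀ e < m, 2 * e ∈ T ∨ 2 * e + 1 ∈ T → s'.real 4 (m + e) =
    edgeKey n (s'.real 3) (s'.word 10) (s'.word 7 (2 * e)) (s'.word 7 (2 * e + 1))
  untouched : ∀ e < m, 2 * e ∉ T → 2 * e + 1 ∉ T → s'.real 4 (m + e) = s.real 4 (m + e)
  announced : ((1 + ε / 4) * s.word 10 u < (s.word 9 u + s.word 9 v : ℕ) ∧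
      s'.word 10 = Function.update (s.word 10) u (s.word 9 u + s.word 9 v) ∧
      ∀ h < 2 * m, h ∈ T ↔ s.word 7 h = u ∨ s.word 7 h = v) ∨
    ((s.word 9 u + s.word 9 v : ℕ) ≤ (1 + ε / 4) * s.word 10 u ∧ s'.word 10 = s.word 10 ∧
      ∀ h < 2 * m, h ∈ T ↔ s.word 7 h = v)
  input : s'.word 0 = s.word 0 ∧ s'.real 0 = s.real 0 ∧ s'.real 1 = s.real 1

set_option maxHeartbeats 1000000 in
theorem exec_merge {W n m d u v i : ℕ} (hWn : n * n + 2 * n + 2 < W)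
    (hWm : n * (2 * m) + 2 * m + 2 < W) (hd : m ≤ 2 ^ d) {s : Memory} {ε : ℝ}
    (hn : s.word 0 0 = n) (hm : s.word 0 1 = m) (hε : s.real 0 0 = ε)
    (hu : s.word 20 0 = u) (hv : s.word 14 0 = v) (hi : s.word 17 0 = i) (hin : i < n)
    (hun : u < n) (hvn : v < n) (huv : u ≠ v)
    (hL : Lists n (2 * m) (s.word 5) (s.word 6) (s.word 7) (Finset.range (2 * m)))
    (hA : ∀ x y, (∃ h < 2 * m, s.word 7 h = x) → (∃ h < 2 * m, s.word 7 h = y) →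
      x ≠ y → s.real 3 (x * n + y) = cutWeight (s.real 1) (s.word 7) m x y)
    (hT : IsTournament m (s.real 4) 0) (hu0 : s.word 9 u ≠ 0) (hv0 : s.word 9 v ≠ 0)
    (hsum : s.word 9 u + s.word 9 v ≤ n)
    (hsz : ∀ i < 2 * m, s.word 10 (s.word 7 i) ≠ 0) (hsu : s.word 10 u ≠ 0) :
    ∃ s' t T, Exec W merge s s' t ∧ t ≤ T.card * (50 * d + 600) + 400 ∧
      Merged n m ε i u v T s s' := by
  have h0 : 0 < W := by omega
  have h1 : 1 < W := by omega
  obtain ⟨t₁, he₁, ht₁⟩ := exec_record (W := W) (n := n) (s := s) (i := i) (by omega) hn hu hv hi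
    hun hvn (by nlinarith) hu0 hv0 (by nlinarith)
  set s₁ := (((((s.setWord 3 i (s.word 8 u)).setWord 4 i (s.word 8 v)).setReal 2 i
      (s.real 3 (u * n + v) / (s.word 9 u * s.word 9 v))).setWord 8 u (n + i)).setWord 9 u
      (s.word 9 u + s.word 9 v)).setWord 15 0 (s.word 6 u) with hs₁
  have e5 : s₁.word 5 = s.word 5 := by simp [hs₁]
  have e6 : s₁.word 6 = s.word 6 := by simp [hs₁]
  have e7 : s₁.word 7 = s.word 7 := by simp [hs₁]
  have e10 : s₁.word 10 = s.word 10 := by simp [hs₁]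
  have e9 : s₁.word 9 u = s.word 9 u + s.word 9 v := by simp [hs₁]
  have e15 : s₁.word 15 0 = s.word 6 u := by simp [hs₁]
  have r1 : s₁.real 1 = s.real 1 := by simp [hs₁]
  have r3 : s₁.real 3 = s.real 3 := by simp [hs₁]
  have r4 : s₁.real 4 = s.real 4 := by simp [hs₁]
  have u₁ : s₁.word 20 0 = u := by simp [hs₁, hu]
  have n₁ : s₁.word 0 = s.word 0 := by simp [hs₁]
  obtain ⟨s₂, t₂, he₂, ht₂, hL₂, hlu, hrep, hold, hnew, hA₂, hF₂⟩ := exec_moveLoop (W := W)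
    (s := s₁) (n := n) (m := m) (u := u) (v := v) (by omega) hWm (by rw [n₁, hn])
    (by rw [n₁, hm]) u₁ (by simp [hs₁, hv]) hun hvn huv (by rwa [e5, e6, e7])
    (fun x => x ≠ v ∧ ∃ h < 2 * m, s.word 7 h = x) (by
      rintro x ⟨hx, h, hh, rfl⟩
      obtain ⟨pos, -, hp⟩ := hL
      exact ⟨(hp h (Finset.mem_range.2 hh)).1, hx⟩) (by
      intro x y hx hy hxy
      rw [r3, r1, e7]
      exact hA x y hx.2 hy.2 hxy)
  rw [e6] at hlu hold hnew ht₂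
  rw [e7] at hrep hold hnew
  rw [r1] at hA₂
  have hw₂ : ∀ a, a ∉ [5, 6, 7, 12, 16, 18, 19] → s₂.word a = s₁.word a := hF₂.1
  have u₂ : s₂.word 20 0 = u := by rw [hw₂ 20 (by simp), u₁]
  have n₂ : s₂.word 0 = s.word 0 := by rw [hw₂ 0 (by simp), n₁]
  have z₂ : s₂.word 10 = s.word 10 := by rw [hw₂ 10 (by simp), e10]
  have y₂ : s₂.word 9 u = s.word 9 u + s.word 9 v := by rw [hw₂ 9 (by simp), e9]
  have x₂ : s₂.word 15 0 = s.word 6 u := by rw [hw₂ 15 (by simp), e15]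
  have T₂ : IsTournament m (s₂.real 4) 0 := by rwa [hF₂.2 4 (by simp), r4]
  obtain ⟨s₃, t₃, he₃, ht₃, hs₃⟩ := exec_announce (W := W) (s := s₂) (ε := ε) (u := u) h0
    (by rw [hF₂.2 0 (by simp)]; simp [hs₁, hε]) u₂
  have hF₃ : Frame [10, 15] [] s₂ s₃ := by
    rcases hs₃ with ⟨-, rfl⟩ | ⟨-, rfl⟩
    · exact ((Frame.refl _ _ _).setWord (by simp) _ _).setWord (by simp) _ _
    · exact Frame.refl _ _ _
  have hw₃ : ∀ a, a ∉ [10, 15] → s₃.word a = s₂.word a := hF₃.1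
  have hr₃ : s₃.real = s₂.real := funext fun a => hF₃.2 a (by simp)
  have hlu₃ : s₃.word 6 u = s.word 6 u + s.word 6 v := by rw [hw₃ 6 (by simp), hlu]
  have hsub : ∀ i < 2 * m, s₂.word 7 i < n := fun i hi => by
    obtain ⟨pos, -, hp⟩ := hL₂
    exact (hp i (Finset.mem_range.2 hi)).1
  have hlist : ∀ k < s₂.word 6 u, s₂.word 5 (u * (2 * m) + k) < 2 * m := fun k hk => by
    obtain ⟨pos, hp, -⟩ := hL₂
    exact Finset.mem_range.1 (hp u hun k hk).1
  have hlen : s₂.word 6 u ≤ 2 * m := hL₂.len_le (by simp) hun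
  have hnz : ∀ i < 2 * m, s₃.word 10 (s₂.word 7 i) ≠ 0 := by
    intro i hi
    have h2 : s₂.word 10 (s₂.word 7 i) ≠ 0 := by
      rw [z₂, hrep i hi]
      split_ifs
      · exact hsu
      · exact hsz i hi
    rcases hs₃ with ⟨-, rfl⟩ | ⟨-, rfl⟩
    · rw [Memory.word_setWord_of_ne _ _ _ (by decide), Memory.word_setWord_self,
        Function.update_apply]
      split_ifs
      · omega
      · exact h2
    · exact h2
  obtain ⟨k₀, hk₀, hk₀u, T, hTsub, hTcard, hTmem, hann⟩ : ∃ k₀, s₃.word 15 0 = k₀ ∧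
      k₀ ≤ s.word 6 u ∧
      ∃ T : Finset ℕ, T ⊆ Finset.range (2 * m) ∧ T.card = s.word 6 u + s.word 6 v - k₀ ∧
      (∀ h < 2 * m, h ∈ T ↔ ∃ k, k₀ ≤ k ∧ k < s.word 6 u + s.word 6 v ∧
        s₂.word 5 (u * (2 * m) + k) = h) ∧
      (((1 + ε / 4) * s.word 10 u < (s.word 9 u + s.word 9 v : ℕ) ∧
      s₃.word 10 = Function.update (s.word 10) u (s.word 9 u + s.word 9 v) ∧
      ∀ h < 2 * m, h ∈ T ↔ s.word 7 h = u ∨ s.word 7 h = v) ∨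
    ((s.word 9 u + s.word 9 v : ℕ) ≤ (1 + ε / 4) * s.word 10 u ∧ s₃.word 10 = s.word 10 ∧
      ∀ h < 2 * m, h ∈ T ↔ s.word 7 h = v)) := by
    have hlv := hL.len_eq hvn
    have hl_u := hL.len_eq hun
    obtain ⟨pos, hp1, hp2⟩ := hL₂
    have hpos : ∀ h < 2 * m, s.word 7 h = u ∨ s.word 7 h = v →
        pos h < s.word 6 u + s.word 6 v ∧ s₂.word 5 (u * (2 * m) + pos h) = h := by
      intro h hh h7
      have h8 : s₂.word 7 h = u := by
        rw [hrep h hh]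
        split_ifs with h9
        · rfl
        · tauto
      have := hp2 h (Finset.mem_range.2 hh)
      rw [h8, hlu] at this
      exact this.2
    rcases hs₃ with ⟨hlt, rfl⟩ | ⟨hle, rfl⟩
    · rw [y₂, z₂] at hlt
      refine ⟨0, by simp, by omega,
        (Finset.range (2 * m)).filter (fun h => s.word 7 h = u ∨ s.word 7 h = v),
        Finset.filter_subset _ _, ?_, ?_, Or.inl ⟨hlt, ?_, ?_⟩⟩
      · rw [Finset.filter_or, Finset.card_union_of_disjoint, hl_u, hlv, Nat.sub_zero]
        rw [Finset.disjoint_filter]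
        intro h _ h3 h4
        exact huv (h3.symm.trans h4)
      · intro h hh
        rw [Finset.mem_filter]
        constructor
        · rintro ⟨-, h7⟩
          exact ⟨pos h, by omega, hpos h hh h7⟩
        · rintro ⟨k, -, hk, rfl⟩
          refine ⟨Finset.mem_range.2 hh, ?_⟩
          by_cases hku : k < s.word 6 u
          · exact Or.inl (hold k hku)
          · exact Or.inr (hnew k (by omega) (by omega))
      · simp [z₂, y₂]
      · intro h hh
        simp [hh]
    · rw [y₂, z₂] at hle
      refine ⟨s.word 6 u, x₂, le_rfl,
        (Finset.range (2 * m)).filter (fun h => s.word 7 h = v),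
        Finset.filter_subset _ _, by rw [hlv]; omega, ?_, Or.inr ⟨hle, z₂, ?_⟩⟩
      · intro h hh
        rw [Finset.mem_filter]
        constructor
        · rintro ⟨-, h7⟩
          obtain ⟨h8, h9⟩ := hpos h hh (Or.inr h7)
          refine ⟨pos h, ?_, h8, h9⟩
          by_contra hlt
          have h10 := hold (pos h) (by omega)
          rw [h9, h7] at h10
          exact huv h10.symm
        · rintro ⟨k, hk, hk', rfl⟩
          exact ⟨Finset.mem_range.2 hh, hnew k hk (by omega)⟩
      · intro h hh
        simp [hh]
  obtain ⟨s₄, t₄, he₄, ht₄, hT₄, hkey, hsame, hF₄⟩ := exec_touchLoop (W := W) (s := s₃) (n := n)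
    (m := m) (d := d) (u := u) (k := k₀) (by omega) hWm hd (by rw [hw₃ 0 (by simp), n₂, hn])
    (by rw [hw₃ 0 (by simp), n₂, hm]) (by rw [hw₃ 20 (by simp), u₂]) hk₀ hun (by omega)
    (by rw [hw₃ 6 (by simp)]; exact hlen)
    (by rw [hw₃ 5 (by simp), hw₃ 6 (by simp)]; exact hlist)
    (by rw [hw₃ 7 (by simp)]; exact fun i hi => ⟨hsub i hi, hnz i hi⟩)
    (by rw [hr₃]; exact T₂)
  have hw₄ : ∀ a, a ∉ [11, 12, 15, 16, 18, 19] → s₄.word a = s₃.word a := hF₄.1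
  have hr₄ : ∀ a, a ∉ [4] → s₄.real a = s₂.real a := fun a ha => by rw [hF₄.2 a ha, hr₃]
  rw [hlu₃] at ht₄ hkey hsame
  rw [hr₃, hw₃ 5 (by simp), hw₃ 7 (by simp)] at hkey
  rw [hr₃, hw₃ 5 (by simp)] at hsame
  have i₄ : s₄.word 17 0 = i := by
    rw [hw₄ 17 (by simp), hw₃ 17 (by simp), hw₂ 17 (by simp)]
    simp [hs₁, hi]
  have hTe : ∀ e < m, (2 * e ∈ T ∨ 2 * e + 1 ∈ T) ↔ ∃ k, k₀ ≤ k ∧ k < s.word 6 u + s.word 6 v ∧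
        s₂.word 5 (u * (2 * m) + k) / 2 = e := by
    intro e he
    rw [hTmem _ (by omega), hTmem _ (by omega)]
    constructor
    · rintro (⟨k, hk, hk', h⟩ | ⟨k, hk, hk', h⟩)
      · exact ⟨k, hk, hk', by omega⟩
      · exact ⟨k, hk, hk', by omega⟩
    · rintro ⟨k, hk, hk', h⟩
      have : s₂.word 5 (u * (2 * m) + k) = 2 * e ∨ s₂.word 5 (u * (2 * m) + k) = 2 * e + 1 := by
        omega
      rcases this with h' | h'
      · exact Or.inl ⟨k, hk, hk', h'⟩
      · exact Or.inr ⟨k, hk, hk', h'⟩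
  have hi1 : i + 1 < W := by nlinarith
  set s₅ := s₄.setWord 17 0 (i + 1) with hs₅
  have hw₅ : ∀ a, a ≠ 17 → s₅.word a = s₄.word a := fun a ha =>
    Memory.word_setWord_of_ne _ _ _ ha
  have hr₅ : s₅.real = s₄.real := rfl
  have w7 : s₅.word 7 = s₂.word 7 := by
    rw [hw₅ 7 (by decide), hw₄ 7 (by simp), hw₃ 7 (by simp)]
  have w5 : s₅.word 5 = s₂.word 5 := by
    rw [hw₅ 5 (by decide), hw₄ 5 (by simp), hw₃ 5 (by simp)]
  have w6 : s₅.word 6 = s₂.word 6 := by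
    rw [hw₅ 6 (by decide), hw₄ 6 (by simp), hw₃ 6 (by simp)]
  have w10 : s₅.word 10 = s₃.word 10 := by
    rw [hw₅ 10 (by decide), hw₄ 10 (by simp)]
  have w1 : ∀ a, a ∉ [5, 6, 7, 10, 11, 12, 15, 16, 17, 18, 19] → s₅.word a = s₁.word a :=
    ((((hF₂.mono (B' := [3, 4]) (by simp) (by simp)).trans
      (hF₃.mono (by simp) (by simp))).trans (hF₄.mono (by simp) (by simp))).setWord
      (by simp) _ _).1
  have rr : ∀ a, a ≠ 3 → a ≠ 4 → s₅.real a = s₁.real a := by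
    intro a h3 h4
    rw [hr₅, hr₄ a (by simpa using h4), hF₂.2 a (by simpa using h3)]
  have rr3 : s₅.real 3 = s₂.real 3 := hr₄ 3 (by simp)
  refine ⟨s₅, _, T, .seq he₁ (.seq he₂ (.seq he₃ (.seq he₄ (.setWord ?_ ?_)))), ?_, ?_⟩
  · simp [WordExpr.eval, fit, h0]
  · simp [WordExpr.eval, fit, h0, h1, i₄, hi1]
  · rw [hTcard]
    have h2 : s.word 6 v ≤ s.word 6 u + s.word 6 v - k₀ := by omega
    have h3 := Nat.mul_le_mul_right 300 h2
    simp only [WordExpr.time]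
    rw [show 50 * d + 600 = (50 * d + 300) + 300 by omega, mul_add (_ - _)]
    omega
  · refine ⟨?_, ?_, ?_, ?_, ?_, ?_, ?_, ?_, ?_, ?_, hTsub, ?_, ?_, ?_, ?_, ?_, ?_⟩
    · rw [w1 3 (by simp)]; simp [hs₁]
    · rw [w1 4 (by simp)]; simp [hs₁]
    · rw [rr 2 (by simp) (by simp)]; simp [hs₁]
    · rw [w1 8 (by simp)]; simp [hs₁]
    · rw [w1 9 (by simp)]; simp [hs₁]
    · simp [hs₅]
    · rw [w7]; exact hrep
    · rw [w7, w5, w6]; exact hL₂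
    · rw [w7, rr3]; exact hA₂
    · exact hT₄
    · intro e he h
      obtain ⟨k, hk, hk', hke⟩ := (hTe e he).1 h
      rw [w7, rr3, w10]
      exact hkey k hk hk' e hke
    · intro e he h h'
      have hr : s₂.real 4 = s.real 4 := by rw [hF₂.2 4 (by simp), r4]
      rw [hr₅, hsame e he, hr]
      intro k hk hk' hke
      have := (hTe e he).2 ⟨k, hk, hk', hke⟩
      tauto
    · rw [w10]; exact hann
    · rw [w1 0 (by simp), n₁]
    · rw [rr 0 (by simp) (by simp)]; simp [hs₁]
    · rw [rr 1 (by simp) (by simp)]; simp [hs₁]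

/-! ## The invariant of the clustering loop -/

/-- Cluster `x` has a half-edge. -/
def Active (m : ℕ) (rep : ℕ → ℕ) (x : ℕ) : Prop := ∃ h < 2 * m, rep h = x

/-- The data structures are consistent. -/
structure Consistent (n m : ℕ) (ε : ℝ) (s : Memory) : Prop where
  input : s.word 0 0 = n ∧ s.word 0 1 = m ∧ s.real 0 0 = ε
  lists : Lists n (2 * m) (s.word 5) (s.word 6) (s.word 7) (Finset.range (2 * m))
  cut : ∀ x y, Active m (s.word 7) x → Active m (s.word 7) y → x ≠ y →
    s.real 3 (x * n + y) = cutWeight (s.real 1) (s.word 7) m x y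
  tree : IsTournament m (s.real 4) 0
  sizes : ∀ x, Active m (s.word 7) x → 1 ≤ s.word 10 x ∧ s.word 10 x ≤ s.word 9 x ∧
    (s.word 9 x : ℝ) ≤ (1 + ε / 4) * s.word 10 x
  key_le : ∀ e < m, s.real 4 (m + e) ≤
    edgeKey n (s.real 3) (s.word 10) (s.word 7 (2 * e)) (s.word 7 (2 * e + 1))
  key_eq : ∀ e < m, ∃ e' < m, Joins (s.word 7) e' (s.word 7 (2 * e)) (s.word 7 (2 * e + 1)) ∧
    s.real 4 (m + e') =
      edgeKey n (s.real 3) (s.word 10) (s.word 7 (2 * e)) (s.word 7 (2 * e + 1))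

theorem Consistent.of_frame {n m : ℕ} {ε : ℝ} {s s' : Memory} (h : Consistent n m ε s)
    (hF : Frame [11, 12, 14, 16, 18, 19, 20] [] s s') : Consistent n m ε s' := by
  have hr : s'.real = s.real := funext fun a => hF.2 a (by simp)
  obtain ⟨h1, h2, h3, h4, h5, h6, h7⟩ := h
  constructor <;> simpa only [hr, hF.1 0 (by simp), hF.1 5 (by simp), hF.1 6 (by simp),
    hF.1 7 (by simp), hF.1 9 (by simp), hF.1 10 (by simp)]

theorem Joins.active {m e a b : ℕ} {rep : ℕ → ℕ} (h : Joins rep e a b) (he : e < m) :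
    Active m rep a ∧ Active m rep b := by
  rcases h with ⟨rfl, rfl⟩ | ⟨rfl, rfl⟩
  · exact ⟨⟨_, by omega, rfl⟩, ⟨_, by omega, rfl⟩⟩
  · exact ⟨⟨_, by omega, rfl⟩, ⟨_, by omega, rfl⟩⟩

theorem edgeKey_of_joins {n m : ℕ} {A : ℕ → ℝ} {sz rep : ℕ → ℕ}
    (hA : ∀ x y, Active m rep x → Active m rep y → x ≠ y → A (x * n + y) = A (y * n + x))
    {e a b : ℕ} (he : e < m) (h : Joins rep e a b) :
    edgeKey n A sz (rep (2 * e)) (rep (2 * e + 1)) = edgeKey n A sz a b := by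
  have hact := h.active he
  rcases h with ⟨rfl, rfl⟩ | ⟨h1, h2⟩
  · rfl
  · rw [h1, h2]
    unfold edgeKey
    by_cases hab : a = b
    · simp [hab]
    · rw [if_neg hab, if_neg (Ne.symm hab), hA a b hact.1 hact.2 hab, mul_comm (sz b : ℝ)]

section Consistent

variable {n m : ℕ} {ε : ℝ} {s : Memory}

theorem Consistent.cut_comm (h : Consistent n m ε s) (x y : ℕ) (hx : Active m (s.word 7) x)
    (hy : Active m (s.word 7) y) (hxy : x ≠ y) :
    s.real 3 (x * n + y) = s.real 3 (y * n + x) := by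
  rw [h.cut x y hx hy hxy, h.cut y x hy hx hxy.symm, cutWeight_comm]

theorem Consistent.active_lt (h : Consistent n m ε s) {x : ℕ} (hx : Active m (s.word 7) x) :
    x < n := by
  obtain ⟨i, hi, rfl⟩ := hx
  obtain ⟨pos, -, hp⟩ := h.lists
  exact (hp i (Finset.mem_range.2 hi)).1

theorem Consistent.key_le_max (h : Consistent n m ε s) {e : ℕ}
    (hmax : ∀ i < m, s.real 4 (m + i) ≤ s.real 4 (m + e)) (hem : e < m) {u v : ℕ}
    (he : Joins (s.word 7) e u v) {e₀ a b : ℕ} (he₀ : e₀ < m) (hab : Joins (s.word 7) e₀ a b) :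
    edgeKey n (s.real 3) (s.word 10) a b ≤ edgeKey n (s.real 3) (s.word 10) u v := by
  obtain ⟨e', he', -, hv⟩ := h.key_eq e₀ he₀
  rw [← edgeKey_of_joins h.cut_comm he₀ hab, ← edgeKey_of_joins h.cut_comm hem he, ← hv]
  exact (hmax e' he').trans (h.key_le e hem)

theorem Consistent.edgeKey_eq (h : Consistent n m ε s) {e a b : ℕ} (he : e < m)
    (hab : Joins (s.word 7) e a b) (hne : a ≠ b) : edgeKey n (s.real 3) (s.word 10) a b =
      cutWeight (s.real 1) (s.word 7) m a b / (s.word 10 a * s.word 10 b) := by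
  rw [edgeKey, if_neg hne, h.cut a b (hab.active he).1 (hab.active he).2 hne]

theorem cutWeight_nonneg {wt : ℕ → ℝ} (hwt : ∀ e < m, 0 ≤ wt e) (rep : ℕ → ℕ) (a b : ℕ) :
    0 ≤ cutWeight wt rep m a b :=
  Finset.sum_nonneg fun e he => by
    split_ifs
    · exact hwt e (Finset.mem_range.1 he)
    · exact le_rfl

theorem Consistent.ne_of_max (h : Consistent n m ε s) (hwt : ∀ e < m, 0 ≤ s.real 1 e) {e : ℕ}
    (hmax : ∀ i < m, s.real 4 (m + i) ≤ s.real 4 (m + e)) (hem : e < m) {u v : ℕ}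
    (he : Joins (s.word 7) e u v) {e₀ a b : ℕ} (he₀ : e₀ < m) (hab : Joins (s.word 7) e₀ a b)
    (hne : a ≠ b) : u ≠ v := by
  intro huv
  have h1 := h.key_le_max hmax hem he he₀ hab
  rw [h.edgeKey_eq he₀ hab hne, edgeKey, if_pos huv] at h1
  have : 0 ≤ cutWeight (s.real 1) (s.word 7) m a b / (s.word 10 a * s.word 10 b) :=
    div_nonneg (cutWeight_nonneg hwt _ _ _) (by positivity)
  linarith

theorem Consistent.close_of_max (h : Consistent n m ε s) (hε : 0 < ε) (hε1 : ε < 1)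
    (hwt : ∀ e < m, 0 ≤ s.real 1 e) {e : ℕ}
    (hmax : ∀ i < m, s.real 4 (m + i) ≤ s.real 4 (m + e)) (hem : e < m) {u v : ℕ}
    (he : Joins (s.word 7) e u v) (huv : u ≠ v) {e₀ a b : ℕ} (he₀ : e₀ < m)
    (hab : Joins (s.word 7) e₀ a b) (hne : a ≠ b) :
    (1 - ε) * (cutWeight (s.real 1) (s.word 7) m a b / (s.word 9 a * s.word 9 b)) ≤
      cutWeight (s.real 1) (s.word 7) m u v / (s.word 9 u * s.word 9 v) := by
  have h1 := h.key_le_max hmax hem he he₀ hab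
  rw [h.edgeKey_eq he₀ hab hne, h.edgeKey_eq hem he huv] at h1
  have hC := cutWeight_nonneg hwt (s.word 7) a b
  have hD := cutWeight_nonneg hwt (s.word 7) u v
  set C := cutWeight (s.real 1) (s.word 7) m a b
  set D := cutWeight (s.real 1) (s.word 7) m u v
  obtain ⟨a1, a2, -⟩ := h.sizes a (hab.active he₀).1
  obtain ⟨b1, b2, -⟩ := h.sizes b (hab.active he₀).2
  obtain ⟨u1, u2, u3⟩ := h.sizes u (he.active hem).1
  obtain ⟨v1, v2, v3⟩ := h.sizes v (he.active hem).2
  have a1' : (1 : ℝ) ≤ s.word 10 a := by exact_mod_cast a1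
  have b1' : (1 : ℝ) ≤ s.word 10 b := by exact_mod_cast b1
  have u1' : (1 : ℝ) ≤ s.word 10 u := by exact_mod_cast u1
  have v1' : (1 : ℝ) ≤ s.word 10 v := by exact_mod_cast v1
  have a2' : (s.word 10 a : ℝ) ≤ s.word 9 a := by exact_mod_cast a2
  have b2' : (s.word 10 b : ℝ) ≤ s.word 9 b := by exact_mod_cast b2
  have u2' : (s.word 10 u : ℝ) ≤ s.word 9 u := by exact_mod_cast u2
  have v2' : (s.word 10 v : ℝ) ≤ s.word 9 v := by exact_mod_cast v2
  have h2 : C / (s.word 9 a * s.word 9 b) ≤ C / (s.word 10 a * s.word 10 b) := by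
    gcongr
  have h3 : D / (s.word 10 u * s.word 10 v) ≤
      (1 + ε / 4) ^ 2 * (D / (s.word 9 u * s.word 9 v)) := by
    rw [← mul_div_assoc, div_le_div_iff₀ (by positivity) (by nlinarith)]
    have h4 : (s.word 9 u : ℝ) * s.word 9 v ≤
        ((1 + ε / 4) * s.word 10 u) * ((1 + ε / 4) * s.word 10 v) := by
      gcongr
    calc D * (s.word 9 u * s.word 9 v) ≤
        D * (((1 + ε / 4) * s.word 10 u) * ((1 + ε / 4) * s.word 10 v)) := by gcongr
      _ = _ := by ring
  have h4 : (1 - ε) * (1 + ε / 4) ^ 2 ≤ 1 := by nlinarith [mul_pos hε hε]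
  have h5 : 0 ≤ D / (s.word 9 u * s.word 9 v : ℝ) := div_nonneg hD (by positivity)
  calc (1 - ε) * (C / (s.word 9 a * s.word 9 b))
      ≤ (1 - ε) * ((1 + ε / 4) ^ 2 * (D / (s.word 9 u * s.word 9 v))) := by
        refine mul_le_mul_of_nonneg_left ?_ (by linarith)
        linarith
    _ = ((1 - ε) * (1 + ε / 4) ^ 2) * (D / (s.word 9 u * s.word 9 v)) := by ring
    _ ≤ 1 * (D / (s.word 9 u * s.word 9 v)) := mul_le_mul_of_nonneg_right h4 h5
    _ = _ := one_mul _

end Consistent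

/-- The potential that pays for the recomputation of keys. -/
noncomputable def potential (m : ℕ) (s : Memory) : ℝ :=
  ∑ h ∈ Finset.range (2 * m), Real.log (s.word 10 (s.word 7 h))

section Merged

variable {n m i u v : ℕ} {ε : ℝ} {T : Finset ℕ} {s s' : Memory}

theorem Merged.active_iff (hM : Merged n m ε i u v T s s') (hu : Active m (s.word 7) u)
    (huv : u ≠ v) (x : ℕ) :
    Active m (s'.word 7) x ↔ x ≠ v ∧ Active m (s.word 7) x := by
  constructor
  · rintro ⟨h, hh, rfl⟩
    rw [hM.rep h hh]
    split_ifs with h7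
    · exact ⟨huv, hu⟩
    · exact ⟨h7, h, hh, rfl⟩
  · rintro ⟨hx, h, hh, rfl⟩
    exact ⟨h, hh, by rw [hM.rep h hh, if_neg hx]⟩

theorem Merged.consistent (hM : Merged n m ε i u v T s s') (h : Consistent n m ε s)
    (hε : 0 < ε) (hwt : ∀ e < m, 0 ≤ s.real 1 e)
    (hu : Active m (s.word 7) u) (huv : u ≠ v) :
    Consistent n m ε s' := by
  have hact := hM.active_iff hu huv
  obtain ⟨i0, i1, i2⟩ := hM.input
  have hcut' : ∀ x y, Active m (s'.word 7) x → Active m (s'.word 7) y → x ≠ y →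
      s'.real 3 (x * n + y) = cutWeight (s'.real 1) (s'.word 7) m x y := fun x y hx hy hxy => by
    rw [i2]
    exact hM.cut x y ((hact x).1 hx) ((hact y).1 hy) hxy
  have hcomm : ∀ x y, Active m (s'.word 7) x → Active m (s'.word 7) y → x ≠ y →
      s'.real 3 (x * n + y) = s'.real 3 (y * n + x) := fun x y hx hy hxy => by
    rw [hcut' x y hx hy hxy, hcut' y x hy hx hxy.symm, cutWeight_comm]
  have hjoin : ∀ e < m, ∀ a b, a ≠ v → b ≠ v → Joins (s.word 7) e a b →
      Joins (s'.word 7) e a b := by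
    intro e he a b ha hb hj
    simp only [Joins]
    rw [hM.rep _ (by omega), hM.rep _ (by omega)]
    rcases hj with ⟨rfl, rfl⟩ | ⟨rfl, rfl⟩ <;> simp [ha, hb]
  have hvT : ∀ h < 2 * m, h ∉ T → s.word 7 h ≠ v := by
    intro h hh hT h7
    rcases hM.announced with ⟨-, -, hT'⟩ | ⟨-, -, hT'⟩ <;> exact hT ((hT' h hh).2 (by simp [h7]))
  have hsz : ∀ h < 2 * m, h ∉ T → s'.word 10 (s.word 7 h) = s.word 10 (s.word 7 h) := by
    intro h hh hT
    rcases hM.announced with ⟨-, hs, hT'⟩ | ⟨-, hs, hT'⟩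
    · rw [hs, Function.update_of_ne]
      intro h7
      exact hT ((hT' h hh).2 (Or.inl h7))
    · rw [hs]
  have hunt : ∀ e < m, 2 * e ∉ T → 2 * e + 1 ∉ T → Joins (s'.word 7) e (s.word 7 (2 * e))
      (s.word 7 (2 * e + 1)) := by
    intro e he h1 h2
    exact hjoin e he _ _ (hvT _ (by omega) h1) (hvT _ (by omega) h2) (Or.inl ⟨rfl, rfl⟩)
  have hrepu : ∀ e < m, 2 * e ∉ T → 2 * e + 1 ∉ T → s'.word 7 (2 * e) = s.word 7 (2 * e) ∧
      s'.word 7 (2 * e + 1) = s.word 7 (2 * e + 1) := by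
    intro e he h1 h2
    rw [hM.rep _ (by omega), hM.rep _ (by omega), if_neg (hvT _ (by omega) h1),
      if_neg (hvT _ (by omega) h2)]
    exact ⟨rfl, rfl⟩
  have hmono : ∀ e < m, 2 * e ∉ T → 2 * e + 1 ∉ T →
      edgeKey n (s.real 3) (s.word 10) (s.word 7 (2 * e)) (s.word 7 (2 * e + 1)) ≤
      edgeKey n (s'.real 3) (s'.word 10) (s.word 7 (2 * e)) (s.word 7 (2 * e + 1)) ∧
      ((∀ e' < m, Joins (s'.word 7) e' (s.word 7 (2 * e)) (s.word 7 (2 * e + 1)) →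
        2 * e' ∉ T ∧ 2 * e' + 1 ∉ T) →
      edgeKey n (s.real 3) (s.word 10) (s.word 7 (2 * e)) (s.word 7 (2 * e + 1)) =
      edgeKey n (s'.real 3) (s'.word 10) (s.word 7 (2 * e)) (s.word 7 (2 * e + 1))) := by
    intro e he h1 h2
    have ha := hvT _ (by omega) h1
    have hb := hvT _ (by omega) h2
    have hj := hunt e he h1 h2
    unfold edgeKey
    rw [hsz _ (by omega) h1, hsz _ (by omega) h2]
    split_ifs with hab
    · exact ⟨le_rfl, fun _ => rfl⟩
    · rw [h.cut _ _ ⟨_, by omega, rfl⟩ ⟨_, by omega, rfl⟩ hab,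
        hcut' _ _ (hj.active he).1 (hj.active he).2 hab, i2]
      constructor
      · refine div_le_div_of_nonneg_right (Finset.sum_le_sum fun e' he' => ?_) (by positivity)
        have he'' := Finset.mem_range.1 he'
        by_cases hJ : Joins (s.word 7) e' (s.word 7 (2 * e)) (s.word 7 (2 * e + 1))
        · rw [if_pos hJ, if_pos (hjoin e' he'' _ _ ha hb hJ)]
        · rw [if_neg hJ]
          split_ifs
          · exact hwt e' he''
          · exact le_rfl
      · intro hall
        congr 1
        refine Finset.sum_congr rfl fun e' he' => ?_
        have he'' := Finset.mem_range.1 he'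
        refine if_congr ⟨hjoin e' he'' _ _ ha hb, fun hJ => ?_⟩ rfl rfl
        obtain ⟨h3, h4⟩ := hall e' he'' hJ
        obtain ⟨h5, h6⟩ := hrepu e' he'' h3 h4
        simpa only [Joins, h5, h6] using hJ
  refine ⟨?_, hM.lists, hcut', hM.tree, ?_, ?_, ?_⟩
  · rw [i0, i1]
    exact h.input
  · intro x hx
    obtain ⟨hxv, hx⟩ := (hact x).1 hx
    obtain ⟨x1, x2, x3⟩ := h.sizes x hx
    rw [hM.size]
    rcases eq_or_ne x u with rfl | hxu
    · rw [Function.update_self]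
      rcases hM.announced with ⟨-, hs, -⟩ | ⟨hle, hs, -⟩
      · rw [hs, Function.update_self]
        refine ⟨by omega, le_rfl, ?_⟩
        have : (0 : ℝ) ≤ (s.word 9 x + s.word 9 v : ℕ) := Nat.cast_nonneg _
        nlinarith
      · rw [hs]
        exact ⟨x1, by omega, hle⟩
    · rw [Function.update_of_ne hxu]
      have hs : s'.word 10 x = s.word 10 x := by
        rcases hM.announced with ⟨-, hs, -⟩ | ⟨-, hs, -⟩
        · rw [hs, Function.update_of_ne hxu]
        · rw [hs]
      rw [hs]
      exact ⟨x1, x2, x3⟩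
  · intro e he
    by_cases ht : 2 * e ∈ T ∨ 2 * e + 1 ∈ T
    · exact (hM.touched e he ht).le
    · rw [not_or] at ht
      rw [hM.untouched e he ht.1 ht.2, (hrepu e he ht.1 ht.2).1, (hrepu e he ht.1 ht.2).2]
      exact (h.key_le e he).trans (hmono e he ht.1 ht.2).1
  · intro e he
    by_cases hex : ∃ e' < m, Joins (s'.word 7) e' (s'.word 7 (2 * e)) (s'.word 7 (2 * e + 1)) ∧
        (2 * e' ∈ T ∨ 2 * e' + 1 ∈ T)
    · obtain ⟨e', he', hJ, ht⟩ := hex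
      refine ⟨e', he', hJ, ?_⟩
      rw [hM.touched e' he' ht]
      exact edgeKey_of_joins hcomm he' hJ
    · have ht : 2 * e ∉ T ∧ 2 * e + 1 ∉ T := by
        rw [← not_or]
        exact fun ht => hex ⟨e, he, Or.inl ⟨rfl, rfl⟩, ht⟩
      obtain ⟨h1, h2⟩ := hrepu e he ht.1 ht.2
      rw [h1, h2] at hex ⊢
      have hall : ∀ e' < m, Joins (s'.word 7) e' (s.word 7 (2 * e)) (s.word 7 (2 * e + 1)) →
          2 * e' ∉ T ∧ 2 * e' + 1 ∉ T := fun e' he' hJ => by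
        rw [← not_or]
        exact fun ht => hex ⟨e', he', hJ, ht⟩
      obtain ⟨e', he', hJ, hv'⟩ := h.key_eq e he
      have hJ' := hjoin e' he' _ _ (hvT _ (by omega) ht.1) (hvT _ (by omega) ht.2) hJ
      refine ⟨e', he', hJ', ?_⟩
      obtain ⟨h3, h4⟩ := hall e' he' hJ'
      rw [hM.untouched e' he' h3 h4, hv', (hmono e he ht.1 ht.2).2 hall]

theorem Merged.card_le (hM : Merged n m ε i u v T s s') (h : Consistent n m ε s)
    (hε : 0 < ε) (hε1 : ε < 1) (hu : Active m (s.word 7) u) (hv : Active m (s.word 7) v)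
    (hsz : s.word 9 v ≤ s.word 9 u) :
    T.card * Real.log (1 + ε / 4) ≤ potential m s' - potential m s := by
  have hlog : 0 ≤ Real.log (1 + ε / 4) := Real.log_nonneg (by linarith)
  obtain ⟨u1, u2, u3⟩ := h.sizes u hu
  obtain ⟨v1, v2, v3⟩ := h.sizes v hv
  have u1' : (1 : ℝ) ≤ s.word 10 u := by exact_mod_cast u1
  have v1' : (1 : ℝ) ≤ s.word 10 v := by exact_mod_cast v1
  have u2' : (s.word 10 u : ℝ) ≤ s.word 9 u := by exact_mod_cast u2
  have v2' : (s.word 10 v : ℝ) ≤ s.word 9 v := by exact_mod_cast v2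
  have hsz' : (s.word 9 v : ℝ) ≤ s.word 9 u := by exact_mod_cast hsz
  have hcard : T.card * Real.log (1 + ε / 4) =
      ∑ h ∈ Finset.range (2 * m), if h ∈ T then Real.log (1 + ε / 4) else 0 := by
    rw [← Finset.sum_filter, Finset.filter_mem_eq_inter, Finset.inter_eq_right.2 hM.subset,
      Finset.sum_const, nsmul_eq_mul]
  rw [hcard, potential, potential, ← Finset.sum_sub_distrib]
  refine Finset.sum_le_sum fun j hj => ?_
  have hj' := Finset.mem_range.1 hj
  have hpos : (0 : ℝ) < s.word 10 (s.word 7 j) := by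
    have := (h.sizes _ ⟨j, hj', rfl⟩).1
    exact_mod_cast this
  have key : (if j ∈ T then (1 + ε / 4) else 1) * (s.word 10 (s.word 7 j) : ℝ) ≤
      s'.word 10 (s'.word 7 j) := by
    rw [hM.rep j hj']
    rcases hM.announced with ⟨hlt, hs, hT⟩ | ⟨hle, hs, hT⟩
    · rw [hs]
      have hT' := hT j hj'
      push_cast at hlt
      by_cases hjv : s.word 7 j = v
      · rw [if_pos (hT'.2 (Or.inr hjv)), if_pos hjv, Function.update_self, hjv]
        push_cast
        nlinarith
      · rw [if_neg hjv]
        by_cases hju : s.word 7 j = u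
        · rw [if_pos (hT'.2 (Or.inl hju)), hju, Function.update_self]
          push_cast
          exact hlt.le
        · rw [if_neg (by rw [hT']; tauto), Function.update_of_ne hju, one_mul]
    · rw [hs]
      have hT' := hT j hj'
      push_cast at hle
      by_cases hjv : s.word 7 j = v
      · rw [if_pos (hT'.2 hjv), if_pos hjv, hjv]
        have h1 : (1 + ε / 4) ^ 2 ≤ 2 := by nlinarith
        nlinarith
      · rw [if_neg (by rwa [hT']), if_neg hjv, one_mul]
  have h2 := Real.log_le_log (by split_ifs <;> positivity) key
  rw [Real.log_mul (by split_ifs <;> positivity) hpos.ne'] at h2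
  split_ifs at h2 ⊢
  · linarith
  · rw [Real.log_one] at h2
    linarith

end Merged

/-! ## Initialization -/

/-- Enter edge number `15` into the data structures. -/
def insertEdge : Program :=
  .seq (.assign 12 (.var 15))
  (.seq (.assign 18 (.get 1 (.var 15)))
  (.seq (.assign 19 (.get 2 (.var 15)))
  (.seq (.assign 20 (.var 18))
  (.seq (.assign 16 (.mul (.lit 2) (.var 15)))
  (.seq push
  (.seq (.assign 20 (.var 19))
  (.seq (.assign 16 (.add (.mul (.lit 2) (.var 15)) (.lit 1)))
  (.seq push
  (.seq addEdge
  (.seq (.setReal 4 (.add (.get 0 (.lit 1)) (.var 12)) (.get 1 (.var 12)))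
  (.seq refresh (.assign 15 (.add (.var 15) (.lit 1))))))))))))))

/-- The data structures hold the first `k` edges. -/
structure Inserted (n m k : ℕ) (s s' : Memory) : Prop where
  lists : Lists n (2 * m) (s'.word 5) (s'.word 6) (s'.word 7) (Finset.range (2 * k))
  ends : ∀ e < k, s'.word 7 (2 * e) = s.word 1 e ∧ s'.word 7 (2 * e + 1) = s.word 2 e
  cut : ∀ x < n, ∀ y < n, x ≠ y →
    s'.real 3 (x * n + y) = cutWeight (s.real 1) (s'.word 7) k x y
  tree : IsTournament m (s'.real 4) 0
  key : ∀ e < k, s'.real 4 (m + e) = s.real 1 e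
  index : s'.word 15 0 = k
  frame : Frame [5, 6, 7, 11, 12, 15, 16, 18, 19, 20] [3, 4] s s'

set_option maxHeartbeats 1000000 in
theorem exec_insertEdge {W n m d k : ℕ} (hWn : n * n + 2 < W)
    (hWm : n * (2 * m) + 2 * m + 2 < W) (hd : m ≤ 2 ^ d) {s s₁ : Memory} (hn : s.word 0 0 = n)
    (hm : s.word 0 1 = m) (hkm : k < m) (h : Inserted n m k s s₁) (ha : s.word 1 k < n)
    (hb : s.word 2 k < n) :
    ∃ s' t, Exec W insertEdge s₁ s' t ∧ t ≤ 50 * d + 300 ∧ Inserted n m (k + 1) s s' := by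
  have h0 : 0 < W := by omega
  have h1 : 1 < W := by omega
  have h2 : 2 < W := by omega
  have h3 : 2 * k < W := by omega
  have h4 : 2 * k + 1 < W := by omega
  have h5 : k + 1 < W := by omega
  have h6 : m + k < W := by omega
  obtain ⟨hL, hends, hcut, htree, hkey, hidx, hF⟩ := h
  set a := s.word 1 k with hsa
  set b := s.word 2 k with hsb
  have haw : s₁.word 1 k = a := by rw [hF.1 1 (by simp)]
  have hbw : s₁.word 2 k = b := by rw [hF.1 2 (by simp)]
  have hmw : s₁.word 0 1 = m := by rw [hF.1 0 (by simp), hm]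
  set s₂ := ((((s₁.setWord 12 0 k).setWord 18 0 a).setWord 19 0 b).setWord 20 0 a).setWord 16 0
    (2 * k) with hs₂
  have hsub : Finset.range (2 * k) ⊆ Finset.range (2 * m) := by
    simp only [Finset.range_subset_range]; omega
  have hL₂ : Lists n (2 * m) (s₂.word 5) (s₂.word 6) (s₂.word 7) (Finset.range (2 * k)) := by
    simpa [hs₂] using hL
  have hla : s₂.word 6 a < 2 * m :=
    hL₂.len_lt (h := 2 * k) hsub ha (by simp) (by omega)
  obtain ⟨t₃, he₃, ht₃⟩ := exec_push (W := W) (n := n) (m := m) (u := a) (h := 2 * k) (s := s₂)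
    hWm (by simp [hs₂, hmw]) (by simp [hs₂]) (by simp [hs₂]) ha hla
  set s₃ := ((s₂.setWord 5 (a * (2 * m) + s₂.word 6 a) (2 * k)).setWord 6 a
      (s₂.word 6 a + 1)).setWord 7 (2 * k) a with hs₃
  have hL₃ : Lists n (2 * m) (s₃.word 5) (s₃.word 6) (s₃.word 7) (Finset.range (2 * k + 1)) := by
    have := hL₂.push hsub ha (h := 2 * k) (by simp) (by omega)
    rw [Finset.range_add_one]
    simpa [hs₃] using this
  set s₄ := (s₃.setWord 20 0 b).setWord 16 0 (2 * k + 1) with hs₄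
  have hL₄ : Lists n (2 * m) (s₄.word 5) (s₄.word 6) (s₄.word 7) (Finset.range (2 * k + 1)) := by
    simpa [hs₄] using hL₃
  have hsub' : Finset.range (2 * k + 1) ⊆ Finset.range (2 * m) := by
    simp only [Finset.range_subset_range]; omega
  have hlb : s₄.word 6 b < 2 * m :=
    hL₄.len_lt (h := 2 * k + 1) hsub' hb (by simp) (by omega)
  obtain ⟨t₅, he₅, ht₅⟩ := exec_push (W := W) (n := n) (m := m) (u := b) (h := 2 * k + 1)
    (s := s₄) hWm (by simp [hs₄, hs₃, hs₂, hmw]) (by simp [hs₄]) (by simp [hs₄]) hb hlb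
  set s₅ := ((s₄.setWord 5 (b * (2 * m) + s₄.word 6 b) (2 * k + 1)).setWord 6 b
      (s₄.word 6 b + 1)).setWord 7 (2 * k + 1) b with hs₅
  have hL₅ : Lists n (2 * m) (s₅.word 5) (s₅.word 6) (s₅.word 7)
      (Finset.range (2 * (k + 1))) := by
    have := hL₄.push hsub' hb (h := 2 * k + 1) (by simp) (by omega)
    rw [show 2 * (k + 1) = 2 * k + 1 + 1 by ring, Finset.range_add_one]
    simpa [hs₅] using this
  have w7 : s₅.word 7 = Function.update (Function.update (s₁.word 7) (2 * k) a) (2 * k + 1) b := by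
    simp [hs₅, hs₄, hs₃, hs₂]
  have r₅ : s₅.real = s₁.real := by simp [hs₅, hs₄, hs₃, hs₂]
  have hF₅ : Frame [5, 6, 7, 11, 12, 15, 16, 18, 19, 20] [3, 4] s s₅ := by
    rw [hs₅, hs₄, hs₃, hs₂]
    repeat' first | exact hF | refine Frame.setWord ?_ (by simp) _ _
  have n₅ : s₅.word 0 = s.word 0 := hF₅.1 0 (by simp)
  have k₅ : s₅.word 15 0 = k := by simp [hs₅, hs₄, hs₃, hs₂, hidx]
  have e₅ : s₅.word 12 0 = k := by simp [hs₅, hs₄, hs₃, hs₂]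
  have wt₅ : s₅.real 1 = s.real 1 := hF₅.2 1 (by simp)
  obtain ⟨s₆, t₆, he₆, ht₆, hA₆, hF₆⟩ := exec_addEdge (W := W) (n := n) (a := a) (b := b) (e := k)
    (s := s₅) hWn (by rw [n₅, hn]) (by simp [hs₅, hs₄, hs₃, hs₂]) (by simp [hs₅, hs₄, hs₃, hs₂])
    e₅ ha hb
  have wt₆ : s₆.real 1 = s.real 1 := by rw [hF₆.2 1 (by simp), wt₅]
  have v₆ : s₆.real 4 = s₁.real 4 := by rw [hF₆.2 4 (by simp), r₅]
  have n₆ : s₆.word 0 = s.word 0 := by rw [hF₆.1 0 (by simp), n₅]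
  have e₆ : s₆.word 12 0 = k := by rw [hF₆.1 12 (by simp), e₅]
  set s₇ := s₆.setReal 4 (m + k) (s.real 1 k) with hs₇
  obtain ⟨s₈, t₈, he₈, ht₈, hT₈, hleaf, hF₈⟩ := exec_refresh (W := W) (m := m) (e := k) (d := d)
    (s := s₇) (val := s₁.real 4) (x := s.real 1 k) (by omega) hd (by simp [hs₇, n₆, hm])
    (by simp [hs₇, e₆]) hkm (by simp [hs₇, v₆]) htree
  have hF₇ : Frame [5, 6, 7, 11, 12, 15, 16, 18, 19, 20] [3, 4] s s₇ :=
    (hF₅.trans (hF₆.mono (by simp) (by simp))).setReal (by simp) _ _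
  have k₈ : s₈.word 15 0 = k := by
    rw [hF₈.1 15 (by simp), hs₇, Memory.word_setReal, hF₆.1 15 (by simp), k₅]
  have hw₈ : ∀ a, a ∉ [11] → s₈.word a = s₅.word a := fun a ha => by
    rw [hF₈.1 a ha, hs₇, Memory.word_setReal, hF₆.1 a (by simp)]
  have a₈ : s₈.real 3 = s₆.real 3 := by rw [hF₈.2 3 (by simp)]; simp [hs₇]
  set s₉ := s₈.setWord 15 0 (k + 1) with hs₉
  have w7₉ : s₉.word 7 = s₅.word 7 := by simp [hs₉, hw₈ 7 (by simp)]
  refine ⟨s₉, _,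
    .seq (s₁ := s₁.setWord 12 0 k) (.setWord ?_ ?_)
    (.seq (s₁ := (s₁.setWord 12 0 k).setWord 18 0 a) (.setWord ?_ ?_)
    (.seq (s₁ := ((s₁.setWord 12 0 k).setWord 18 0 a).setWord 19 0 b) (.setWord ?_ ?_)
    (.seq (s₁ := (((s₁.setWord 12 0 k).setWord 18 0 a).setWord 19 0 b).setWord 20 0 a)
      (.setWord ?_ ?_)
    (.seq (s₁ := s₂) (.setWord ?_ ?_)
    (.seq he₃
    (.seq (s₁ := s₃.setWord 20 0 b) (.setWord ?_ ?_)
    (.seq (s₁ := s₄) (.setWord ?_ ?_)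
    (.seq he₅ (.seq he₆ (.seq (s₁ := s₇) (.setReal ?_ ?_)
    (.seq he₈ (.setWord ?_ ?_)))))))))))), ?_, ?_⟩
  · simp [WordExpr.eval, fit, h0]
  · simp [WordExpr.eval, fit, h0, hidx]
  · simp [WordExpr.eval, fit, h0]
  · simp [WordExpr.eval, fit, h0, hidx, haw]
  · simp [WordExpr.eval, fit, h0]
  · simp [WordExpr.eval, fit, h0, hidx, hbw]
  · simp [WordExpr.eval, fit, h0]
  · simp [WordExpr.eval, fit, h0]
  · simp [WordExpr.eval, fit, h0]
  · simp [WordExpr.eval, fit, h0, h2, hidx, h3]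
  · simp [WordExpr.eval, fit, h0]
  · simp [hs₃, hs₂, WordExpr.eval, fit, h0]
  · simp [WordExpr.eval, fit, h0]
  · simp [hs₃, hs₂, WordExpr.eval, fit, h0, h1, h2, hidx, h3, h4]
  · simp [WordExpr.eval, fit, h0, h1, n₆, e₆, hm, h6]
  · simp [RealExpr.eval, WordExpr.eval, fit, h0, wt₆, e₆]
  · simp [WordExpr.eval, fit, h0]
  · simp [WordExpr.eval, fit, h0, h1, k₈, h5]
  · simp only [RealExpr.time, WordExpr.time]; omega
  · refine ⟨?_, ?_, ?_, ?_, ?_, by simp [hs₉], ?_⟩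
    · rw [w7₉]
      simpa [hs₉, hw₈ 5 (by simp), hw₈ 6 (by simp)] using hL₅
    · intro e he
      rw [w7₉, w7]
      rcases eq_or_ne e k with rfl | hne
      · simpa using ⟨hsa, hsb⟩
      · rw [Function.update_of_ne (by omega), Function.update_of_ne (by omega),
          Function.update_of_ne (by omega), Function.update_of_ne (by omega)]
        exact hends e (by omega)
    · intro x hx y hy hxy
      rw [w7₉, hs₉, Memory.real_setWord, a₈, hA₆ x hx y hy hxy, cutWeight_succ, r₅,
        hcut x hx y hy hxy, hF.2 1 (by simp)]
      congr 1
      · refine cutWeight_congr _ _ fun i hi => ?_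
        rw [w7, Function.update_of_ne (by omega), Function.update_of_ne (by omega)]
      · refine if_congr ?_ rfl rfl
        simp [Joins, w7]
    · simpa [hs₉] using hT₈
    · intro e he
      rw [hs₉, Memory.real_setWord, hleaf e (by omega)]
      split_ifs with hek
      · rw [hek]
      · exact hkey e (by omega)
    · exact (hF₇.trans (hF₈.mono (by simp) (by simp))).setWord (by simp) _ _

/-- Make vertex number `15` a cluster. -/
def insertVertex : Program :=
  .seq (.setWord 8 (.var 15) (.var 15))
  (.seq (.setWord 9 (.var 15) (.lit 1))
  (.seq (.setWord 10 (.var 15) (.lit 1))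
    (.assign 15 (.add (.var 15) (.lit 1)))))

/-- Build the data structures for the singleton clusters. -/
def buildData : Program :=
  .seq (.loop (.wordLt (.var 15) (.get 0 (.lit 1))) insertEdge)
  (.seq (.assign 15 (.lit 0)) (.loop (.wordLt (.var 15) (.get 0 (.lit 0))) insertVertex))

theorem exec_insertEdges {W n m d : ℕ} (hWn : n * n + 2 < W)
    (hWm : n * (2 * m) + 2 * m + 2 < W) (hd : m ≤ 2 ^ d) {s : Memory} (hn : s.word 0 0 = n)
    (hm : s.word 0 1 = m) (hends : ∀ e < m, s.word 1 e < n ∧ s.word 2 e < n)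
    (h6 : ∀ i, s.word 6 i = 0) (h15 : s.word 15 0 = 0) (hr3 : ∀ i, s.real 3 i = 0)
    (hr4 : ∀ i, s.real 4 i = 0) :
    ∃ s' t, Exec W (.loop (.wordLt (.var 15) (.get 0 (.lit 1))) insertEdge) s s' t ∧
      t ≤ m * (50 * d + 400) + 10 ∧ Inserted n m m s s' := by
  have h0 : 0 < W := by omega
  have h1 : 1 < W := by omega
  refine Exists.elim (exec_loop_of_le (W := W) (b := .wordLt (.var 15) (.get 0 (.lit 1)))
    (p := insertEdge) (fun k s' => Inserted n m k s s') m (50 * d + 300) (s := s) ?_ ?_ ?_) ?_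
  · intro k hk s₁ h
    refine ⟨?_, exec_insertEdge hWn hWm hd hn hm hk h (hends k hk).1 (hends k hk).2⟩
    simp [Test.eval, WordExpr.eval, fit, h0, h1, h.index, h.frame.1 0 (by simp), hm, hk]
  · intro s₁ h
    simp [Test.eval, WordExpr.eval, fit, h0, h1, h.index, h.frame.1 0 (by simp), hm]
  · refine ⟨⟨fun _ => 0, fun u _ k hk => ?_, by simp⟩, by simp, ?_, ?_, by simp, h15,
      Frame.refl _ _ _⟩
    · rw [h6] at hk
      omega
    · intro x _ y _ _
      simp [hr3, cutWeight]
    · intro j _ _ _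
      simp [hr4]
  · rintro s' ⟨t, he, ht, h⟩
    refine ⟨s', t, he, ht.trans ?_, h⟩
    simp only [Test.time, WordExpr.time]
    exact Nat.add_le_add (Nat.mul_le_mul_left _ (by omega)) (by omega)

theorem exec_insertVertices {W n : ℕ} (hW : n + 2 < W) {s : Memory} (hn : s.word 0 0 = n)
    (h15 : s.word 15 0 = 0) :
    ∃ s' t, Exec W (.loop (.wordLt (.var 15) (.get 0 (.lit 0))) insertVertex) s s' t ∧
      t ≤ n * 50 + 10 ∧ (∀ u < n, s'.word 8 u = u ∧ s'.word 9 u = 1 ∧ s'.word 10 u = 1) ∧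
      Frame [8, 9, 10, 15] [] s s' := by
  have h0 : 0 < W := by omega
  have h1 : 1 < W := by omega
  refine Exists.elim (exec_loop_of_le (W := W) (b := .wordLt (.var 15) (.get 0 (.lit 0)))
    (p := insertVertex) (fun k s' => s'.word 15 0 = k ∧
      (∀ u < k, s'.word 8 u = u ∧ s'.word 9 u = 1 ∧ s'.word 10 u = 1) ∧
      Frame [8, 9, 10, 15] [] s s') n 40 (s := s) ?_ ?_ ?_) ?_
  · rintro k hk s₁ ⟨hk₁, h, hF⟩
    have hk' : k + 1 < W := by omega
    refine ⟨?_, (((s₁.setWord 8 k k).setWord 9 k 1).setWord 10 k 1).setWord 15 0 (k + 1), _,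
      .seq (.setWord ?_ ?_) (.seq (.setWord ?_ ?_) (.seq (.setWord ?_ ?_) (.setWord ?_ ?_))),
      ?_, ?_, ?_, ?_⟩
    · simp [Test.eval, WordExpr.eval, fit, h0, hk₁, hF.1 0 (by simp), hn, hk]
    · simp [WordExpr.eval, fit, h0, hk₁]
    · simp [WordExpr.eval, fit, h0, hk₁]
    · simp [WordExpr.eval, fit, h0, hk₁]
    · simp [WordExpr.eval, fit, h1]
    · simp [WordExpr.eval, fit, h0, hk₁]
    · simp [WordExpr.eval, fit, h1]
    · simp [WordExpr.eval, fit, h0]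
    · simp [WordExpr.eval, fit, h0, h1, hk₁, hk']
    · simp [WordExpr.time]
    · simp
    · intro u hu
      rcases eq_or_ne u k with rfl | hne
      · simp
      · simpa [hne] using h u (by omega)
    · repeat' first | exact hF | refine Frame.setWord ?_ (by simp) _ _
  · rintro s₁ ⟨hk₁, -, hF⟩
    simp [Test.eval, WordExpr.eval, fit, h0, hk₁, hF.1 0 (by simp), hn]
  · exact ⟨h15, by simp, Frame.refl _ _ _⟩
  · rintro s' ⟨t, he, ht, -, h, hF⟩
    refine ⟨s', t, he, ht.trans ?_, h, hF⟩
    simp only [Test.time, WordExpr.time]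
    omega

theorem exec_buildData {W n m d : ℕ} (hWn : n * n + 2 * n + 2 < W)
    (hWm : n * (2 * m) + 2 * m + 2 < W) (hd : m ≤ 2 ^ d) {s : Memory} {ε : ℝ} (hε : 0 < ε)
    (hn : s.word 0 0 = n) (hm : s.word 0 1 = m) (hsε : s.real 0 0 = ε)
    (hends : ∀ e < m, s.word 1 e < n ∧ s.word 2 e < n)
    (h6 : ∀ i, s.word 6 i = 0) (h15 : s.word 15 0 = 0) (hr3 : ∀ i, s.real 3 i = 0)
    (hr4 : ∀ i, s.real 4 i = 0)
    (hne : ∀ e < m, s.word 1 e ≠ s.word 2 e)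
    (hinj : ∀ e < m, ∀ e' < m, s.word 1 e' = s.word 1 e ∧ s.word 2 e' = s.word 2 e ∨
      s.word 1 e' = s.word 2 e ∧ s.word 2 e' = s.word 1 e → e' = e) :
    ∃ s' t, Exec W buildData s s' t ∧ t ≤ m * (50 * d + 400) + n * 50 + 30 ∧
      Consistent n m ε s' ∧
      (∀ e < m, s'.word 7 (2 * e) = s.word 1 e ∧ s'.word 7 (2 * e + 1) = s.word 2 e) ∧
      (∀ u < n, s'.word 8 u = u ∧ s'.word 9 u = 1 ∧ s'.word 10 u = 1) ∧
      s'.real 1 = s.real 1 ∧ s'.word 17 0 = s.word 17 0 := by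
  have h0 : 0 < W := by omega
  obtain ⟨s₁, t₁, he₁, ht₁, hI⟩ := exec_insertEdges (by omega) hWm hd hn hm hends h6 h15 hr3 hr4
  obtain ⟨s₂, t₂, he₂, ht₂, hV, hF₂⟩ := exec_insertVertices (W := W) (n := n)
    (s := s₁.setWord 15 0 0) (by omega) (by simp [hI.frame.1 0 (by simp), hn]) (by simp)
  have hw : ∀ a, a ∉ [8, 9, 10, 15] → s₂.word a = s₁.word a := fun a ha => by
    rw [hF₂.1 a ha, Memory.word_setWord_of_ne]
    rintro rfl
    simp at ha
  have hr : s₂.real = s₁.real := funext fun a => hF₂.2 a (by simp)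
  have w0 : s₂.word 0 = s.word 0 := by rw [hw 0 (by simp), hI.frame.1 0 (by simp)]
  have r1 : s₂.real 1 = s.real 1 := by rw [hr, hI.frame.2 1 (by simp)]
  have hends' : ∀ e < m, s₂.word 7 (2 * e) = s.word 1 e ∧ s₂.word 7 (2 * e + 1) = s.word 2 e := by
    rw [hw 7 (by simp)]
    exact hI.ends
  have hL : Lists n (2 * m) (s₂.word 5) (s₂.word 6) (s₂.word 7) (Finset.range (2 * m)) := by
    rw [hw 5 (by simp), hw 6 (by simp), hw 7 (by simp)]
    exact hI.lists
  have hlt : ∀ x, Active m (s₂.word 7) x → x < n := by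
    rintro x ⟨h, hh, rfl⟩
    obtain ⟨pos, -, hp⟩ := hL
    exact (hp h (Finset.mem_range.2 hh)).1
  have hcut : ∀ x y, Active m (s₂.word 7) x → Active m (s₂.word 7) y → x ≠ y →
      s₂.real 3 (x * n + y) = cutWeight (s₂.real 1) (s₂.word 7) m x y := by
    intro x y hx hy hxy
    rw [hr, hI.cut x (hlt x hx) y (hlt y hy) hxy, hw 7 (by simp), hI.frame.2 1 (by simp)]
  have hkey : ∀ e < m, s₂.real 4 (m + e) =
      edgeKey n (s₂.real 3) (s₂.word 10) (s₂.word 7 (2 * e)) (s₂.word 7 (2 * e + 1)) := by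
    intro e he
    obtain ⟨e1, e2⟩ := hends' e he
    have hne' := hne e he
    have hact : Active m (s₂.word 7) (s.word 1 e) ∧ Active m (s₂.word 7) (s.word 2 e) :=
      Joins.active (e := e) (Or.inl ⟨e1, e2⟩) he
    rw [e1, e2, edgeKey, if_neg hne', hcut _ _ hact.1 hact.2 hne',
      (hV _ (hends e he).1).2.2, (hV _ (hends e he).2).2.2, hr, hI.key e he, cutWeight,
      Finset.sum_eq_single e]
    · rw [if_pos (Or.inl ⟨e1, e2⟩), hI.frame.2 1 (by simp)]
      simp
    · intro e' he' hee
      rw [if_neg]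
      intro hJ
      have he'' := Finset.mem_range.1 he'
      simp only [Joins, (hends' e' he'').1, (hends' e' he'').2] at hJ
      exact hee (hinj e he e' he'' hJ)
    · intro h
      exact absurd (Finset.mem_range.2 he) h
  refine ⟨s₂, _, .seq he₁ (.seq (.setWord (k := 0) (x := 0) ?_ ?_) he₂), ?_,
    ⟨?_, hL, hcut, ?_, ?_, ?_, ?_⟩, hends', hV, r1, ?_⟩
  · simp [WordExpr.eval, fit, h0]
  · simp [WordExpr.eval, fit, h0]
  · simp only [WordExpr.time]
    omega
  · rw [w0, hr, hI.frame.2 0 (by simp)]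
    exact ⟨hn, hm, hsε⟩
  · rw [hr]
    exact hI.tree
  · intro x hx
    obtain ⟨-, h9, h10⟩ := hV x (hlt x hx)
    rw [h9, h10]
    refine ⟨le_rfl, le_rfl, ?_⟩
    push_cast
    linarith
  · exact fun e he => (hkey e he).le
  · exact fun e he => ⟨e, he, Or.inl ⟨rfl, rfl⟩, hkey e he⟩
  · rw [hw 17 (by simp), hI.frame.1 17 (by simp)]

/-! ## The graph and the dendrogram -/

/-- The clusters of the half-edges are the clusters `cl` of their ends. -/
def EndsIn {n : ℕ} (L : List (Fin n × Fin n)) (cl : Fin n → ℕ) (rep : ℕ → ℕ) : Prop :=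
  ∀ e (he : e < L.length), rep (2 * e) = cl L[e].1 ∧ rep (2 * e + 1) = cl L[e].2

/-- The cluster with the name `a`. -/
def fiber {n : ℕ} (cl : Fin n → ℕ) (a : ℕ) : Finset (Fin n) := Finset.univ.filter fun x => cl x = a

@[simp] theorem mem_fiber {n : ℕ} {cl : Fin n → ℕ} {a : ℕ} {x : Fin n} :
    x ∈ fiber cl a ↔ cl x = a := by simp [fiber]

section Graph

variable {n : ℕ} {G : SimpleGraph (Fin n)} {L : List (Fin n × Fin n)} {cl : Fin n → ℕ}
  {rep : ℕ → ℕ}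

theorem IsEdgeList.adj_iff (hL : IsEdgeList G L) (x y : Fin n) :
    G.Adj x y ↔ ∃ e, ∃ he : e < L.length, s(L[e].1, L[e].2) = s(x, y) := by
  rw [← SimpleGraph.mem_edgeSet, ← hL.2, List.mem_map]
  constructor
  · rintro ⟨p, hp, hpe⟩
    obtain ⟨e, he, rfl⟩ := List.mem_iff_getElem.1 hp
    exact ⟨e, he, hpe⟩
  · rintro ⟨e, he, h⟩
    exact ⟨L[e], List.getElem_mem he, h⟩

theorem IsEdgeList.adj (hL : IsEdgeList G L) {e : ℕ} (he : e < L.length) :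
    G.Adj L[e].1 L[e].2 := (hL.adj_iff _ _).2 ⟨e, he, rfl⟩

theorem IsEdgeList.inj (hL : IsEdgeList G L) {e e' : ℕ} (he : e < L.length) (he' : e' < L.length)
    (h : s(L[e].1, L[e].2) = s(L[e'].1, L[e'].2)) : e = e' := by
  have := hL.1.getElem_inj_iff (i := e) (j := e') (hi := by simpa using he)
    (hj := by simpa using he')
  rw [← this]
  simpa using h

theorem IsEdgeList.length_eq [DecidableRel G.Adj] (hL : IsEdgeList G L) :
    L.length = G.edgeFinset.card := by
  classical
  rw [← List.length_map (fun p => s(p.1, p.2)), ← List.toFinset_card_of_nodup hL.1]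
  congr 1
  ext e
  rw [List.mem_toFinset, hL.2, SimpleGraph.mem_edgeFinset]

theorem sum_interedges [DecidableRel G.Adj] (hL : IsEdgeList G L) (hends : EndsIn L cl rep)
    (w : Sym2 (Fin n) → ℝ) {wt : ℕ → ℝ}
    (hwt : ∀ e (he : e < L.length), wt e = w s(L[e].1, L[e].2)) {a b : ℕ} (hab : a ≠ b) :
    ∑ p ∈ G.interedges (fiber cl a) (fiber cl b), w s(p.1, p.2) =
      cutWeight wt rep L.length a b := by
  symm
  rw [cutWeight, Finset.sum_range, ← Finset.sum_filter]
  refine Finset.sum_bij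
    (fun (e : Fin L.length) _ => if cl L[e].1 = a then L[e] else L[e].swap) ?_ ?_ ?_ ?_
  · intro e he
    have hJ := (Finset.mem_filter.1 he).2
    simp only [Joins, (hends e e.2).1, (hends e e.2).2] at hJ
    have hadj := hL.adj e.2
    rw [SimpleGraph.mem_interedges_iff]
    rcases hJ with ⟨h1, h2⟩ | ⟨h1, h2⟩
    · simpa [h1, h2] using hadj
    · have : b ≠ a := hab.symm
      simpa [h1, h2, this] using hadj.symm
  · intro e he e' he' h
    refine Fin.ext (hL.inj e.2 e'.2 ?_)
    have hs : ∀ e : Fin L.length, s((if cl L[e].1 = a then L[e] else L[e].swap).1,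
        (if cl L[e].1 = a then L[e] else L[e].swap).2) = s(L[e].1, L[e].2) := by
      intro e
      split_ifs
      · rfl
      · exact Sym2.eq_swap
    exact (hs e).symm.trans ((by rw [h] : _ = _).trans (hs e'))
  · rintro ⟨x, y⟩ hp
    obtain ⟨hx, hy, hadj⟩ := SimpleGraph.mem_interedges_iff _ |>.1 hp
    rw [mem_fiber] at hx hy
    obtain ⟨e, he, hs⟩ := (hL.adj_iff x y).1 hadj
    refine ⟨⟨e, he⟩, ?_, ?_⟩
    · rw [Finset.mem_filter]
      refine ⟨Finset.mem_univ _, ?_⟩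
      simp only [Joins, (hends e he).1, (hends e he).2]
      rcases Sym2.eq_iff.1 hs with ⟨h1, h2⟩ | ⟨h1, h2⟩
      · exact Or.inl ⟨by rw [h1, hx], by rw [h2, hy]⟩
      · exact Or.inr ⟨by rw [h1, hy], by rw [h2, hx]⟩
    · rcases Sym2.eq_iff.1 hs with ⟨h1, h2⟩ | ⟨h1, h2⟩
      · simp only [Fin.getElem_fin, h1, hx, if_true]
        exact Prod.ext h1 h2
      · have : b ≠ a := hab.symm
        simp only [Fin.getElem_fin, h1, hy, this, if_false]
        exact Prod.ext h2 h1
  · intro e he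
    rw [hwt e e.2]
    split_ifs
    · rfl
    · rw [Sym2.eq_swap]
      rfl

theorem interedges_nonempty_iff [DecidableRel G.Adj] (hL : IsEdgeList G L)
    (hends : EndsIn L cl rep) (a b : ℕ) :
    (G.interedges (fiber cl a) (fiber cl b)).Nonempty ↔ ∃ e < L.length, Joins rep e a b := by
  constructor
  · rintro ⟨⟨x, y⟩, hp⟩
    obtain ⟨hx, hy, hadj⟩ := SimpleGraph.mem_interedges_iff _ |>.1 hp
    rw [mem_fiber] at hx hy
    obtain ⟨e, he, hs⟩ := (hL.adj_iff x y).1 hadj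
    refine ⟨e, he, ?_⟩
    simp only [Joins, (hends e he).1, (hends e he).2]
    rcases Sym2.eq_iff.1 hs with ⟨h1, h2⟩ | ⟨h1, h2⟩
    · exact Or.inl ⟨by rw [h1, hx], by rw [h2, hy]⟩
    · exact Or.inr ⟨by rw [h1, hy], by rw [h2, hx]⟩
  · rintro ⟨e, he, hJ⟩
    simp only [Joins, (hends e he).1, (hends e he).2] at hJ
    rcases hJ with ⟨h1, h2⟩ | ⟨h1, h2⟩
    · exact ⟨L[e], by simpa [SimpleGraph.mem_interedges_iff, h1, h2] using hL.adj he⟩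
    · exact ⟨L[e].swap, by simpa [SimpleGraph.mem_interedges_iff, h1, h2] using (hL.adj he).symm⟩

theorem active_iff (hn : 2 ≤ n) (hG : G.Connected) (hL : IsEdgeList G L)
    (hends : EndsIn L cl rep) (a : ℕ) : Active L.length rep a ↔ ∃ x, cl x = a := by
  constructor
  · rintro ⟨h, hh, rfl⟩
    rcases Nat.even_or_odd' h with ⟨e, rfl | rfl⟩
    · exact ⟨_, (hends e (by omega)).1.symm⟩
    · exact ⟨_, (hends e (by omega)).2.symm⟩
  · rintro ⟨x, rfl⟩
    have : Nontrivial (Fin n) := Fin.nontrivial_iff_two_le.2 hn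
    obtain ⟨y, hxy⟩ := hG.preconnected.exists_adj_of_nontrivial x
    obtain ⟨e, he, hs⟩ := (hL.adj_iff x y).1 hxy
    rcases Sym2.eq_iff.1 hs with ⟨h1, h2⟩ | ⟨h1, h2⟩
    · exact ⟨2 * e, by omega, by rw [(hends e he).1, h1]⟩
    · exact ⟨2 * e + 1, by omega, by rw [(hends e he).2, h2]⟩

theorem exists_crossing_edge (hG : G.Connected) (hL : IsEdgeList G L)
    (hends : EndsIn L cl rep) {x y : Fin n} (hxy : cl x ≠ cl y) :
    ∃ e < L.length, rep (2 * e) ≠ rep (2 * e + 1) := by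
  by_contra! hcon
  have hadj : ∀ a b, G.Adj a b → cl a = cl b := by
    intro a b hab
    obtain ⟨e, he, hs⟩ := (hL.adj_iff a b).1 hab
    have h := hcon e he
    rw [(hends e he).1, (hends e he).2] at h
    rcases Sym2.eq_iff.1 hs with ⟨h1, h2⟩ | ⟨h1, h2⟩
    · rwa [h1, h2] at h
    · rw [h1, h2] at h
      exact h.symm
  obtain ⟨p⟩ := hG.preconnected x y
  refine hxy ?_
  induction p with
  | nil => rfl
  | cons h _ ih => exact (hadj _ _ h).trans (ih (fun h' => hxy ((hadj _ _ h).trans h')))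

end Graph

section Dendrogram

variable {D D' : Dendrogram} {n i : ℕ}

theorem Dendrogram.cluster_congr (h : ∀ j < i, D.left j = D'.left j ∧ D.right j = D'.right j) :
    D.cluster n i = D'.cluster n i := by
  induction i with
  | zero => rfl
  | succ i ih =>
    rw [cluster, cluster, ih fun j hj => h j (by omega), (h i (by omega)).1, (h i (by omega)).2]

theorem Dendrogram.active_congr (h : ∀ j < i, D.left j = D'.left j ∧ D.right j = D'.right j) :
    D.active n i = D'.active n i := by
  induction i with
  | zero => rfl
  | succ i ih =>
    rw [active, active, ih fun j hj => h j (by omega), (h i (by omega)).1, (h i (by omega)).2]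

/-- Merge number `i` of the dendrogram is `ε`-close. -/
def Dendrogram.CloseAt (D : Dendrogram) {n : ℕ} (G : SimpleGraph (Fin n)) [DecidableRel G.Adj]
    (w : Sym2 (Fin n) → ℝ) (ε : ℝ) (i : ℕ) : Prop :=
  D.IsEdge G i (D.left i) (D.right i) ∧
    D.weight i = D.similarity G w i (D.left i) (D.right i) ∧
    ∃ Wmax : ℝ,
      IsGreatest {x | ∃ a b, D.IsEdge G i a b ∧ x = D.similarity G w i a b} Wmax ∧
      (1 - ε) * Wmax ≤ D.similarity G w i (D.left i) (D.right i)

theorem Dendrogram.CloseAt.congr {G : SimpleGraph (Fin n)} [DecidableRel G.Adj]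
    {w : Sym2 (Fin n) → ℝ} {ε : ℝ} (hc : D.CloseAt G w ε i)
    (h : ∀ j ≤ i, D.left j = D'.left j ∧ D.right j = D'.right j)
    (hw : D.weight i = D'.weight i) : D'.CloseAt G w ε i := by
  have hcl : D.cluster n i = D'.cluster n i := cluster_congr fun j hj => h j hj.le
  have hac : D.active n i = D'.active n i := active_congr fun j hj => h j hj.le
  simpa only [CloseAt, IsEdge, similarity, hcl, hac, hw, (h i le_rfl).1, (h i le_rfl).2] using hc

end Dendrogram

/-- After `i` merges, the memory and its output agree with the clusters `cl`. -/
structure Represents {n : ℕ} (G : SimpleGraph (Fin n)) [DecidableRel G.Adj]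
    (w : Sym2 (Fin n) → ℝ) (L : List (Fin n × Fin n)) (ε : ℝ) (i : ℕ) (cl : Fin n → ℕ)
    (s : Memory) : Prop where
  index : s.word 17 0 = i
  ends : EndsIn L cl (s.word 7)
  weights : ∀ e (he : e < L.length), s.real 1 e = w s(L[e].1, L[e].2)
  cluster : ∀ x, (outputDendrogram s).cluster n i (s.word 8 (cl x)) = fiber cl (cl x)
  node_lt : ∀ x, s.word 8 (cl x) < n + i
  node_inj : ∀ x y, s.word 8 (cl x) = s.word 8 (cl y) → cl x = cl y
  active : (outputDendrogram s).active n i = Finset.univ.image fun x => s.word 8 (cl x)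
  card : (Finset.univ.image cl).card + i = n
  size : ∀ x, s.word 9 (cl x) = (fiber cl (cl x)).card
  close : ∀ j < i, (outputDendrogram s).CloseAt G w ε j

section Represents

variable {n : ℕ} {G : SimpleGraph (Fin n)} [DecidableRel G.Adj] {w : Sym2 (Fin n) → ℝ}
  {L : List (Fin n × Fin n)} {ε : ℝ} {i : ℕ} {cl : Fin n → ℕ} {s s' : Memory}

theorem Represents.isEdge_iff (h : Represents G w L ε i cl s) (hL : IsEdgeList G L) (x y : Fin n) :
    (outputDendrogram s).IsEdge G i (s.word 8 (cl x)) (s.word 8 (cl y)) ↔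
      cl x ≠ cl y ∧ ∃ e < L.length, Joins (s.word 7) e (cl x) (cl y) := by
  rw [Dendrogram.IsEdge, h.active, h.cluster, h.cluster, interedges_nonempty_iff hL h.ends]
  have hne : s.word 8 (cl x) ≠ s.word 8 (cl y) ↔ cl x ≠ cl y :=
    not_congr ⟨h.node_inj x y, fun h => by rw [h]⟩
  simp [hne]

theorem Represents.similarity (h : Represents G w L ε i cl s) (hL : IsEdgeList G L) {x y : Fin n}
    (hxy : cl x ≠ cl y) :
    (outputDendrogram s).similarity G w i (s.word 8 (cl x)) (s.word 8 (cl y)) =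
      cutWeight (s.real 1) (s.word 7) L.length (cl x) (cl y) /
        (s.word 9 (cl x) * s.word 9 (cl y)) := by
  rw [Dendrogram.similarity, avgLinkage, h.cluster, h.cluster,
    sum_interedges hL h.ends w h.weights hxy, h.size, h.size]

theorem Represents.of_frame (h : Represents G w L ε i cl s)
    (hF : Frame [11, 12, 14, 16, 18, 19, 20] [] s s') : Represents G w L ε i cl s' := by
  have hr : s'.real = s.real := funext fun a => hF.2 a (by simp)
  have hD : outputDendrogram s' = outputDendrogram s := by
    simp only [outputDendrogram, hr, hF.1 3 (by simp), hF.1 4 (by simp)]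
  obtain ⟨h1, h2, h3, h4, h5, h6, h7, h8, h9, h10⟩ := h
  constructor <;> simpa only [hD, hr, hF.1 17 (by simp), hF.1 7 (by simp), hF.1 8 (by simp),
    hF.1 9 (by simp)]

theorem Represents.merged {T : Finset ℕ} {x y : Fin n} (h : Represents G w L ε i cl s)
    (hL : IsEdgeList G L) (hM : Merged n L.length ε i (cl x) (cl y) T s s')
    (hxy : cl x ≠ cl y) {e : ℕ} (he : e < L.length) (hJ : Joins (s.word 7) e (cl x) (cl y))
    (hC : Consistent n L.length ε s)
    (hclose : ∀ a b e', cl a ≠ cl b → e' < L.length → Joins (s.word 7) e' (cl a) (cl b) →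
      (1 - ε) * (cutWeight (s.real 1) (s.word 7) L.length (cl a) (cl b) /
        (s.word 9 (cl a) * s.word 9 (cl b))) ≤
      cutWeight (s.real 1) (s.word 7) L.length (cl x) (cl y) /
        (s.word 9 (cl x) * s.word 9 (cl y))) :
    Represents G w L ε (i + 1) (fun z => if cl z = cl y then cl x else cl z) s' := by
  have hpre : ∀ j < i, (outputDendrogram s').left j = (outputDendrogram s).left j ∧
      (outputDendrogram s').right j = (outputDendrogram s).right j := fun j hj => by
    simp only [outputDendrogram, hM.left, hM.right]
    rw [Function.update_of_ne (by omega), Function.update_of_ne (by omega)]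
    exact ⟨rfl, rfl⟩
  have hcl : (outputDendrogram s').cluster n i = (outputDendrogram s).cluster n i :=
    Dendrogram.cluster_congr hpre
  have hac : (outputDendrogram s').active n i = (outputDendrogram s).active n i :=
    Dendrogram.active_congr hpre
  have hl : (outputDendrogram s').left i = s.word 8 (cl x) := by simp [outputDendrogram, hM.left]
  have hr : (outputDendrogram s').right i = s.word 8 (cl y) := by
    simp [outputDendrogram, hM.right]
  have hnode : ∀ z, cl z ≠ cl x → s'.word 8 (cl z) = s.word 8 (cl z) := fun z hz => by
    rw [hM.node, Function.update_of_ne hz]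
  have hnodeu : s'.word 8 (cl x) = n + i := by rw [hM.node, Function.update_self]
  have hfib : fiber (fun z => if cl z = cl y then cl x else cl z) (cl x) =
      fiber cl (cl x) ∪ fiber cl (cl y) := by
    ext z
    simp only [mem_fiber, Finset.mem_union]
    split_ifs with hz <;> simp [hz]
  have hfib' : ∀ z, cl z ≠ cl x → cl z ≠ cl y →
      fiber (fun z => if cl z = cl y then cl x else cl z) (cl z) = fiber cl (cl z) := by
    intro z hzx hzy
    ext z'
    simp only [mem_fiber]
    split_ifs with hz
    · rw [hz]
      exact ⟨fun h => absurd h.symm hzx, fun h => absurd h.symm hzy⟩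
    · rfl
  have hcases : ∀ z, (if cl z = cl y then cl x else cl z) = cl x ∨
      (cl z ≠ cl x ∧ cl z ≠ cl y ∧ (if cl z = cl y then cl x else cl z) = cl z) := by
    intro z
    split_ifs with hz
    · exact Or.inl rfl
    · by_cases hzx : cl z = cl x
      · exact Or.inl hzx
      · exact Or.inr ⟨hzx, hz, rfl⟩
  refine ⟨hM.index, ?_, ?_, ?_, ?_, ?_, ?_, ?_, ?_, ?_⟩
  · intro e he
    rw [hM.rep _ (by omega), hM.rep _ (by omega), (h.ends e he).1, (h.ends e he).2]
    exact ⟨rfl, rfl⟩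
  · rw [hM.input.2.2]
    exact h.weights
  · intro z
    rw [Dendrogram.cluster, hcl, hl, hr]
    rcases hcases z with hz | ⟨hzx, hzy, hz⟩
    · simp only [hz]
      rw [hnodeu, Function.update_self, h.cluster, h.cluster, hfib]
    · simp only [hz]
      have := h.node_lt z
      rw [hnode z hzx, Function.update_of_ne (by omega), h.cluster, hfib' z hzx hzy]
  · intro z
    rcases hcases z with hz | ⟨hzx, hzy, hz⟩
    · simp only [hz]
      rw [hnodeu]
      omega
    · simp only [hz]
      have := h.node_lt z
      rw [hnode z hzx]
      omega
  · intro z z'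
    have h1 := h.node_lt z
    have h2 := h.node_lt z'
    rcases hcases z with hz | ⟨hzx, hzy, hz⟩ <;> rcases hcases z' with hz' | ⟨hzx', hzy', hz'⟩ <;>
      simp only [hz, hz']
    · simp
    · rw [hnodeu, hnode z' hzx']
      omega
    · rw [hnodeu, hnode z hzx]
      omega
    · rw [hnode z hzx, hnode z' hzx']
      exact h.node_inj z z'
  · rw [Dendrogram.active, hac, hl, hr, h.active]
    ext k
    simp only [Finset.mem_insert, Finset.mem_erase, Finset.mem_image, Finset.mem_univ, true_and]
    constructor
    · rintro (rfl | ⟨hk1, hk2, z, rfl⟩)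
      · exact ⟨x, by simp [hxy, hnodeu]⟩
      · have hzx : cl z ≠ cl x := fun h => hk2 (by rw [h])
        have hzy : cl z ≠ cl y := fun h => hk1 (by rw [h])
        exact ⟨z, by rw [if_neg hzy, hnode z hzx]⟩
    · rintro ⟨z, rfl⟩
      rcases hcases z with hz | ⟨hzx, hzy, hz⟩
      · rw [hz]
        exact Or.inl hnodeu
      · rw [hz, hnode z hzx]
        exact Or.inr ⟨fun h' => hzy (h.node_inj _ _ h'), fun h' => hzx (h.node_inj _ _ h'), z, rfl⟩
  · have himg : Finset.univ.image (fun z => if cl z = cl y then cl x else cl z) =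
        (Finset.univ.image cl).erase (cl y) := by
      ext k
      simp only [Finset.mem_erase, Finset.mem_image, Finset.mem_univ, true_and]
      constructor
      · rintro ⟨z, rfl⟩
        split_ifs with hz
        · exact ⟨hxy, x, rfl⟩
        · exact ⟨hz, z, rfl⟩
      · rintro ⟨hk, z, rfl⟩
        exact ⟨z, if_neg hk⟩
    have hmem : cl y ∈ Finset.univ.image cl := Finset.mem_image_of_mem _ (Finset.mem_univ _)
    have hpos := Finset.card_pos.2 ⟨_, hmem⟩
    have := h.card
    rw [himg, Finset.card_erase_of_mem hmem]
    omega
  · intro z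
    rcases hcases z with hz | ⟨hzx, hzy, hz⟩
    · simp only [hz]
      rw [hM.size, Function.update_self, h.size, h.size, hfib, Finset.card_union_of_disjoint]
      rw [Finset.disjoint_left]
      intro z' h1 h2
      rw [mem_fiber] at h1 h2
      exact hxy (h1.symm.trans h2)
    · simp only [hz]
      rw [hM.size, Function.update_of_ne hzx, h.size, hfib' z hzx hzy]
  · intro j hj
    rcases Nat.lt_succ_iff_lt_or_eq.1 hj with hj | rfl
    · refine (h.close j hj).congr (fun j' hj' => ?_) ?_
      · obtain ⟨h1, h2⟩ := hpre j' (by omega)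
        exact ⟨h1.symm, h2.symm⟩
      · simp only [outputDendrogram, hM.weight]
        rw [Function.update_of_ne (by omega)]
    · have hedge : ∀ a b, (outputDendrogram s').IsEdge G j a b ↔
          (outputDendrogram s).IsEdge G j a b := fun a b => by
        simp only [Dendrogram.IsEdge, hcl, hac]
      have hsim : ∀ a b, (outputDendrogram s').similarity G w j a b =
          (outputDendrogram s).similarity G w j a b := fun a b => by
        simp only [Dendrogram.similarity, hcl]
      simp only [Dendrogram.CloseAt, hedge, hsim, hl, hr]
      have hE := (h.isEdge_iff hL x y).2 ⟨hxy, e, he, hJ⟩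
      refine ⟨hE, ?_, ?_⟩
      · rw [h.similarity hL hxy]
        simp only [outputDendrogram, hM.weight, Function.update_self]
        rw [hC.cut _ _ (hJ.active he).1 (hJ.active he).2 hxy]
      · let E : Set (ℕ × ℕ) := {p | (outputDendrogram s).IsEdge G j p.1 p.2}
        have hfin : E.Finite := by
          refine Set.Finite.subset (((outputDendrogram s).active n j) ×ˢ
            ((outputDendrogram s).active n j)).finite_toSet ?_
          rintro ⟨a, b⟩ hab
          exact Finset.mem_coe.2 (Finset.mem_product.2 ⟨hab.1, hab.2.1⟩)
        obtain ⟨⟨a, b⟩, hab, hmax⟩ := Set.exists_max_image E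
          (fun p => (outputDendrogram s).similarity G w j p.1 p.2) hfin ⟨(_, _), hE⟩
        refine ⟨_, ⟨⟨a, b, hab, rfl⟩, ?_⟩, ?_⟩
        · rintro _ ⟨a', b', hab', rfl⟩
          exact hmax (a', b') hab'
        · have ha : a ∈ (outputDendrogram s).active n j := hab.1
          have hb : b ∈ (outputDendrogram s).active n j := hab.2.1
          rw [h.active, Finset.mem_image] at ha hb
          obtain ⟨p, -, rfl⟩ := ha
          obtain ⟨q, -, rfl⟩ := hb
          obtain ⟨hpq, e', he', hJ'⟩ := (h.isEdge_iff hL p q).1 hab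
          rw [h.similarity hL hpq, h.similarity hL hxy]
          exact hclose p q e' hpq he' hJ'

end Represents

/-! ## The clustering program -/

/-- The clustering program. -/
def cluster : Program :=
  .seq buildData
    (.loop (.wordLt (.add (.var 17) (.lit 1)) (.get 0 (.lit 0))) (.seq select merge))

section Rounds

variable {n : ℕ} {G : SimpleGraph (Fin n)} [DecidableRel G.Adj] {w : Sym2 (Fin n) → ℝ}
  {L : List (Fin n × Fin n)} {ε : ℝ} {i : ℕ} {cl : Fin n → ℕ} {s : Memory}

theorem IsEdgeList.two_mul_length_le (hL : IsEdgeList G L) : 2 * L.length ≤ n * n := by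
  have h1 := G.card_edgeFinset_le_card_choose_two
  rw [← hL.length_eq, Fintype.card_fin, Nat.choose_two_right] at h1
  have h2 : n * (n - 1) ≤ n * n := Nat.mul_le_mul_left _ (by omega)
  omega

theorem IsEdgeList.le_length (hL : IsEdgeList G L) (hG : G.Connected) : n ≤ L.length + 1 := by
  have h1 := hG.card_vert_le_card_edgeSet_add_one
  rwa [Nat.card_eq_fintype_card, Fintype.card_fin, Nat.card_eq_fintype_card,
    ← SimpleGraph.edgeFinset_card, ← hL.length_eq] at h1

theorem exec_round {W d : ℕ} (hn : 2 ≤ n) (hG : G.Connected) (hw : ∀ e ∈ G.edgeSet, 0 ≤ w e)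
    (hL : IsEdgeList G L) (hε : 0 < ε) (hε1 : ε < 1) (hWn : n * n + 2 * n + 2 < W)
    (hWm : n * (2 * L.length) + 2 * L.length + 2 < W) (hd : L.length ≤ 2 ^ d)
    (hR : Represents G w L ε i cl s) (hC : Consistent n L.length ε s) (hi : i + 1 < n) :
    ∃ cl' s' t, Exec W (.seq select merge) s s' t ∧
      (t + 20 : ℕ) * Real.log (1 + ε / 4) ≤ (50 * d + 620) *
        (Real.log (1 + ε / 4) + (potential L.length s' - potential L.length s)) ∧
      Represents G w L ε (i + 1) cl' s' ∧ Consistent n L.length ε s' := by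
  have hlog : 0 ≤ Real.log (1 + ε / 4) := Real.log_nonneg (by linarith)
  have hm : 1 ≤ L.length := by
    have := hL.le_length hG
    omega
  obtain ⟨s₁, t₁, e, u, v, he₁, ht₁, hem, hmax, hJ, hsz, hu, hv, hF⟩ :=
    exec_select (W := W) (d := d) (s := s) (by nlinarith) hm hd hC.input.2.1 hC.tree
  have hR₁ := hR.of_frame hF
  have hC₁ := hC.of_frame hF
  have w7 : s₁.word 7 = s.word 7 := hF.1 7 (by simp)
  have w9 : s₁.word 9 = s.word 9 := hF.1 9 (by simp)
  have w10 : s₁.word 10 = s.word 10 := hF.1 10 (by simp)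
  have r4 : s₁.real 4 = s.real 4 := hF.2 4 (by simp)
  have hpot : potential L.length s₁ = potential L.length s := by
    simp only [potential, w7, w10]
  rw [← r4] at hmax
  rw [← w7] at hJ
  rw [← w9] at hsz
  have hwt : ∀ e < L.length, 0 ≤ s₁.real 1 e := fun e he => by
    rw [hR₁.weights e he]
    exact hw _ (hL.adj he)
  obtain ⟨x₀, y₀, hxy₀⟩ : ∃ x₀ y₀, cl x₀ ≠ cl y₀ := by
    have h1 : 1 < (Finset.univ.image cl).card := by
      have := hR.card
      omega
    obtain ⟨a, ha, b, hb, hab⟩ := Finset.one_lt_card.1 h1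
    obtain ⟨x, -, rfl⟩ := Finset.mem_image.1 ha
    obtain ⟨y, -, rfl⟩ := Finset.mem_image.1 hb
    exact ⟨x, y, hab⟩
  obtain ⟨e₀, he₀, hne₀⟩ := exists_crossing_edge hG hL hR₁.ends hxy₀
  have huv := hC₁.ne_of_max hwt hmax hem hJ he₀ (Or.inl ⟨rfl, rfl⟩) hne₀
  have hau := (hJ.active hem).1
  have hav := (hJ.active hem).2
  obtain ⟨x, rfl⟩ := (active_iff hn hG hL hR₁.ends u).1 hau
  obtain ⟨y, rfl⟩ := (active_iff hn hG hL hR₁.ends v).1 hav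
  have hsizes : ∀ z, Active L.length (s₁.word 7) z → s₁.word 10 z ≠ 0 ∧ s₁.word 9 z ≠ 0 :=
    fun z hz => by
      have := hC₁.sizes z hz
      omega
  have hsum : s₁.word 9 (cl x) + s₁.word 9 (cl y) ≤ n := by
    rw [hR₁.size, hR₁.size, ← Finset.card_union_of_disjoint]
    · simpa using Finset.card_le_univ (fiber cl (cl x) ∪ fiber cl (cl y))
    · rw [Finset.disjoint_left]
      intro z h1 h2
      rw [mem_fiber] at h1 h2
      exact huv (h1.symm.trans h2)
  obtain ⟨s₂, t₂, T, he₂, ht₂, hM⟩ := exec_merge (ε := ε) (i := i) hWn hWm hd hC₁.input.1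
    hC₁.input.2.1 hC₁.input.2.2 hu hv hR₁.index (by omega) (hC₁.active_lt hau)
    (hC₁.active_lt hav) huv hC₁.lists hC₁.cut hC₁.tree (hsizes _ hau).2 (hsizes _ hav).2 hsum
    (fun j hj => (hsizes _ ⟨j, hj, rfl⟩).1) (hsizes _ hau).1
  have hcard := hM.card_le hC₁ hε hε1 hau hav hsz
  refine ⟨_, s₂, _, .seq he₁ he₂, ?_,
    hR₁.merged hL hM huv hem hJ hC₁ fun a b e' hab he' hJ' =>
      hC₁.close_of_max hε hε1 hwt hmax hem hJ huv he' hJ' hab,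
    hM.consistent hC₁ hε hwt hau huv⟩
  rw [hpot] at hcard
  have ht : t₁ + t₂ + 20 ≤ (50 * d + 620) * (1 + T.card) := by
    have : (50 * d + 620) * (1 + T.card) =
        50 * d + 620 + T.card * (50 * d + 600) + 20 * T.card := by ring
    omega
  have ht' : ((t₁ + t₂ + 20 : ℕ) : ℝ) ≤ (50 * d + 620) * (1 + T.card) := by exact_mod_cast ht
  calc ((t₁ + t₂ + 20 : ℕ) : ℝ) * Real.log (1 + ε / 4)
      ≤ (50 * d + 620) * (1 + T.card) * Real.log (1 + ε / 4) :=
        mul_le_mul_of_nonneg_right ht' hlog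
    _ = (50 * d + 620) * (Real.log (1 + ε / 4) + T.card * Real.log (1 + ε / 4)) := by ring
    _ ≤ _ := by gcongr

theorem Represents.potential_le (hn : 2 ≤ n) (hG : G.Connected) (hL : IsEdgeList G L)
    (hR : Represents G w L ε i cl s) (hC : Consistent n L.length ε s) :
    potential L.length s ≤ 2 * L.length * Real.log n := by
  have : ∀ h ∈ Finset.range (2 * L.length),
      Real.log (s.word 10 (s.word 7 h)) ≤ Real.log n := fun h hh => by
    have hact : Active L.length (s.word 7) (s.word 7 h) := ⟨h, Finset.mem_range.1 hh, rfl⟩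
    obtain ⟨h1, h2, -⟩ := hC.sizes _ hact
    obtain ⟨x, hx⟩ := (active_iff hn hG hL hR.ends _).1 hact
    have h3 : s.word 9 (s.word 7 h) ≤ n := by
      rw [← hx, hR.size]
      simpa using Finset.card_le_univ (fiber cl (cl x))
    exact Real.log_le_log (by exact_mod_cast h1) (by exact_mod_cast h2.trans h3)
  refine (Finset.sum_le_sum this).trans_eq ?_
  simp

theorem exec_cluster {W d : ℕ} (hn : 2 ≤ n) (hG : G.Connected) (hw : ∀ e ∈ G.edgeSet, 0 ≤ w e)
    (hL : IsEdgeList G L) (hε : 0 < ε) (hε1 : ε < 1) (hWn : n * n + 2 * n + 2 < W)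
    (hWm : n * (2 * L.length) + 2 * L.length + 2 < W) (hd : L.length ≤ 2 ^ d) :
    ∃ s t, Exec W cluster (inputMemory L w ε) s t ∧
      ((t : ℝ) ≤ L.length * (50 * d + 400) + n * 50 + 50 +
        (50 * d + 620) * (n + 2 * L.length * Real.log n / Real.log (1 + ε / 4))) ∧
      (outputDendrogram s).IsClose G w ε := by
  have hlog : 0 < Real.log (1 + ε / 4) := Real.log_pos (by linarith)
  have h0 : 0 < W := by omega
  have h1 : 1 < W := by omega
  have hnW : n < W := by nlinarith
  set s₀ := inputMemory L w ε with hs₀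
  have hends : ∀ e (he : e < L.length), s₀.word 1 e = (L[e].1 : ℕ) ∧ s₀.word 2 e = (L[e].2 : ℕ) :=
    fun e he => by simp [hs₀, inputMemory, he]
  have hwt : ∀ e (he : e < L.length), s₀.real 1 e = w s(L[e].1, L[e].2) :=
    fun e he => by simp [hs₀, inputMemory, he]
  obtain ⟨s₁, t₁, he₁, ht₁, hC₁, hrep₁, hV₁, hr₁, h17⟩ := exec_buildData (W := W) (n := n)
    (m := L.length) (d := d) (s := s₀) (ε := ε) hWn hWm hd hε (by simp [hs₀, inputMemory])
    (by simp [hs₀, inputMemory]) (by simp [hs₀, inputMemory])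
    (fun e he => by rw [(hends e he).1, (hends e he).2]; exact ⟨L[e].1.2, L[e].2.2⟩)
    (by simp [hs₀, inputMemory]) (by simp [hs₀, inputMemory]) (by simp [hs₀, inputMemory])
    (by simp [hs₀, inputMemory])
    (fun e he => by
      rw [(hends e he).1, (hends e he).2]
      exact fun h => (hL.adj he).ne (Fin.ext h))
    (fun e he e' he' h => by
      rw [(hends e he).1, (hends e he).2, (hends e' he').1, (hends e' he').2] at h
      refine hL.inj he' he (Sym2.eq_iff.2 ?_)
      simpa only [Fin.ext_iff] using h)
  have hR₁ : Represents G w L ε 0 (fun x => (x : ℕ)) s₁ := by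
    have hinj : ∀ x : Fin n, fiber (fun x : Fin n => (x : ℕ)) (x : ℕ) = {x} := fun x => by
      ext y
      simp [Fin.ext_iff]
    have h8 : ∀ x : Fin n, s₁.word 8 (x : ℕ) = x := fun x => (hV₁ x x.2).1
    refine ⟨?_, ?_, ?_, ?_, ?_, ?_, ?_, ?_, ?_, by simp⟩
    · rw [h17]; simp [hs₀, inputMemory]
    · intro e he
      rw [(hrep₁ e he).1, (hrep₁ e he).2]
      exact hends e he
    · rw [hr₁]; exact hwt
    · intro x
      rw [h8, hinj]
      simp [Dendrogram.cluster]
    · intro x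
      rw [h8]
      omega
    · intro x y h
      rwa [h8, h8] at h
    · ext k
      simp only [h8, Dendrogram.active, Finset.mem_range, Finset.mem_image, Finset.mem_univ,
        true_and]
      exact ⟨fun hk => ⟨⟨k, hk⟩, rfl⟩, by rintro ⟨x, rfl⟩; exact x.2⟩
    · rw [Finset.card_image_of_injective _ Fin.val_injective]
      simp
    · intro x
      rw [(hV₁ x x.2).2.1, hinj]
      simp
  have hpot₁ : potential L.length s₁ = 0 := by
    refine Finset.sum_eq_zero fun h hh => ?_
    rw [(hV₁ _ (hC₁.active_lt ⟨h, Finset.mem_range.1 hh, rfl⟩)).2.2]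
    simp
  obtain ⟨s₂, t₂, he₂, ⟨cl, hR₂, hC₂⟩, ht₂⟩ := exec_loop (W := W)
    (b := .wordLt (.add (.var 17) (.lit 1)) (.get 0 (.lit 0))) (p := .seq select merge)
    (fun i s t => (∃ cl, Represents G w L ε i cl s ∧ Consistent n L.length ε s) ∧
      (t : ℝ) * Real.log (1 + ε / 4) ≤
        (50 * d + 620) * (i * Real.log (1 + ε / 4) + potential L.length s))
    (n - 1)
    (fun i hi s t ⟨⟨cl, hR, hC⟩, ht⟩ => by
      have hiW : i + 1 < W := by omega
      refine ⟨?_, ?_⟩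
      · simp [Test.eval, WordExpr.eval, fit, h0, h1, hR.index, hC.input.1, hiW]
        omega
      · obtain ⟨cl', s', t', he, ht', hR', hC'⟩ := exec_round hn hG hw hL hε hε1 hWn hWm hd hR hC
          (by omega)
        refine ⟨s', t', he, ⟨cl', hR', hC'⟩, ?_⟩
        have hb : (Test.wordLt (.add (.var 17) (.lit 1)) (.get 0 (.lit 0))).time + 1 + t' ≤
            t' + 20 := by
          simp only [Test.time, WordExpr.time]
          omega
        have hb' : ((Test.wordLt (.add (.var 17) (.lit 1)) (.get 0 (.lit 0))).time + 1 + t' : ℕ) *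
            Real.log (1 + ε / 4) ≤ (t' + 20 : ℕ) * Real.log (1 + ε / 4) :=
          mul_le_mul_of_nonneg_right (by exact_mod_cast hb) hlog.le
        rw [Nat.cast_add t, Nat.cast_add i, add_mul]
        push_cast at ht' hb' ⊢
        linarith)
    (fun s t ⟨⟨cl, hR, hC⟩, ht⟩ => by
      have hiW : n - 1 + 1 < W := by
        omega
      simp [Test.eval, WordExpr.eval, fit, h0, h1, hR.index, hC.input.1, hiW]
      omega)
    (s := s₁) ⟨⟨_, hR₁, hC₁⟩, by simp [hpot₁]⟩
  refine ⟨s₂, _, .seq he₁ he₂, ?_, fun i hi => hR₂.close i hi⟩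
  have hpot := hR₂.potential_le hn hG hL hC₂
  have ht₂' : (t₂ : ℝ) ≤
      (50 * d + 620) * (n + 2 * L.length * Real.log n / Real.log (1 + ε / 4)) := by
    rw [← le_div_iff₀ hlog] at ht₂
    refine ht₂.trans ?_
    rw [mul_div_assoc, add_div, mul_div_cancel_right₀ _ hlog.ne']
    gcongr
    exact Nat.sub_le _ _
  have ht₁' : (t₁ : ℝ) ≤ L.length * (50 * d + 400) + n * 50 + 30 := by exact_mod_cast ht₁
  simp only [Test.time, WordExpr.time]
  push_cast
  linarith

end Rounds

/-- The bound on the running time in terms of `m * (log n) ^ 2`. -/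
theorem time_bound {n m d : ℕ} {l : ℝ} (hn : 2 ≤ n) (hl : 0 < l) (hm : 1 ≤ m) (hnm : n ≤ m + 1)
    (hd : d = 2 * Nat.clog 2 n) :
    (m : ℝ) * (50 * d + 400) + n * 50 + 50 + (50 * d + 620) * (n + 2 * m * Real.log n / l) ≤
      (20000 + 5000 / l) * m * Real.log n ^ 2 := by
  have hn' : (2 : ℝ) ≤ n := by exact_mod_cast hn
  have hlog2 : 0.69 ≤ Real.log 2 := by linarith [Real.log_two_gt_d9]
  have hx2 : Real.log 2 ≤ Real.log n := Real.log_le_log (by norm_num) hn'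
  have hc : (Nat.clog 2 n - 1 : ℝ) * Real.log 2 ≤ Real.log n := by
    have h1 := Nat.pow_pred_clog_lt_self (b := 2) (by norm_num) (x := n) (by omega)
    have h2 : ((2 : ℝ) ^ (Nat.clog 2 n).pred) ≤ n := by exact_mod_cast h1.le
    have h3 := Real.log_le_log (by positivity) h2
    rw [Real.log_pow] at h3
    have h4 : 1 ≤ Nat.clog 2 n := Nat.clog_pos (by norm_num) hn
    rwa [Nat.pred_eq_sub_one, Nat.cast_sub h4, Nat.cast_one] at h3
  set x := Real.log n
  have hdx : (d : ℝ) ≤ 6 * x := by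
    rw [hd]
    push_cast
    nlinarith
  have h1 : 1 ≤ 1.5 * x := by linarith
  have hm' : (1 : ℝ) ≤ m := by exact_mod_cast hm
  have hnm' : (n : ℝ) ≤ 2 * m := by
    have : (n : ℝ) ≤ m + 1 := by exact_mod_cast hnm
    linarith
  have hx0 : 0 < x := by linarith
  have hxx : x ≤ 1.5 * x ^ 2 := by nlinarith
  have hd' : 50 * (d : ℝ) + 620 ≤ 1230 * x := by linarith
  have hk : (50 * d + 620) * (n + 2 * m * x / l) ≤ (1230 * x) * (2 * m + 2 * m * x / l) := by
    gcongr
  have e1 : (1230 * x) * (2 * m + 2 * m * x / l) = 2460 * (m * x) + 2460 / l * m * x ^ 2 := by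
    ring
  have e2 : (m : ℝ) * (50 * d + 400) ≤ 1230 * (m * x) := by nlinarith
  have e3 : (n : ℝ) * 50 + 50 ≤ 250 * (m * x) := by nlinarith
  have e4 : (m : ℝ) * x ≤ 1.5 * (m * x ^ 2) := by nlinarith
  have e5 : (0 : ℝ) ≤ 2540 / l * m * x ^ 2 := by positivity
  have e6 : (0 : ℝ) ≤ m * x ^ 2 := by positivity
  have e7 : (20000 + 5000 / l) * m * x ^ 2 =
      20000 * (m * x ^ 2) + 2460 / l * m * x ^ 2 + 2540 / l * m * x ^ 2 := by ring
  linarith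

end HAC

/-- There is one program that performs, for every `ε` with `0 < ε < 1`, `ε`-close average-linkage
clustering in time `O(m log² n)`, on words of `O(log n)` bits; the constant factor in the running
time depends only on `ε`. -/
theorem mainTheorem5 :
    ∃ (P : RealRAM.Program) (c : ℕ), ∀ ε : ℝ, 0 < ε → ε < 1 → ∃ C : ℝ,
      ∀ (n : ℕ) (G : SimpleGraph (Fin n)) [DecidableRel G.Adj] (w : Sym2 (Fin n) → ℝ)
        (L : List (Fin n × Fin n)),
        2 ≤ n → G.Connected → (∀ e ∈ G.edgeSet, 0 ≤ w e) → HAC.IsEdgeList G L →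
        ∃ (s : RealRAM.Memory) (t : ℕ),
          RealRAM.Exec (n ^ c) P (HAC.inputMemory L w ε) s t ∧
          (t : ℝ) ≤ C * (G.edgeFinset.card : ℝ) * Real.log (n : ℝ) ^ 2 ∧
          (HAC.outputDendrogram s).IsClose G w ε := by
  refine ⟨HAC.cluster, 6, fun ε hε hε1 => ⟨20000 + 5000 / Real.log (1 + ε / 4), ?_⟩⟩
  intro n G _ w L hn hG hw hL
  have hmn := hL.two_mul_length_le
  have hnm := hL.le_length hG
  have h6 : 8 * n ^ 3 ≤ n ^ 6 := by
    have h3 : 2 ^ 3 ≤ n ^ 3 := Nat.pow_le_pow_left hn 3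
    calc 8 * n ^ 3 ≤ n ^ 3 * n ^ 3 := Nat.mul_le_mul_right _ h3
      _ = n ^ 6 := by ring
  have h3 : n * (2 * L.length) ≤ n ^ 3 := by
    calc n * (2 * L.length) ≤ n * (n * n) := Nat.mul_le_mul_left _ hmn
      _ = n ^ 3 := by ring
  have h2 : 2 * (n * n) ≤ n ^ 3 := by
    calc 2 * (n * n) ≤ n * (n * n) := Nat.mul_le_mul_right _ hn
      _ = n ^ 3 := by ring
  have h1 : 2 * n ≤ n * n := Nat.mul_le_mul_right _ hn
  have hd : L.length ≤ 2 ^ (2 * Nat.clog 2 n) := by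
    have hc := Nat.le_pow_clog (b := 2) (by norm_num) n
    calc L.length ≤ n * n := by omega
      _ ≤ 2 ^ Nat.clog 2 n * 2 ^ Nat.clog 2 n := Nat.mul_le_mul hc hc
      _ = 2 ^ (2 * Nat.clog 2 n) := by rw [← pow_add, two_mul]
  obtain ⟨s, t, he, ht, hclose⟩ := HAC.exec_cluster (W := n ^ 6) hn hG hw hL hε hε1 (by omega)
    (by omega) hd
  refine ⟨s, t, he, ht.trans ?_, hclose⟩
  rw [← hL.length_eq]
  exact HAC.time_bound hn (Real.log_pos (by linarith)) (by omega) hnm rfl
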